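/- All graphs are finite, simple and undirected. A graph $\Gamma$ is \emph{amply regular} with parameters $(v,k,\lambda,\mu)$ if it is $k$-regular on $v$ vertices, any two adjacent vertices have exactly $\lambda$ common neighbours, and any two vertices at distance $2$ have exactly $\mu$ common neighbours. It is \emph{$2$-walk-regular} if, for every $n\ge 0$, the number of walks of length $n$ between two vertices at distance at most $2$ depends only on $n$ and on their distance. A \emph{symmetric association scheme with $n$ classes} on a finite set $X$ is a family of non-empty relations $R_0,\dots,R_n\subseteq X\times X$ whose adjacency matrices $F_0,\dots,F_n$ are symmetric and satisfy $F_0=I$, $\sum_i F_i=J$, and $F_iF_j\in\operatorname{span}_{\mathbb C}(F_0,\dots,F_n)$ for all $i,j$; for $i\neq 0$, its \emph{relation graph} with respect to $R_i$ is the graph $(X,R_i)$. Let $\Delta_{4.1}$ be the point-block incidence graph of the square $2$-$(7,4,2)$ design (unique up to isomorphism; its points are the elements of $\mathbb Z/7$, its blocks the translates of $\{0,3,5,6\}$), and let $\square$ denote the Cartesian product of graphs. \textbf{Theorem.} Let $\Gamma$ be a connected amply regular graph with diameter $d\ge 4$ and parameters $(v,k,\lambda,\mu)$, where $k\ge 5$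 is odd and $\mu=\frac{k-1}{2}$. Then one of the following holds. (1) $\Gamma$ is isomorphic to the $5$-cube. (2) $\Gamma$ is isomorphic to $K_2\,\square\,\Delta_{4.1}$, which has diameter $4$ and is amply regular with parameters $(28,5,0,2)$. (3) There is a symmetric association scheme $R_0,\dots,R_5$ with $5$ classes on the vertex set $V(\Gamma)$ such that $\Gamma$ is the relation graph of one of the relations $R_i$ with $i\neq0$, and such that the distribution diagram of the scheme with respect to $R_i$ is the following one: for every vertex $x$, the sets $B_j(x)=\{y : (x,y)\in R_j\}$, $0\le j\le 5$, have sizes $$(|B_0|,\dots,|B_5|)=(1,\;k,\;2k,\;k,\;1,\;2),$$ and every vertex of $B_a(x)$ has exactly $q_{ab}$ neighbours of $\Gamma$ in $B_b(x)$, where $$(q_{ab})_{0\le a,b\le 5}=\begin{pmatrix}0&k&0&0&0&0\\1&0&k-1&0&0&0\\0&\frac{k-1}{2}&0&\frac{k-1}{2}&0&1\\0&0&k-1&0&1&0\\0&0&0&k&0&0\\0&0&k&0&0&0\end{pmatrix}.$$ Moreover, in this case $\Gamma$ is bipartite and $2$-walk-regular, has $4k+4$ vertices and diameter $4$, and its adjacency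 matrix has exactly $6$ distinct eigenvalues. -/

import Mathlib

open scoped Matrix

section GraphNotions

variable {V : Type*}

/-- The amply regular graphs with parameters `(v, k, lam, mu)`. -/
structure SimpleGraph.IsAmplyRegularWith [Fintype V] [DecidableEq V] (G : SimpleGraph V)
    [DecidableRel G.Adj] (v k lam mu : ℕ) : Prop where
  card : Fintype.card V = v
  regular : G.IsRegularOfDegree k
  of_adj : ∀ x y, G.Adj x y → Fintype.card (G.commonNeighbors x y) = lam
  of_dist_two : ∀ x y, G.dist x y = 2 → Fintype.card (G.commonNeighbors x y) = mu

/-- `G` is `t`-walk-regular: for every `n`, the number of walks of length `n` between two vertices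
at (extended) distance at most `t` depends only on their distance. -/
def SimpleGraph.IsWalkRegular (G : SimpleGraph V) (t : ℕ) : Prop :=
  ∀ (n : ℕ) (x y x' y' : V), G.edist x y ≤ t → G.edist x' y' = G.edist x y →
    Set.ncard {p : G.Walk x' y' | p.length = n} = Set.ncard {p : G.Walk x y | p.length = n}

/-- The set of eigenvalues of a finite graph, that is, of its (real symmetric) adjacency matrix. -/
def SimpleGraph.eigenvalueSet [Fintype V] [DecidableEq V] (G : SimpleGraph V)
    [DecidableRel G.Adj] : Set ℝ :=
  {θ | Module.End.HasEigenvalue (Matrix.toLin' (G.adjMatrix ℝ)) θ}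

/-- The family `B` is an equitable partition of the vertex set of `G` into blocks `B i` of size
`p i`, such that every vertex of `B i` has exactly `q i j` neighbours in `B j`.  This is the
information recorded by the distribution diagram of `G` with respect to `B`. -/
structure SimpleGraph.HasDistributionDiagram (G : SimpleGraph V) {ι : Type*} (B : ι → Set V)
    (p : ι → ℕ) (q : Matrix ι ι ℕ) : Prop where
  nonempty : ∀ i, (B i).Nonempty
  partition : ∀ x, ∃! i, x ∈ B i
  size : ∀ i, (B i).ncard = p i
  equitable : ∀ i, ∀ x ∈ B i, ∀ j, (G.neighborSet x ∩ B j).ncard = q i j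

end GraphNotions

section AssociationSchemes

open Classical in
/-- The adjacency matrix over `ℂ` of a binary relation. -/
noncomputable def relMatrix {X : Type*} (R : X → X → Prop) : Matrix X X ℂ :=
  Matrix.of fun x y => if R x y then 1 else 0

/-- An association scheme with `n` classes on the finite set `X`, with relations `R 0, …, R n`. -/
structure AssocScheme (X : Type*) [Fintype X] [DecidableEq X] (n : ℕ) where
  /-- the relations of the scheme -/
  R : Fin (n + 1) → X → X → Prop
  nonempty : ∀ i, ∃ x y, R i x y
  zero_eq_one : relMatrix (R 0) = 1
  sum_eq_allOnes : ∑ i, relMatrix (R i) = Matrix.of fun _ _ => 1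
  transpose_mem : ∀ i, ∃ j, (relMatrix (R i))ᵀ = relMatrix (R j)
  mul_mem : ∀ i j, relMatrix (R i) * relMatrix (R j) ∈
    Submodule.span ℂ (Set.range fun l => relMatrix (R l))

variable {X : Type*} [Fintype X] [DecidableEq X] {n : ℕ}

/-- The scheme is symmetric: all of its adjacency matrices are symmetric. -/
def AssocScheme.IsSymmetric (S : AssocScheme X n) : Prop :=
  ∀ i, (relMatrix (S.R i)).IsSymm

theorem AssocScheme.IsSymmetric.rel_symm {S : AssocScheme X n} (hS : S.IsSymmetric)
    (i : Fin (n + 1)) {x y : X} (h : S.R i x y) : S.R i y x := by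
  have h1 := (hS i).apply x y
  by_contra h2
  simp [relMatrix, h, h2] at h1

theorem AssocScheme.rel_irrefl (S : AssocScheme X n) {i : Fin (n + 1)} (hi : i ≠ 0) (x : X) :
    ¬ S.R i x x := by
  classical
  intro h
  have h0 : relMatrix (S.R 0) x x = 1 := by rw [S.zero_eq_one]; simp
  have hs := congrFun (congrFun S.sum_eq_allOnes x) x
  rw [Matrix.sum_apply] at hs
  have hR0 : S.R 0 x x := by
    by_contra h2
    simp [relMatrix, h2] at h0
  simp only [relMatrix, Matrix.of_apply, Finset.sum_boole] at hs
  have hs' : (Finset.univ.filter fun j => S.R j x x).card = 1 := by exact_mod_cast hs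
  obtain ⟨a, ha⟩ := Finset.card_eq_one.mp hs'
  have e0 : (0 : Fin (n + 1)) ∈ ({a} : Finset (Fin (n + 1))) := by rw [← ha]; simpa using hR0
  have e1 : i ∈ ({a} : Finset (Fin (n + 1))) := by rw [← ha]; simpa using h
  rw [Finset.mem_singleton] at e0 e1
  exact hi (e1.trans e0.symm)

/-- The relation graph of a nontrivial relation of a symmetric association scheme. -/
def AssocScheme.relationGraph (S : AssocScheme X n) (hS : S.IsSymmetric) (i : Fin (n + 1))
    (hi : i ≠ 0) : SimpleGraph X where
  Adj := S.R i
  symm := ⟨fun _ _ h => hS.rel_symm i h⟩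
  loopless := ⟨fun x => S.rel_irrefl hi x⟩

/-- The distribution diagram of the symmetric association scheme `S` with respect to the relation
`R i` has balloons of sizes `p` and quotient matrix `q`: for every vertex `x`, this holds for the
relation graph of `R i` and the partition into the sets `{y | R j x y}`. -/
def AssocScheme.HasDistributionDiagram (S : AssocScheme X n) (hS : S.IsSymmetric)
    (i : Fin (n + 1)) (hi : i ≠ 0) (p : Fin (n + 1) → ℕ)
    (q : Matrix (Fin (n + 1)) (Fin (n + 1)) ℕ) : Prop :=
  ∀ x : X, (S.relationGraph hS i hi).HasDistributionDiagram (fun j => {y | S.R j x y}) p q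

end AssociationSchemes

section SpecificGraphs

/-- The `n`-cube: binary words of length `n`, adjacent when they differ in exactly one place. -/
def hypercubeGraph (n : ℕ) : SimpleGraph (Fin n → Fin 2) where
  Adj x y := hammingDist x y = 1
  symm := ⟨fun x y h => by rw [hammingDist_comm]; exact h⟩
  loopless := ⟨fun x h => by simp [hammingDist_self] at h⟩

/-- The point-block incidence graph of an incidence structure. -/
def incidenceGraph {P B : Type*} (I : P → B → Prop) : SimpleGraph (P ⊕ B) where
  Adj
    | .inl p, .inr b => I p b
    | .inr b, .inl p => I p b
    | _, _ => False
  symm := ⟨by rintro (p | b) (p' | b') h <;> exact h⟩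
  loopless := ⟨by rintro (p | b) h <;> exact h⟩

/-- `I` is a square `2`-`(w, k, l)` design: there are `w` points and `w` blocks, each block has
`k` points, and any two distinct points lie in exactly `l` blocks. -/
structure IsSquareDesign {P B : Type*} (I : P → B → Prop) (w k l : ℕ) : Prop where
  card_points : Nat.card P = w
  card_blocks : Nat.card B = w
  block_size : ∀ b, Set.ncard {p | I p b} = k
  pair_count : ∀ p p', p ≠ p' → Set.ncard {b | I p b ∧ I p' b} = l

/-- The cyclic design on `ℤ/7` whose blocks are the translates of `{0, 3, 5, 6}`
(the complement of the Fano plane). -/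
def design742 (p b : ZMod 7) : Prop := p - b ∈ ({0, 3, 5, 6} : Finset (ZMod 7))

instance (p b : ZMod 7) : Decidable (design742 p b) := by
  unfold design742; infer_instance

theorem design742_isSquareDesign : IsSquareDesign design742 7 4 2 where
  card_points := by simp
  card_blocks := by simp
  block_size := by
    have h : ∀ b : ZMod 7, (Finset.univ.filter fun p => design742 p b).card = 4 := by decide
    intro b
    rw [← h b, ← Set.ncard_coe_finset]
    congr 1; ext; simp
  pair_count := by
    have h : ∀ p p' : ZMod 7, p ≠ p' →
        (Finset.univ.filter fun b => design742 p b ∧ design742 p' b).card = 2 := by decide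
    intro p p' hp
    rw [← h p p' hp, ← Set.ncard_coe_finset]
    congr 1; ext; simp

/-- The graph `Δ_{4.1}`: the point-block incidence graph of the square `2`-`(7, 4, 2)` design
(which is unique up to isomorphism). -/
def delta41 : SimpleGraph (ZMod 7 ⊕ ZMod 7) := incidenceGraph design742

end SpecificGraphs

section Diagram

/-- The balloon sizes of the diagram.  Balloon `0` is the base vertex `x`, balloon `1` its
neighbours, balloon `2` the vertices at distance two, balloon `3` the neighbours of the vertex
opposite to `x`, balloon `4` that opposite vertex, and balloon `5` the two remaining vertices at
distance three. -/
def diagramSizes (k : ℕ) : Fin 6 → ℕ := ![1, k, 2 * k, k, 1, 2]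

/-- The quotient matrix of the diagram (for odd `k`, so that `(k - 1) / 2` is exact). -/
def diagramMatrix (k : ℕ) : Matrix (Fin 6) (Fin 6) ℕ :=
  !![0, k,           0,     0,           0, 0;
     1, 0,           k - 1, 0,           0, 0;
     0, (k - 1) / 2, 0,     (k - 1) / 2, 0, 1;
     0, 0,           k - 1, 0,           1, 0;
     0, 0,           0,     k,           0, 0;
     0, 0,           k,     0,           0, 0]

end Diagram

/-! Write `k = 2μ + 1`, let `x` and `z` be at distance four, and call `mid x z` the middle layer. A
layer vertex has `μ` neighbours next to `x`, `μ` next to `z`, and hence exactly one more, its third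
neighbour (`exists_third`). Double counting around a neighbour `a` of `x` that meets the layer gives
`λ = 0` (`lam_eq_zero`). A second count shows, for `μ ≥ 3`, that all neighbours of `a` other than
`x` lie in the layer (`mem_mid_of_three_le`). For `μ = 2` that count gives no contradiction, and
this is the source of the two exceptional graphs.

If the second property holds for all such pairs (`IsTight`), the layer is the full second
neighbourhood of `x` and is independent, and the third neighbours send all their edges back into it.
Connectedness then leaves no room for other vertices (`covering`), and counting edges gives the
block sizes. Antipodes are unique, and the neighbours of a vertex with an antipode have antipodes
too, so the same diagram holds around every vertex. The six relation matrices are polynomials in the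
adjacency matrix and form a scheme; walk counts and eigenvalues are read off the 6 × 6 quotient.

Otherwise `k = 5` and `μ = 2`, and some neighbour `a` of `x` has three layer neighbours and one
neighbour `e ≠ x` outside (`BadConfig`). The tool is a parity rule (`third_eq_iff`): two layer
vertices have no or two common neighbours, at most one next to each end, so an even number of three
possible coincidences occur. Let `a'` be the second common neighbour of `x` and `e`. If `a'` misses
the layer, the other neighbours of `x` carry configurations that fit together to the 5-cube
(`exists_cubeGraph`). If `a'` meets the layer, the configurations at `a` and `a'` are paired and the
parity rule forces `K₂ □ Δ` (`exists_pairedGraph`). In both cases the neighbourhood table is a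
covering map from the model graph with a one-point fibre, hence an isomorphism
(`nonempty_iso_of_cover`). -/

set_option linter.unusedSectionVars false

/-! ### The middle layer, the vanishing of `λ`, and tightness for `μ ≥ 3`. -/

section Basics

variable {V : Type*} [Fintype V] [DecidableEq V]

/-- `G` is `k`-regular, adjacent vertices have `lam` common neighbours, and distinct nonadjacent
vertices with a common neighbour have `mu` of them. -/
structure SimpleGraph.HasCounts (G : SimpleGraph V) [DecidableRel G.Adj] (k lam mu : ℕ) :
    Prop where
  card_nbr : ∀ x, (G.neighborFinset x).card = k
  card_of_adj : ∀ x y, G.Adj x y → (G.neighborFinset x ∩ G.neighborFinset y).card = lam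
  card_of_not_adj : ∀ x y p, x ≠ y → ¬ G.Adj x y → G.Adj x p → G.Adj y p →
    (G.neighborFinset x ∩ G.neighborFinset y).card = mu

/-- No walk of length at most three joins `x` and `z`. -/
structure SimpleGraph.Far (G : SimpleGraph V) (x z : V) : Prop where
  ne : x ≠ z
  not_adj : ¬ G.Adj x z
  not_two : ∀ p, G.Adj x p → ¬ G.Adj p z
  not_three : ∀ p q, G.Adj x p → G.Adj p q → ¬ G.Adj q z

/-- The vertices that are joined to both `x` and `z` by walks of length two. -/
def SimpleGraph.mid (G : SimpleGraph V) [DecidableRel G.Adj] (x z : V) : Finset V :=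
  Finset.univ.filter fun y => (∃ p, G.Adj x p ∧ G.Adj y p) ∧ ∃ q, G.Adj z q ∧ G.Adj y q

variable {G : SimpleGraph V} [DecidableRel G.Adj] {k lam mu : ℕ} {x z y a e : V}

theorem SimpleGraph.mem_mid :
    y ∈ G.mid x z ↔ (∃ p, G.Adj x p ∧ G.Adj y p) ∧ ∃ q, G.Adj z q ∧ G.Adj y q := by
  simp [SimpleGraph.mid]

theorem SimpleGraph.mid_comm : G.mid x z = G.mid z x := by
  ext y; simp only [SimpleGraph.mem_mid]; tauto

theorem SimpleGraph.Far.symm (h : G.Far x z) : G.Far z x where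
  ne := h.ne.symm
  not_adj := fun h' => h.not_adj h'.symm
  not_two := fun p h1 h2 => h.not_two p h2.symm h1.symm
  not_three := fun p q h1 h2 h3 => h.not_three q p h3.symm h2.symm h1.symm

theorem SimpleGraph.Far.ne_of_mem_mid (h : G.Far x z) (hy : y ∈ G.mid x z) : x ≠ y := by
  obtain ⟨-, q, hq, hyq⟩ := SimpleGraph.mem_mid.1 hy
  rintro rfl
  exact h.not_two q hyq hq.symm

theorem SimpleGraph.Far.not_adj_of_mem_mid (h : G.Far x z) (hy : y ∈ G.mid x z) :
    ¬ G.Adj x y := by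
  obtain ⟨-, q, hq, hyq⟩ := SimpleGraph.mem_mid.1 hy
  exact fun h' => h.not_three y q h' hyq hq.symm

theorem SimpleGraph.HasCounts.card_left (H : G.HasCounts k lam mu) (h : G.Far x z)
    (hy : y ∈ G.mid x z) : (G.neighborFinset x ∩ G.neighborFinset y).card = mu := by
  obtain ⟨⟨p, hp, hyp⟩, -⟩ := SimpleGraph.mem_mid.1 hy
  exact H.card_of_not_adj x y p (h.ne_of_mem_mid hy) (h.not_adj_of_mem_mid hy) hp hyp

/-- No vertex is adjacent to both ends, so the common neighbours of `y` with `x` and with `z` form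
disjoint sets of size `mu`, which use up all but one of the `2 * mu + 1` neighbours of `y`. -/
theorem SimpleGraph.HasCounts.exists_third (H : G.HasCounts k lam mu) (hk : k = 2 * mu + 1)
    (h : G.Far x z) (hy : y ∈ G.mid x z) :
    ∃ w, G.Adj y w ∧ ¬ G.Adj x w ∧ ¬ G.Adj z w ∧
      ∀ u, G.Adj y u → G.Adj x u ∨ G.Adj z u ∨ u = w := by
  have hA := H.card_left h hy
  have hB := H.card_left h.symm (SimpleGraph.mid_comm (G := G) ▸ hy)
  set A := G.neighborFinset x ∩ G.neighborFinset y with hAdef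
  set B := G.neighborFinset z ∩ G.neighborFinset y with hBdef
  have hdis : Disjoint A B := by
    rw [Finset.disjoint_left]
    intro u hu hu'
    simp only [hAdef, hBdef, Finset.mem_inter, SimpleGraph.mem_neighborFinset] at hu hu'
    exact h.not_two u hu.1 hu'.1.symm
  have hsub : A ∪ B ⊆ G.neighborFinset y := by
    intro u hu
    simp only [hAdef, hBdef, Finset.mem_union, Finset.mem_inter] at hu
    tauto
  have hc : (G.neighborFinset y \ (A ∪ B)).card = 1 := by
    rw [Finset.card_sdiff_of_subset hsub, Finset.card_union_of_disjoint hdis, hA, hB,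
      H.card_nbr]
    omega
  obtain ⟨w, hw⟩ := Finset.card_eq_one.1 hc
  have key : ∀ u, u ∈ G.neighborFinset y \ (A ∪ B) ↔ u = w := fun u => by rw [hw]; simp
  simp only [hAdef, hBdef, Finset.mem_sdiff, Finset.mem_union, Finset.mem_inter,
    SimpleGraph.mem_neighborFinset] at key
  have := (key w).2 rfl
  refine ⟨w, this.1, fun h' => this.2 (Or.inl ⟨h', this.1⟩),
    fun h' => this.2 (Or.inr ⟨h', this.1⟩), fun u hu => ?_⟩
  by_cases h1 : G.Adj x u
  · exact Or.inl h1
  by_cases h2 : G.Adj z u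
  · exact Or.inr (Or.inl h2)
  exact Or.inr (Or.inr ((key u).1 ⟨hu, by tauto⟩))

/-- A vertex adjacent to `x` and to a vertex of `mid x z` has `mu` common neighbours with every
neighbour of `z` at distance two, all of them in `mid x z`. -/
theorem SimpleGraph.HasCounts.common_subset_mid (H : G.HasCounts k lam mu) (h : G.Far x z)
    {q : V} (hxa : G.Adj x a) (hzq : G.Adj z q) (hy : G.Adj a y) (hyq : G.Adj q y) :
    (G.neighborFinset a ∩ G.neighborFinset q).card = mu ∧
    G.neighborFinset a ∩ G.neighborFinset q ⊆ G.mid x z ∩ G.neighborFinset a := by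
  constructor
  · apply H.card_of_not_adj a q y _ _ hy hyq
    · rintro rfl
      exact h.not_two a hxa hzq.symm
    · exact fun h' => h.not_three a q hxa h' hzq.symm
  · intro u hu
    simp only [Finset.mem_inter, SimpleGraph.mem_neighborFinset, SimpleGraph.mem_mid] at hu ⊢
    exact ⟨⟨⟨a, hxa, hu.1.symm⟩, q, hzq, hu.2.symm⟩, hu.1⟩

theorem SimpleGraph.HasCounts.le_card_mid_inter (H : G.HasCounts k lam mu) (h : G.Far x z)
    (hy : y ∈ G.mid x z) (hxa : G.Adj x a) (hya : G.Adj y a) :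
    mu ≤ (G.mid x z ∩ G.neighborFinset a).card := by
  obtain ⟨-, q, hq, hyq⟩ := SimpleGraph.mem_mid.1 hy
  obtain ⟨h1, h2⟩ := H.common_subset_mid h hxa hq hya.symm hyq.symm
  exact h1 ▸ Finset.card_le_card h2

/-- For `lam = 1` the neighbourhood of `x` would induce a 1-regular graph on an odd number of
vertices, against the handshake lemma. -/
theorem SimpleGraph.HasCounts.lam_ne_one (H : G.HasCounts k lam mu) (hk : Odd k) (x : V) :
    lam ≠ 1 := by
  rintro rfl
  have hdeg : ∀ v : {v // v ∈ G.neighborFinset x},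
      (G.comap (Subtype.val : {v // v ∈ G.neighborFinset x} → V)).degree v = 1 := by
    rintro ⟨v, hv⟩
    have hv' := (G.mem_neighborFinset x v).1 hv
    rw [← H.card_of_adj x v hv', ← SimpleGraph.card_neighborFinset_eq_degree,
      ← Finset.card_map (Function.Embedding.subtype _)]
    congr 1
    ext u
    simp only [Finset.mem_map, SimpleGraph.mem_neighborFinset, SimpleGraph.comap_adj,
      Function.Embedding.subtype_apply, Subtype.exists, Finset.mem_inter]
    constructor
    · rintro ⟨u', h1, h2, rfl⟩
      exact ⟨h1, h2⟩
    · rintro ⟨h1, h2⟩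
      exact ⟨u, h1, h2, rfl⟩
  have hs := (G.comap (Subtype.val : {v // v ∈ G.neighborFinset x} →
      V)).sum_degrees_eq_twice_card_edges
  rw [Finset.sum_congr rfl fun v _ => hdeg v] at hs
  have : (Finset.univ : Finset {v // v ∈ G.neighborFinset x}).card = k := by
    rw [Finset.card_univ, Fintype.card_coe, H.card_nbr]
  simp only [Finset.sum_const, smul_eq_mul, mul_one, this] at hs
  obtain ⟨m, hm⟩ := hk
  omega

/-- Each vertex `y` of `mid x z` adjacent to `a` sees all but one of the common neighbours of `a`
and `x`. -/
theorem SimpleGraph.HasCounts.lam_le (H : G.HasCounts k lam mu) (hk : k = 2 * mu + 1)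
    (h : G.Far x z) (hy : y ∈ G.mid x z) (hxa : G.Adj x a) (hya : G.Adj y a) :
    lam ≤ ((G.neighborFinset a ∩ G.neighborFinset x) ∩ G.neighborFinset y).card + 1 := by
  obtain ⟨w, hyw, hxw, hzw, hw⟩ := H.exists_third hk h hy
  rw [← H.card_of_adj a y hya.symm]
  refine le_trans (Finset.card_le_card (t := insert w _) fun u hu => ?_)
    (Finset.card_insert_le _ _)
  simp only [Finset.mem_inter, SimpleGraph.mem_neighborFinset, Finset.mem_insert] at hu ⊢
  rcases hw u hu.2 with h1 | h1 | h1
  · tauto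
  · exact absurd h1.symm (h.not_three a u hxa hu.1)
  · tauto

/-- For `lam ≥ 2`, counting edges between the layer neighbours `D` of `a` and the common neighbours
`N` of `a` and `x` gives `|D| ≤ lam`, while `lam ≤ mu ≤ |D|`. In the resulting equality case two
vertices of `D` have `mu + 1` common neighbours, which is too many. -/
theorem SimpleGraph.HasCounts.lam_eq_zero (H : G.HasCounts k lam mu) (hk : k = 2 * mu + 1)
    (hmu : 2 ≤ mu) (h : G.Far x z) (hne : (G.mid x z).Nonempty) : lam = 0 := by
  by_contra hl
  have hl1 : lam ≠ 1 := H.lam_ne_one ⟨mu, hk⟩ x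
  obtain ⟨y, hy⟩ := hne
  obtain ⟨⟨a, hxa, hya⟩, q, hzq, hyq⟩ := SimpleGraph.mem_mid.1 hy
  set D := G.mid x z ∩ G.neighborFinset a with hD
  have hc : mu ≤ D.card := H.le_card_mid_inter h hy hxa hya
  set N := G.neighborFinset a ∩ G.neighborFinset x with hN
  have hNc : N.card = lam := H.card_of_adj a x hxa.symm
  have h1 : D.card * (lam - 1) ≤ N.card * (lam - 1) := by
    refine Finset.card_mul_le_card_mul (fun u n => G.Adj u n) (fun u hu => ?_) fun n hn => ?_
    · simp only [hD, Finset.mem_inter, SimpleGraph.mem_neighborFinset] at hu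
      have h2 := H.lam_le hk h hu.1 hxa hu.2.symm
      have h3 : Finset.bipartiteAbove (fun u n => G.Adj u n) N u = N ∩ G.neighborFinset u := by
        ext n; simp [Finset.bipartiteAbove]
      rw [h3, hN]; omega
    · simp only [hN, Finset.mem_inter, SimpleGraph.mem_neighborFinset] at hn
      -- The vertex `x` is a common neighbour of `a` and `n` outside `D`, so `n` has at most `lam -
      -- 1` neighbours in `D`.
      have h2 : insert x (Finset.bipartiteBelow (fun u n => G.Adj u n) D n) ⊆
          G.neighborFinset a ∩ G.neighborFinset n := by
        intro u hu
        simp only [Finset.bipartiteBelow, hD, Finset.mem_insert, Finset.mem_filter,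
          Finset.mem_inter, SimpleGraph.mem_neighborFinset] at hu ⊢
        rcases hu with rfl | hu
        · exact ⟨hxa.symm, hn.2.symm⟩
        · exact ⟨hu.1.2, hu.2.symm⟩
      have h3 := Finset.card_le_card h2
      rw [H.card_of_adj a n hn.1, Finset.card_insert_of_notMem] at h3
      · omega
      · intro h4
        simp only [Finset.bipartiteBelow, hD, Finset.mem_filter, Finset.mem_inter] at h4
        exact h.ne_of_mem_mid h4.1.1 rfl
  have h2 : D.card ≤ lam := by
    rw [hNc] at h1
    exact Nat.le_of_mul_le_mul_right h1 (by omega)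
  have h3 : lam ≤ mu := by
    have h4 := H.lam_le hk h hy hxa hya
    have h5 : insert a (N ∩ G.neighborFinset y) ⊆ G.neighborFinset x ∩ G.neighborFinset y := by
      intro u hu
      simp only [hN, Finset.mem_insert, Finset.mem_inter, SimpleGraph.mem_neighborFinset]
        at hu ⊢
      rcases hu with rfl | hu
      · exact ⟨hxa, hya⟩
      · tauto
    have h6 := Finset.card_le_card h5
    rw [H.card_left h hy, Finset.card_insert_of_notMem (by simp [hN]), hN] at h6
    omega
  -- Now `|D| = mu`, so the `mu` common neighbours of `a` and such a `q` fill `D`: every `q` is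
  -- adjacent to all of `D`.
  have hDq : ∀ q ∈ G.neighborFinset z ∩ G.neighborFinset y,
      G.neighborFinset a ∩ G.neighborFinset q = D := by
    intro q hq
    simp only [Finset.mem_inter, SimpleGraph.mem_neighborFinset] at hq
    obtain ⟨h4, h5⟩ := H.common_subset_mid h hxa hq.1 hya.symm hq.2.symm
    exact Finset.eq_of_subset_of_card_le h5 (by omega)
  obtain ⟨y', hy', hyy⟩ := Finset.exists_mem_ne (s := D) (by omega) y
  have h7 : insert a (G.neighborFinset z ∩ G.neighborFinset y) ⊆
      G.neighborFinset y ∩ G.neighborFinset y' := by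
    intro u hu
    rw [Finset.mem_insert] at hu
    rcases hu with rfl | hu
    · simp only [hD, Finset.mem_inter, SimpleGraph.mem_neighborFinset] at hy' ⊢
      exact ⟨hya, hy'.2.symm⟩
    · have h8 := hDq u hu ▸ hy'
      simp only [Finset.mem_inter, SimpleGraph.mem_neighborFinset] at hu h8 ⊢
      exact ⟨hu.2, h8.2.symm⟩
  have h8 := Finset.card_le_card h7
  rw [Finset.card_insert_of_notMem, H.card_left h.symm (SimpleGraph.mid_comm (G := G) ▸ hy)]
    at h8
  · simp only [hD, Finset.mem_inter, SimpleGraph.mem_neighborFinset] at hy'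
    by_cases h9 : G.Adj y y'
    · rw [H.card_of_adj y y' h9] at h8; omega
    · rw [H.card_of_not_adj y y' a hyy.symm h9 hya hy'.2.symm] at h8; omega
  · simp only [Finset.mem_inter, SimpleGraph.mem_neighborFinset, not_and]
    exact fun h9 => absurd h9.symm (h.not_two a hxa)

theorem SimpleGraph.HasCounts.not_triangle (H : G.HasCounts k 0 mu) {u v w : V}
    (h1 : G.Adj u v) (h2 : G.Adj v w) : ¬ G.Adj u w := by
  intro h3
  have := H.card_of_adj u w h3
  rw [Finset.card_eq_zero] at this
  exact Finset.notMem_empty v (this ▸ by simp [h1, h2.symm])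

theorem SimpleGraph.HasCounts.card_common (H : G.HasCounts k 0 mu) {u v p : V} (huv : u ≠ v)
    (h1 : G.Adj u p) (h2 : G.Adj v p) :
    (G.neighborFinset u ∩ G.neighborFinset v).card = mu :=
  H.card_of_not_adj u v p huv (H.not_triangle h1 h2.symm) h1 h2

/-- For `mu ≥ 3`, the neighbours of `a` other than `x` lie in `mid x z`. -/
theorem SimpleGraph.HasCounts.mem_mid_of_three_le (H : G.HasCounts k 0 mu)
    (hk : k = 2 * mu + 1) (hmu : 3 ≤ mu) (h : G.Far x z) (hy : y ∈ G.mid x z)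
    (hxa : G.Adj x a) (hya : G.Adj y a) (hae : G.Adj a e) (hex : e ≠ x) : e ∈ G.mid x z := by
  by_contra he
  set D := G.mid x z ∩ G.neighborFinset a with hD
  have hc : mu ≤ D.card := H.le_card_mid_inter h hy hxa hya
  set A := (G.neighborFinset e ∩ G.neighborFinset x).erase a with hA
  have hAe : (G.neighborFinset e ∩ G.neighborFinset x).card = mu :=
    H.card_common hex hae.symm hxa
  have haA : a ∈ G.neighborFinset e ∩ G.neighborFinset x := by simp [hae.symm, hxa]
  have hAc : A.card = mu - 1 := by rw [hA, Finset.card_erase_of_mem haA, hAe]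
  -- Count non-adjacent pairs. A vertex `b` of `A` has at most `mu - 2` neighbours in `D`, since `x`
  -- and `e` are also common neighbours of `a` and `b`. A vertex of `D` misses at most one vertex of
  -- `A`: its `mu` common neighbours with `e` are next to `x`, except possibly its third neighbour.
  have h1 : A.card * (D.card + 2 - mu) ≤ D.card * 1 := by
    refine Finset.card_mul_le_card_mul (fun b u => ¬ G.Adj u b) (fun b hb => ?_) fun u hu => ?_
    · simp only [hA, Finset.mem_erase, Finset.mem_inter, SimpleGraph.mem_neighborFinset] at hb
      have h2 : (D.filter fun u => G.Adj u b) ⊆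
          ((G.neighborFinset a ∩ G.neighborFinset b).erase x).erase e := by
        intro u hu
        simp only [hD, Finset.mem_filter, Finset.mem_inter, SimpleGraph.mem_neighborFinset,
          Finset.mem_erase] at hu ⊢
        refine ⟨?_, (h.ne_of_mem_mid hu.1.1).symm, hu.1.2, hu.2.symm⟩
        rintro rfl
        exact he hu.1.1
      have h3 := Finset.card_le_card h2
      rw [Finset.card_erase_of_mem, Finset.card_erase_of_mem,
        H.card_common hb.1.symm hxa.symm hb.2.2.symm] at h3
      · have h4 := Finset.card_filter_add_card_filter_not (s := D) (fun u => G.Adj u b)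
        simp only [Finset.bipartiteAbove]
        omega
      · simp [hxa.symm, hb.2.2.symm]
      · simp [hex, hae, hb.2.1.symm]
    · simp only [hD, Finset.mem_inter, SimpleGraph.mem_neighborFinset] at hu
      obtain ⟨w, hyw, hxw, hzw, hw⟩ := H.exists_third hk h hu.1
      have heu : e ≠ u := by rintro rfl; exact he hu.1
      have h2 := H.card_common heu hae.symm hu.2.symm
      have h3 : G.neighborFinset e ∩ G.neighborFinset u ⊆
          insert w ((G.neighborFinset e ∩ G.neighborFinset x).filter fun b => G.Adj u b) := by
        intro b hb
        simp only [Finset.mem_inter, SimpleGraph.mem_neighborFinset, Finset.mem_insert,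
          Finset.mem_filter] at hb ⊢
        rcases hw b hb.2 with h4 | h4 | h4
        · tauto
        · exact absurd (SimpleGraph.mem_mid.2 ⟨⟨a, hxa, hae.symm⟩, b, h4, hb.1⟩) he
        · tauto
      have h4 := (Finset.card_le_card h3).trans (Finset.card_insert_le _ _)
      have h5 := Finset.card_filter_add_card_filter_not
        (s := G.neighborFinset e ∩ G.neighborFinset x) (fun b => G.Adj u b)
      have h6 : (Finset.bipartiteBelow (fun b u => ¬ G.Adj u b) A u).card ≤
          ((G.neighborFinset e ∩ G.neighborFinset x).filter fun b => ¬ G.Adj u b).card := by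
        apply Finset.card_le_card
        intro b hb
        simp only [Finset.bipartiteBelow, hA, Finset.mem_filter, Finset.mem_erase] at hb ⊢
        tauto
      omega
  rw [hAc] at h1
  obtain ⟨m, rfl⟩ := Nat.exists_eq_add_of_le hmu
  obtain ⟨c, hc'⟩ := Nat.exists_eq_add_of_le hc
  rw [hc'] at h1
  have e1 : 3 + m - 1 = m + 2 := by omega
  have e2 : 3 + m + c + 2 - (3 + m) = c + 2 := by omega
  rw [e1, e2] at h1
  -- With `mu = 3 + m` and `|D| = mu + c` the count reads `(m + 2) * (c + 2) ≤ 3 + m + c`. For `mu =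
  -- 2` it would be the equality `c + 2 = 2 + c`.
  nlinarith [Nat.zero_le (m * c)]

end Basics

/-! ### Global structure of tight graphs. -/

section Tight

variable {V : Type*} [Fintype V] [DecidableEq V]

/-- `G` is triangle-free of valency `2 * mu + 1` with constant `mu`, and in the interval between
two vertices at distance four every vertex next to an end has a single neighbour outside. -/
structure SimpleGraph.IsTight (G : SimpleGraph V) [DecidableRel G.Adj] (mu : ℕ) : Prop extends
    G.HasCounts (2 * mu + 1) 0 mu where
  two_le : 2 ≤ mu
  mem_mid : ∀ x z y a e, G.Far x z → y ∈ G.mid x z → G.Adj x a → G.Adj y a → G.Adj a e →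
    e ≠ x → e ∈ G.mid x z

/-- `x` and `z` are at distance four. -/
structure SimpleGraph.Opp (G : SimpleGraph V) [DecidableRel G.Adj] (x z : V) : Prop extends
    G.Far x z where
  nonempty : (G.mid x z).Nonempty

variable {G : SimpleGraph V} [DecidableRel G.Adj] {mu : ℕ} {x z y a e : V}

/-- The form in which connectedness is used: a property of one vertex that passes along edges holds
everywhere. -/
theorem SimpleGraph.Connected.mem_of_closed (hG : G.Connected) {S : Set V} (hx : x ∈ S)
    (hS : ∀ u ∈ S, ∀ v, G.Adj u v → v ∈ S) (v : V) : v ∈ S := by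
  obtain ⟨p⟩ := hG.preconnected x v
  induction p with
  | nil => exact hx
  | cons h p ih => exact ih (hS _ hx _ h)

theorem SimpleGraph.Opp.symm (O : G.Opp x z) : G.Opp z x where
  toFar := O.toFar.symm
  nonempty := SimpleGraph.mid_comm (G := G) ▸ O.nonempty

theorem SimpleGraph.mem_mid_symm (h : y ∈ G.mid x z) : y ∈ G.mid z x :=
  SimpleGraph.mid_comm (G := G) ▸ h

namespace SimpleGraph.IsTight

theorem exists_other (T : G.IsTight mu) {u v p : V} (huv : u ≠ v) (h1 : G.Adj u p)
    (h2 : G.Adj v p) : ∃ q, q ≠ p ∧ G.Adj u q ∧ G.Adj v q := by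
  have h := T.card_common huv h1 h2
  have := T.two_le
  obtain ⟨q, hq, hne⟩ := Finset.exists_mem_ne
    (s := G.neighborFinset u ∩ G.neighborFinset v) (by omega) p
  simp only [Finset.mem_inter, SimpleGraph.mem_neighborFinset] at hq
  exact ⟨q, hne, hq⟩

theorem exists_nbr_ne (T : G.IsTight mu) (u v : V) : ∃ t, t ≠ v ∧ G.Adj u t := by
  have h := T.card_nbr u
  have := T.two_le
  obtain ⟨t, ht, hne⟩ := Finset.exists_mem_ne (s := G.neighborFinset u) (by omega) v
  exact ⟨t, hne, by simpa using ht⟩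

/-- Tightness speaks only of neighbours of `x` that meet the layer. Any neighbour `a` does: it
shares with one that does, `b`, a common neighbour `t ≠ x`, and `t` lies in the layer. -/
theorem mem_mid_of_adj (T : G.IsTight mu) (O : G.Opp x z) (hxa : G.Adj x a) (hae : G.Adj a e)
    (hex : e ≠ x) : e ∈ G.mid x z := by
  obtain ⟨y, hy⟩ := O.nonempty
  obtain ⟨⟨b, hxb, hyb⟩, -⟩ := SimpleGraph.mem_mid.1 hy
  by_cases hab : a = b
  · subst hab
    exact T.mem_mid x z y a e O.toFar hy hxa hyb hae hex
  obtain ⟨t, htx, hat, hbt⟩ := T.exists_other hab hxa.symm hxb.symm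
  have ht := T.mem_mid x z y b t O.toFar hy hxb hyb hbt htx
  exact T.mem_mid x z t a e O.toFar ht hxa hat.symm hae hex

theorem mem_mid_iff (T : G.IsTight mu) (O : G.Opp x z) :
    y ∈ G.mid x z ↔ x ≠ y ∧ ∃ p, G.Adj x p ∧ G.Adj y p := by
  constructor
  · exact fun h => ⟨O.ne_of_mem_mid h, (SimpleGraph.mem_mid.1 h).1⟩
  · rintro ⟨h1, p, h2, h3⟩
    exact T.mem_mid_of_adj O h2 h3.symm h1.symm

/-- A layer neighbour of `v` can only be its third neighbour. But an edge `u v` of the layer would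
extend to a quadrangle `b u v t` with `b` next to `x`, and `t` would be a second layer neighbour of
`v`. -/
theorem not_adj_of_mem_mid (T : G.IsTight mu) (O : G.Opp x z) {u v : V} (hu : u ∈ G.mid x z)
    (hv : v ∈ G.mid x z) : ¬ G.Adj u v := by
  intro huv
  obtain ⟨⟨b, hxb, hub⟩, -⟩ := SimpleGraph.mem_mid.1 hu
  have hbv : b ≠ v := by
    rintro rfl; exact O.not_adj_of_mem_mid hv hxb
  obtain ⟨t, htu, hbt, hvt⟩ := T.exists_other hbv hub.symm huv.symm
  have htx : t ≠ x := by
    rintro rfl; exact O.not_adj_of_mem_mid hv hvt.symm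
  have ht := T.mem_mid_of_adj O hxb hbt htx
  obtain ⟨w, -, -, -, hw⟩ := T.exists_third rfl O.toFar hv
  have key : ∀ s ∈ G.mid x z, G.Adj v s → s = w := by
    intro s hs hvs
    rcases hw s hvs with h | h | h
    · exact absurd h (O.not_adj_of_mem_mid hs)
    · exact absurd h (O.symm.not_adj_of_mem_mid (SimpleGraph.mem_mid_symm hs))
    · exact h
  exact htu ((key t ht hvt).trans (key u hu huv.symm).symm)

/-- A neighbour of the middle layer that is adjacent to neither end has all its neighbours in
the middle layer. -/
theorem mem_mid_of_adj_rest (T : G.IsTight mu) (O : G.Opp x z) {w f : V} (hy : y ∈ G.mid x z)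
    (hyw : G.Adj y w) (hxw : ¬ G.Adj x w) (hzw : ¬ G.Adj z w) (hwf : G.Adj w f) :
    f ∈ G.mid x z := by
  by_contra hf
  have hyf : y ≠ f := by rintro rfl; exact hf hy
  obtain ⟨t, htw, hyt, hft⟩ := T.exists_other hyf hyw hwf.symm
  obtain ⟨w', -, -, -, hw'⟩ := T.exists_third rfl O.toFar hy
  have hw : w = w' := by rcases hw' w hyw with h | h | h <;> tauto
  rcases hw' t hyt with h | h | h
  · refine hf (T.mem_mid_of_adj O h hft.symm ?_)
    rintro rfl; exact hxw hwf.symm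
  · refine hf (SimpleGraph.mem_mid_symm (T.mem_mid_of_adj O.symm h hft.symm ?_))
    rintro rfl; exact hzw hwf.symm
  · exact htw (h.trans hw.symm)

/-- The six classes together contain `x` and are closed under adjacency; the last class closes up by
`mem_mid_of_adj_rest`. -/
theorem covering (T : G.IsTight mu) (hG : G.Connected) (O : G.Opp x z) (v : V) :
    v = x ∨ G.Adj x v ∨ v ∈ G.mid x z ∨ G.Adj z v ∨ v = z ∨
      ((∃ y ∈ G.mid x z, G.Adj y v) ∧ ¬ G.Adj x v ∧ ¬ G.Adj z v) := by
  refine hG.mem_of_closed (S := {v | v = x ∨ G.Adj x v ∨ v ∈ G.mid x z ∨ G.Adj z v ∨ v = z ∨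
      ((∃ y ∈ G.mid x z, G.Adj y v) ∧ ¬ G.Adj x v ∧ ¬ G.Adj z v)}) (Or.inl rfl) ?_ v
  rintro u (rfl | hu | hu | hu | rfl | ⟨⟨y, hy, hyu⟩, hxu, hzu⟩) v huv
  · exact Or.inr (Or.inl huv)
  · by_cases hv : v = x
    · exact Or.inl hv
    · exact Or.inr (Or.inr (Or.inl (T.mem_mid_of_adj O hu huv hv)))
  · by_cases h1 : G.Adj x v
    · exact Or.inr (Or.inl h1)
    by_cases h2 : G.Adj z v
    · exact Or.inr (Or.inr (Or.inr (Or.inl h2)))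
    exact Or.inr (Or.inr (Or.inr (Or.inr (Or.inr ⟨⟨u, hu, huv⟩, h1, h2⟩))))
  · by_cases hv : v = z
    · exact Or.inr (Or.inr (Or.inr (Or.inr (Or.inl hv))))
    · exact Or.inr (Or.inr (Or.inl
        (SimpleGraph.mem_mid_symm (T.mem_mid_of_adj O.symm hu huv hv))))
  · exact Or.inr (Or.inr (Or.inr (Or.inl huv)))
  · exact Or.inr (Or.inr (Or.inl (T.mem_mid_of_adj_rest O hy hyu hxu hzu huv)))

/-- A vertex at distance four from `x` has no neighbour in the layer, whereas neighbours of `z` and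
the vertices of the last class of `covering` do. The other classes are too close to `x`. -/
theorem opp_unique (T : G.IsTight mu) (hG : G.Connected) (O : G.Opp x z) {z' : V}
    (O' : G.Opp x z') : z' = z := by
  have hmid : ∀ y ∈ G.mid x z, ¬ G.Adj y z' := by
    intro y hy h
    obtain ⟨⟨p, hp, hyp⟩, -⟩ := SimpleGraph.mem_mid.1 hy
    exact O'.not_three p y hp hyp.symm h
  rcases T.covering hG O z' with h | h | h | h | h | ⟨⟨y, hy, h⟩, -⟩
  · exact absurd h.symm O'.ne
  · exact absurd h O'.not_adj
  · obtain ⟨⟨p, hp, hyp⟩, -⟩ := SimpleGraph.mem_mid.1 h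
    exact absurd hyp.symm (O'.not_two p hp)
  · obtain ⟨t, htz, ht⟩ := T.exists_nbr_ne z' z
    exact absurd ht.symm
      (hmid t (SimpleGraph.mem_mid_symm (T.mem_mid_of_adj O.symm h ht htz)))
  · exact h
  · exact absurd h (hmid y hy)

/-- Every neighbour of `x` has exactly one neighbour of `z` without common neighbours. -/
theorem exists_unique_no_common (T : G.IsTight mu) (O : G.Opp x z) (hxa : G.Adj x a) :
    ∃! q, G.Adj z q ∧ ∀ t, G.Adj a t → ¬ G.Adj q t := by
  have hmu := T.two_le
  have hD : ∀ u ∈ (G.neighborFinset a).erase x, u ∈ G.mid x z := by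
    intro u hu
    simp only [Finset.mem_erase, SimpleGraph.mem_neighborFinset] at hu
    exact T.mem_mid_of_adj O hxa hu.2 hu.1
  set Q := (G.neighborFinset z).filter fun q => ∃ t, G.Adj a t ∧ G.Adj q t with hQ
  -- The bipartite graph between the `2 * mu` layer neighbours of `a` and the set `Q` they reach
  -- next to `z` is `mu`-regular on both sides. Hence `|Q| = 2 * mu`, one less than the valency of
  -- `z`.
  have h1 : ((G.neighborFinset a).erase x).card * mu = Q.card * mu := by
    refine Finset.card_mul_eq_card_mul (fun u q => G.Adj u q) (fun u hu => ?_) fun q hq => ?_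
    · rw [← T.card_left O.symm.toFar (SimpleGraph.mem_mid_symm (hD u hu))]
      congr 1
      ext q
      simp only [Finset.mem_erase, SimpleGraph.mem_neighborFinset] at hu
      simp only [Finset.bipartiteAbove, hQ, Finset.mem_filter, Finset.mem_inter,
        SimpleGraph.mem_neighborFinset]
      constructor
      · tauto
      · rintro ⟨h2, h3⟩
        exact ⟨⟨h2, u, hu.2, h3.symm⟩, h3⟩
    · simp only [hQ, Finset.mem_filter, SimpleGraph.mem_neighborFinset] at hq
      obtain ⟨hzq, t, hat, hqt⟩ := hq
      have haq : a ≠ q := by rintro rfl; exact O.not_two a hxa hzq.symm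
      rw [← T.card_common haq hat hqt]
      congr 1
      ext u
      simp only [Finset.bipartiteBelow, Finset.mem_filter, Finset.mem_erase, Finset.mem_inter,
        SimpleGraph.mem_neighborFinset]
      constructor
      · rintro ⟨⟨-, h2⟩, h3⟩
        exact ⟨h2, h3.symm⟩
      · rintro ⟨h2, h3⟩
        refine ⟨⟨?_, h2⟩, h3.symm⟩
        rintro rfl
        exact O.not_two q h3.symm hzq.symm
  rw [Finset.card_erase_of_mem (by simpa using hxa.symm), T.card_nbr] at h1
  have h2 := Nat.eq_of_mul_eq_mul_right (by omega) h1
  have h3 := Finset.card_filter_add_card_filter_not (s := G.neighborFinset z)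
    (fun q => ∃ t, G.Adj a t ∧ G.Adj q t)
  rw [T.card_nbr, ← hQ, ← h2] at h3
  obtain ⟨q, hq⟩ := Finset.card_eq_one.1 (show ((G.neighborFinset z).filter
    fun q => ¬ ∃ t, G.Adj a t ∧ G.Adj q t).card = 1 by omega)
  have key : ∀ u, u ∈ (G.neighborFinset z).filter
    (fun q => ¬ ∃ t, G.Adj a t ∧ G.Adj q t) ↔ u = q := fun u => by rw [hq]; simp
  simp only [Finset.mem_filter, SimpleGraph.mem_neighborFinset, not_exists, not_and] at key
  exact ⟨q, (key q).2 rfl, fun u hu => (key u).1 hu⟩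

/-- The exceptional `q` of `exists_unique_no_common` is the antipode of `a`: a walk of length three
between them would pass through `x` or `z`, or use an edge of the independent layer. -/
theorem exists_opp_of_adj (T : G.IsTight mu) (O : G.Opp x z) (hxa : G.Adj x a) :
    ∃ q, G.Adj z q ∧ G.Opp a q := by
  obtain ⟨q, ⟨hzq, hq⟩, -⟩ := T.exists_unique_no_common O hxa
  refine ⟨q, hzq, ⟨?_, ?_, fun p h1 h2 => hq p h1 h2.symm, ?_⟩, ?_⟩
  · rintro rfl
    exact O.not_two a hxa hzq.symm
  · exact fun h => O.not_three a q hxa h hzq.symm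
  · intro s t has hst htq
    by_cases hs : s = x
    · subst hs
      exact O.not_three t q hst htq hzq.symm
    by_cases ht : t = z
    · subst ht
      exact O.not_three a s hxa has hst
    · exact T.not_adj_of_mem_mid O (T.mem_mid_of_adj O hxa has hs)
        (SimpleGraph.mem_mid_symm (T.mem_mid_of_adj O.symm hzq htq.symm ht)) hst
  -- By the same uniqueness with the ends exchanged, only `a` among the neighbours of `x` has no
  -- common neighbour with `q`. So `b ≠ a` has one and lies between `a` and `q`.
  · obtain ⟨b, hba, hxb⟩ := T.exists_nbr_ne x a
    obtain ⟨a', ⟨-, -⟩, h2⟩ := T.exists_unique_no_common O.symm hzq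
    have h3 : ∃ t, G.Adj q t ∧ G.Adj b t := by
      by_contra h4
      push Not at h4
      exact hba ((h2 b ⟨hxb, h4⟩).trans
        (h2 a ⟨hxa, fun t h5 h6 => hq t h6 h5⟩).symm)
    obtain ⟨t, hqt, hbt⟩ := h3
    exact ⟨b, SimpleGraph.mem_mid.2 ⟨⟨x, hxa.symm, hxb.symm⟩, t, hqt, hbt⟩⟩

theorem exists_opp (T : G.IsTight mu) (hG : G.Connected) (O : G.Opp x z) (v : V) :
    ∃ v', G.Opp v v' := by
  refine hG.mem_of_closed (S := {v | ∃ v', G.Opp v v'}) ⟨z, O⟩ ?_ v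
  rintro u ⟨u', O'⟩ v huv
  obtain ⟨q, -, hq⟩ := T.exists_opp_of_adj O' huv
  exact ⟨q, hq⟩

end SimpleGraph.IsTight

/-- The index of the block of `v` in the distribution diagram with ends `x` and `z`. -/
def SimpleGraph.block (G : SimpleGraph V) [DecidableRel G.Adj] (x z v : V) : Fin 6 :=
  if v = x then 0 else if G.Adj x v then 1 else if v ∈ G.mid x z then 2 else
    if G.Adj z v then 3 else if v = z then 4 else 5

theorem SimpleGraph.block_eq_zero : G.block x z y = 0 ↔ y = x := by
  unfold SimpleGraph.block; split_ifs <;> simp_all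

namespace SimpleGraph.Opp

theorem block_eq_one (O : G.Opp x z) : G.block x z y = 1 ↔ G.Adj x y := by
  have h : y = x → ¬ G.Adj x y := by rintro rfl; exact G.irrefl
  unfold SimpleGraph.block; split_ifs <;> simp_all

theorem block_eq_two (O : G.Opp x z) : G.block x z y = 2 ↔ y ∈ G.mid x z := by
  have h1 : y ∈ G.mid x z → y ≠ x := fun h => (O.ne_of_mem_mid h).symm
  have h2 : y ∈ G.mid x z → ¬ G.Adj x y := O.not_adj_of_mem_mid
  unfold SimpleGraph.block; split_ifs <;> simp_all

theorem block_eq_three (O : G.Opp x z) : G.block x z y = 3 ↔ G.Adj z y := by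
  have h1 : y ∈ G.mid x z → ¬ G.Adj z y := fun h =>
    O.symm.not_adj_of_mem_mid (SimpleGraph.mem_mid_symm h)
  have h2 : G.Adj z y → ¬ G.Adj x y := fun h h' => O.not_two y h' h.symm
  have h3 : G.Adj z y → y ≠ x := by rintro h rfl; exact O.not_adj h.symm
  unfold SimpleGraph.block; split_ifs <;> simp_all

theorem block_eq_four (O : G.Opp x z) : G.block x z y = 4 ↔ y = z := by
  have h1 : z ∉ G.mid x z := fun h =>
    O.symm.ne_of_mem_mid (SimpleGraph.mem_mid_symm h) rfl
  have h2 := O.not_adj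
  have h3 := O.ne.symm
  rcases eq_or_ne y z with rfl | h
  · simp [SimpleGraph.block, h1, h2, h3]
  · unfold SimpleGraph.block; split_ifs <;> simp_all

theorem block_eq_five (O : G.Opp x z) (T : G.IsTight mu) (hG : G.Connected) : G.block x z y = 5 ↔
    (∃ u ∈ G.mid x z, G.Adj u y) ∧ ¬ G.Adj x y ∧ ¬ G.Adj z y := by
  have h := T.covering hG O y
  have h1 : (∃ u ∈ G.mid x z, G.Adj u y) → y ≠ x := by
    rintro ⟨u, hu, h'⟩ rfl; exact O.not_adj_of_mem_mid hu h'.symm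
  have h2 : (∃ u ∈ G.mid x z, G.Adj u y) → y ≠ z := by
    rintro ⟨u, hu, h'⟩ rfl
    exact O.symm.not_adj_of_mem_mid (SimpleGraph.mem_mid_symm hu) h'.symm
  have h3 : (∃ u ∈ G.mid x z, G.Adj u y) → y ∉ G.mid x z := by
    rintro ⟨u, hu, h''⟩ h'; exact T.not_adj_of_mem_mid O hu h' h''
  generalize (∃ u ∈ G.mid x z, G.Adj u y) = E at *
  unfold SimpleGraph.block; split_ifs <;> simp_all

end SimpleGraph.Opp
end Tight

/-! ### The equitable partition around a vertex and its antipode. -/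

section Diagrams

variable {V : Type*} [Fintype V] [DecidableEq V]
variable {G : SimpleGraph V} [DecidableRel G.Adj] {mu : ℕ} {x z y a e : V}

namespace SimpleGraph.IsTight

theorem card_rest (T : G.IsTight mu) (hG : G.Connected) (O : G.Opp x z) (hy : y ∈ G.mid x z) :
    ((G.neighborFinset y).filter fun v => G.block x z v = 5).card = 1 := by
  obtain ⟨w, hyw, hxw, hzw, hw⟩ := T.exists_third rfl O.toFar hy
  rw [Finset.card_eq_one]
  refine ⟨w, ?_⟩
  ext v
  simp only [Finset.mem_filter, SimpleGraph.mem_neighborFinset, O.block_eq_five T hG,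
    Finset.mem_singleton]
  constructor
  · rintro ⟨h1, -, h2, h3⟩
    rcases hw v h1 with h | h | h <;> tauto
  · rintro rfl
    exact ⟨hyw, ⟨y, hy, hyw⟩, hxw, hzw⟩

/-- Only the nonzero entries of a row are counted; they already add up to the valency `2 * mu + 1`,
which forces the zeros. -/
theorem card_nbr_block (T : G.IsTight mu) (hG : G.Connected) (O : G.Opp x z) (u : V)
    (j : Fin 6) : ((G.neighborFinset u).filter fun v => G.block x z v = j).card =
      diagramMatrix (2 * mu + 1) (G.block x z u) j := by
  have hs := Finset.card_eq_sum_card_fiberwise (f := G.block x z) (s := G.neighborFinset u)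
    (t := Finset.univ) (fun _ _ => by simp)
  rw [T.card_nbr, Fin.sum_univ_six] at hs
  obtain ⟨c, hc⟩ : ∃ c : Fin 6 → ℕ,
    ∀ j, ((G.neighborFinset u).filter fun v => G.block x z v = j).card = c j :=
    ⟨_, fun _ => rfl⟩
  have hk : (2 * mu + 1 - 1) / 2 = mu := by omega
  have hk' : 2 * mu + 1 - 1 = 2 * mu := by omega
  have all : ∀ i : Fin 6, (∀ v, G.Adj u v → G.block x z v = i) →
      ((G.neighborFinset u).filter fun v => G.block x z v = i).card = 2 * mu + 1 := by
    intro i hi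
    rw [Finset.filter_true_of_mem (fun v hv => hi v (by simpa using hv)), T.card_nbr]
  have one : ∀ (i : Fin 6) (p : V), G.Adj u p → (∀ v, G.block x z v = i ↔ v = p) →
      ((G.neighborFinset u).filter fun v => G.block x z v = i).card = 1 := by
    intro i p hp hi
    rw [Finset.card_eq_one]
    refine ⟨p, ?_⟩
    ext v
    simp only [Finset.mem_filter, SimpleGraph.mem_neighborFinset, hi, Finset.mem_singleton]
    exact ⟨fun h => h.2, fun h => ⟨h ▸ hp, h⟩⟩
  have most : ∀ p, G.Adj u p → (∀ v, G.Adj u v → v ≠ p → v ∈ G.mid x z) →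
      p ∉ G.mid x z →
      ((G.neighborFinset u).filter fun v => G.block x z v = 2).card = 2 * mu := by
    intro p hp hv hpm
    rw [← hk', ← T.card_nbr u, ← Finset.card_erase_of_mem (a := p) (by simpa using hp)]
    congr 1
    ext v
    simp only [Finset.mem_filter, SimpleGraph.mem_neighborFinset, O.block_eq_two,
      Finset.mem_erase]
    constructor
    · rintro ⟨h1, h2⟩
      exact ⟨fun h => hpm (h ▸ h2), h1⟩
    · rintro ⟨h1, h2⟩
      exact ⟨h2, hv v h2 h1⟩
  obtain ⟨i, hi⟩ : ∃ i, G.block x z u = i := ⟨_, rfl⟩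
  rw [hi, hc]
  simp only [hc] at hs
  fin_cases i
  · have hu := SimpleGraph.block_eq_zero.1 hi
    have h1 := all 1 (fun v hv => O.block_eq_one.2 (hu ▸ hv))
    rw [hc] at h1
    fin_cases j <;> simp [diagramMatrix] <;> omega
  · have hu := O.block_eq_one.1 hi
    have h1 := one 0 x hu.symm (fun v => SimpleGraph.block_eq_zero)
    have h2 := most x hu.symm (fun v h h' => T.mem_mid_of_adj O hu h h')
      (fun h => O.ne_of_mem_mid h rfl)
    rw [hc] at h1 h2
    fin_cases j <;> simp [diagramMatrix] <;> omega
  · have hu := O.block_eq_two.1 hi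
    have h1 : ((G.neighborFinset u).filter fun v => G.block x z v = 1).card = mu := by
      rw [← T.card_left O.toFar hu]
      congr 1; ext v
      simp only [Finset.mem_filter, SimpleGraph.mem_neighborFinset, O.block_eq_one,
        Finset.mem_inter, and_comm]
    have h2 : ((G.neighborFinset u).filter fun v => G.block x z v = 3).card = mu := by
      rw [← T.card_left O.symm.toFar (SimpleGraph.mem_mid_symm hu)]
      congr 1; ext v
      simp only [Finset.mem_filter, SimpleGraph.mem_neighborFinset, O.block_eq_three,
        Finset.mem_inter, and_comm]
    have h3 := T.card_rest hG O hu
    rw [hc] at h1 h2 h3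
    fin_cases j <;> simp [diagramMatrix] <;> omega
  · have hu := O.block_eq_three.1 hi
    have h1 := one 4 z hu.symm (fun v => O.block_eq_four)
    have h2 := most z hu.symm
      (fun v h h' => SimpleGraph.mem_mid_symm (T.mem_mid_of_adj O.symm hu h h'))
      (fun h => O.symm.ne_of_mem_mid (SimpleGraph.mem_mid_symm h) rfl)
    rw [hc] at h1 h2
    fin_cases j <;> simp [diagramMatrix] <;> omega
  · have hu := O.block_eq_four.1 hi
    have h1 := all 3 (fun v hv => O.block_eq_three.2 (hu ▸ hv))
    rw [hc] at h1
    fin_cases j <;> simp [diagramMatrix] <;> omega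
  · obtain ⟨⟨y, hy, hyu⟩, hxu, hzu⟩ := (O.block_eq_five T hG).1 hi
    have h1 := all 2 (fun v hv =>
      O.block_eq_two.2 (T.mem_mid_of_adj_rest O hy hyu hxu hzu hv))
    rw [hc] at h1
    fin_cases j <;> simp [diagramMatrix] <;> omega

theorem card_mul_block (T : G.IsTight mu) (hG : G.Connected) (O : G.Opp x z) (i j : Fin 6) :
    (Finset.univ.filter fun v => G.block x z v = i).card * diagramMatrix (2 * mu + 1) i j =
      (Finset.univ.filter fun v => G.block x z v = j).card *
        diagramMatrix (2 * mu + 1) j i := by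
  refine Finset.card_mul_eq_card_mul G.Adj (fun u hu => ?_) fun v hv => ?_
  · simp only [Finset.mem_filter, Finset.mem_univ, true_and] at hu
    rw [← hu, ← T.card_nbr_block hG O u j]
    congr 1; ext v
    simp [Finset.bipartiteAbove, and_comm]
  · simp only [Finset.mem_filter, Finset.mem_univ, true_and] at hv
    rw [← hv, ← T.card_nbr_block hG O v i]
    congr 1; ext u
    simp [Finset.bipartiteBelow, and_comm, SimpleGraph.adj_comm]

/-- The sizes spread from the single vertex of block 0 by counting the edges between blocks
0–1–2–3–4 and 2–5 from both sides. -/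
theorem card_block (T : G.IsTight mu) (hG : G.Connected) (O : G.Opp x z) (j : Fin 6) :
    (Finset.univ.filter fun v => G.block x z v = j).card = diagramSizes (2 * mu + 1) j := by
  have hmu := T.two_le
  have hk : (2 * mu + 1 - 1) / 2 = mu := by omega
  have hk' : 2 * mu + 1 - 1 = 2 * mu := by omega
  have c0 : (Finset.univ.filter fun v => G.block x z v = 0).card = 1 := by
    simp [SimpleGraph.block_eq_zero, Finset.filter_eq']
  have c01 := T.card_mul_block hG O 0 1
  have c12 := T.card_mul_block hG O 1 2
  have c23 := T.card_mul_block hG O 2 3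
  have c34 := T.card_mul_block hG O 3 4
  have c25 := T.card_mul_block hG O 2 5
  simp only [diagramMatrix, hk', c0] at c01 c12 c23 c34 c25
  simp at c01 c12 c23 c34 c25
  rw [← c01] at c12
  have c2 : (Finset.univ.filter fun v => G.block x z v = 2).card = 2 * (2 * mu + 1) := by
    apply Nat.eq_of_mul_eq_mul_right (show 0 < mu by omega)
    rw [← c12]; ring
  rw [c2] at c23 c25
  have c3 : (Finset.univ.filter fun v => G.block x z v = 3).card = 2 * mu + 1 := by
    apply Nat.eq_of_mul_eq_mul_right (show 0 < 2 * mu by omega)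
    rw [← c23]; ring
  rw [c3] at c34
  have c4 : (Finset.univ.filter fun v => G.block x z v = 4).card = 1 := by
    apply Nat.eq_of_mul_eq_mul_right (show 0 < 2 * mu + 1 by omega)
    rw [← c34]; ring
  have c5 : (Finset.univ.filter fun v => G.block x z v = 5).card = 2 := by
    apply Nat.eq_of_mul_eq_mul_right (show 0 < 2 * mu + 1 by omega)
    rw [← c25]
  fin_cases j <;> simp [diagramSizes, c0, ← c01, c2, c3, c4, c5]

theorem card_vertices (T : G.IsTight mu) (hG : G.Connected) (O : G.Opp x z) :
    Fintype.card V = 4 * (2 * mu + 1) + 4 := by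
  have hs := Finset.card_eq_sum_card_fiberwise (f := G.block x z) (s := Finset.univ)
    (t := Finset.univ) (fun _ _ => by simp)
  simp only [T.card_block hG O, Fin.sum_univ_six, Finset.card_univ] at hs
  rw [hs]
  simp [diagramSizes]
  ring

theorem hasDistributionDiagram (T : G.IsTight mu) (hG : G.Connected) (O : G.Opp x z) :
    G.HasDistributionDiagram (fun j => {y | G.block x z y = j}) (diagramSizes (2 * mu + 1))
      (diagramMatrix (2 * mu + 1)) := by
  have hsize : ∀ i, ({y | G.block x z y = i} : Set V).ncard = diagramSizes (2 * mu + 1) i := by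
    intro i
    rw [← T.card_block hG O i, ← Set.ncard_coe_finset]
    congr 1; ext; simp
  refine ⟨fun i => ?_, fun y => ⟨_, rfl, fun i hi => hi.symm⟩, hsize, fun i y hy j => ?_⟩
  · apply Set.nonempty_of_ncard_ne_zero
    rw [hsize]
    fin_cases i <;> simp [diagramSizes]
  · have hy' : G.block x z y = i := hy
    rw [← hy', ← T.card_nbr_block hG O y j, ← Set.ncard_coe_finset]
    congr 1; ext; simp

end SimpleGraph.IsTight
end Diagrams

/-! ### The association scheme of a tight graph. -/

section Scheme

variable {V : Type*} [Fintype V] [DecidableEq V]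
variable {G : SimpleGraph V} [DecidableRel G.Adj] {mu : ℕ} {ant : V → V}

theorem relMatrix_apply {X : Type*} (R : X → X → Prop) (x y : X) [Decidable (R x y)] :
    relMatrix R x y = if R x y then 1 else 0 := by
  simp [relMatrix]

namespace SimpleGraph.IsTight

/-- Blocks 0, 1 and 2 are symmetric by their description. Blocks 3 and 4 are symmetric because
antipodes are unique and adjacent vertices have adjacent antipodes. Block 5 is the remainder. -/
theorem block_symm (T : G.IsTight mu) (hG : G.Connected) (hant : ∀ x, G.Opp x (ant x))
    (x y : V) : G.block y (ant y) x = G.block x (ant x) y := by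
  have key : ∀ x y i, i ≠ 5 → G.block x (ant x) y = i → G.block y (ant y) x = i := by
    intro x y i hi h
    have O := hant x
    have O' := hant y
    fin_cases i
    · exact SimpleGraph.block_eq_zero.2 (SimpleGraph.block_eq_zero.1 h).symm
    · exact O'.block_eq_one.2 (O.block_eq_one.1 h).symm
    · have h' := (T.mem_mid_iff O).1 (O.block_eq_two.1 h)
      obtain ⟨h1, p, h2, h3⟩ := h'
      exact O'.block_eq_two.2 ((T.mem_mid_iff O').2 ⟨h1.symm, p, h3, h2⟩)
    · obtain ⟨a, hxa, hya⟩ := T.exists_opp_of_adj O.symm (O.block_eq_three.1 h)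
      rw [T.opp_unique hG O' hya] at hxa
      exact O'.block_eq_three.2 hxa.symm
    · have h' := O.block_eq_four.1 h
      exact O'.block_eq_four.2 (T.opp_unique hG O' (h' ▸ O.symm))
    · exact absurd rfl hi
  by_cases h : G.block x (ant x) y = 5
  · by_contra h'
    rw [h] at h'
    exact h' ((key y x _ h' rfl).symm.trans h)
  · exact key x y _ h rfl

/-- The multiplication by the adjacency matrix in the span of the relation matrices. -/
theorem relMatrix_mul (T : G.IsTight mu) (hG : G.Connected) (hant : ∀ x, G.Opp x (ant x))
    (j : Fin 6) :
    relMatrix G.Adj * relMatrix (fun x y => G.block x (ant x) y = j) =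
      ∑ i, (diagramMatrix (2 * mu + 1) i j : ℂ) •
        relMatrix (fun x y => G.block x (ant x) y = i) := by
  ext x y
  rw [Matrix.mul_apply, Matrix.sum_apply]
  simp only [relMatrix_apply, Matrix.smul_apply, smul_eq_mul, mul_ite, mul_one, mul_zero,
    Finset.sum_ite_eq, Finset.mem_univ, if_true, T.block_symm hG hant y]
  rw [← T.card_nbr_block hG (hant y) x j, Finset.card_filter,
    SimpleGraph.neighborFinset_eq_filter, Finset.sum_filter]
  push_cast
  refine Finset.sum_congr rfl fun u _ => ?_
  split_ifs <;> rfl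

theorem relMatrix_zero (ant : V → V) : relMatrix (fun x y => G.block x (ant x) y = 0) = 1 := by
  ext x y
  rw [relMatrix_apply, Matrix.one_apply]
  simp only [SimpleGraph.block_eq_zero, eq_comm (a := x)]

theorem relMatrix_one (hant : ∀ x, G.Opp x (ant x)) :
    (fun x y => G.block x (ant x) y = 1) = G.Adj := by
  ext x y
  rw [(hant x).block_eq_one]

/-- The matrices that multiply the span `S` into itself form an algebra `P`, which contains `A` by
`relMatrix_mul`. It suffices to produce every `F l` from `A` by products and linear combinations. -/
theorem relMatrix_mul_mem (T : G.IsTight mu) (hG : G.Connected)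
    (hant : ∀ x, G.Opp x (ant x)) (i j : Fin 6) :
    relMatrix (fun x y => G.block x (ant x) y = i) *
      relMatrix (fun x y => G.block x (ant x) y = j) ∈
    Submodule.span ℂ (Set.range fun l => relMatrix fun x y => G.block x (ant x) y = l) := by
  have hmu := T.two_le
  have hmu' : (mu : ℂ) ≠ 0 := by
    simp only [ne_eq, Nat.cast_eq_zero]; omega
  have hk : (2 * mu + 1 - 1) / 2 = mu := by omega
  have hk' : 2 * mu + 1 - 1 = 2 * mu := by omega
  have hk2 : (2 * mu + 1 : ℂ) ≠ 0 := by
    exact_mod_cast (show 2 * mu + 1 ≠ 0 by omega)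
  have hmul := T.relMatrix_mul hG hant
  have hzero := relMatrix_zero (G := G) ant
  have hone := congrArg relMatrix (relMatrix_one hant)
  generalize relMatrix G.Adj = A at *
  obtain ⟨F, hF⟩ : ∃ F : Fin 6 → Matrix V V ℂ,
    ∀ j, relMatrix (fun x y => G.block x (ant x) y = j) = F j := ⟨_, fun _ => rfl⟩
  simp only [hF] at hmul hzero hone ⊢
  set S := Submodule.span ℂ (Set.range fun l => F l) with hS
  let P : Submodule ℂ (Matrix V V ℂ) :=
    { carrier := {M | ∀ N ∈ S, M * N ∈ S}
      zero_mem' := fun N _ => by simp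
      add_mem' := fun h1 h2 N hN => by rw [add_mul]; exact S.add_mem (h1 N hN) (h2 N hN)
      smul_mem' := fun c M h N hN => by rw [smul_mul_assoc]; exact S.smul_mem c (h N hN) }
  have hFS : ∀ l, F l ∈ S := fun l => Submodule.subset_span ⟨l, rfl⟩
  have hPmul : ∀ M ∈ P, ∀ N ∈ P, M * N ∈ P := fun M hM N hN K hK => by
    rw [mul_assoc]; exact hM _ (hN K hK)
  have hA : A ∈ P := by
    intro N hN
    induction hN using Submodule.span_induction with
    | mem N h =>
      obtain ⟨l, rfl⟩ := h
      rw [hmul]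
      exact S.sum_mem fun i _ => S.smul_mem _ (hFS i)
    | zero => simp
    | add M N _ _ h1 h2 => rw [mul_add]; exact S.add_mem h1 h2
    | smul c M _ h => rw [mul_smul_comm]; exact S.smul_mem c h
  have m1 := hmul 1
  have m2 := hmul 2
  have m3 := hmul 3
  have m4 := hmul 4
  simp only [diagramMatrix, hk', Fin.sum_univ_six] at m1 m2 m3 m4
  simp at m1 m2 m3 m4
  have p0 : F 0 ∈ P := fun N hN => by rw [hzero, one_mul]; exact hN
  have p1 : F 1 ∈ P := hone ▸ hA
  have p2 : F 2 ∈ P := by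
    rw [← P.smul_mem_iff hmu', ← P.add_mem_iff_right (P.smul_mem (2 * mu + 1 : ℂ) p0), ← m1]
    exact hPmul _ hA _ p1
  -- `A * F 2` yields `F 3` and `F 5` only in combination. Multiplying that combination by `A`
  -- isolates `F 4`; then `F 3 = A * F 4`, and `F 5` is what is left.
  have p35 : (2 * mu : ℂ) • F 3 + (2 * mu + 1 : ℂ) • F 5 ∈ P := by
    rw [← P.add_mem_iff_right (P.smul_mem (2 * mu : ℂ) p1), ← add_assoc, ← m2]
    exact hPmul _ hA _ p2
  have p4 : F 4 ∈ P := by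
    have h := hPmul _ hA _ p35
    rw [mul_add, mul_smul_comm, mul_smul_comm, m3] at h
    have m5 := hmul 5
    simp only [diagramMatrix, Fin.sum_univ_six] at m5
    simp at m5
    rw [m5, smul_add, add_right_comm] at h
    rw [P.add_mem_iff_right] at h
    · rwa [P.smul_mem_iff (mul_ne_zero two_ne_zero hmu'), P.smul_mem_iff hk2] at h
    · exact P.add_mem (P.smul_mem _ (P.smul_mem _ p2)) (P.smul_mem _ p2)
  have p3 : F 3 ∈ P := by
    rw [← m4]; exact hPmul _ hA _ p4
  have p5 : F 5 ∈ P := by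
    rwa [P.add_mem_iff_right (P.smul_mem _ p3), P.smul_mem_iff hk2] at p35
  have hp : ∀ l, F l ∈ P := by
    intro l; fin_cases l <;> assumption
  exact hp i _ (hFS j)

/-- The association scheme whose relations are the blocks of the distribution diagrams. -/
noncomputable def scheme (T : G.IsTight mu) (hG : G.Connected)
    (hant : ∀ x, G.Opp x (ant x)) : AssocScheme V 5 where
  R j x y := G.block x (ant x) y = j
  nonempty j := by
    obtain ⟨x⟩ := hG.nonempty
    exact ⟨x, (T.hasDistributionDiagram hG (hant x)).nonempty j⟩
  zero_eq_one := relMatrix_zero ant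
  sum_eq_allOnes := by
    ext x y
    simp [Matrix.sum_apply, relMatrix_apply]
  transpose_mem j := ⟨j, by
    ext x y
    simp only [Matrix.transpose_apply, relMatrix_apply, T.block_symm hG hant]⟩
  mul_mem := T.relMatrix_mul_mem hG hant

theorem scheme_isSymmetric (T : G.IsTight mu) (hG : G.Connected)
    (hant : ∀ x, G.Opp x (ant x)) : (T.scheme hG hant).IsSymmetric := by
  intro j
  ext x y
  simp only [scheme, Matrix.transpose_apply, relMatrix_apply, T.block_symm hG hant]

theorem exists_scheme (T : G.IsTight mu) (hG : G.Connected) (hant : ∀ x, G.Opp x (ant x)) :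
    ∃ (S : AssocScheme V 5) (hS : S.IsSymmetric) (i : Fin 6) (hi : i ≠ 0),
      G = S.relationGraph hS i hi ∧ S.HasDistributionDiagram hS i hi
        (diagramSizes (2 * mu + 1)) (diagramMatrix (2 * mu + 1)) := by
  have h : G = (T.scheme hG hant).relationGraph (T.scheme_isSymmetric hG hant) 1
      (by decide) := by
    ext x y
    exact (hant x).block_eq_one.symm
  refine ⟨T.scheme hG hant, T.scheme_isSymmetric hG hant, 1, by decide, h, fun x => ?_⟩
  rw [← h]
  exact T.hasDistributionDiagram hG (hant x)

theorem isBipartite (T : G.IsTight mu) (hG : G.Connected) {x z : V} (O : G.Opp x z) :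
    G.IsBipartite := by
  refine ⟨SimpleGraph.Coloring.mk
    (fun v => (![0, 1, 0, 1, 0, 1] : Fin 6 → Fin 2) (G.block x z v)) ?_⟩
  intro u v huv
  have h := T.card_nbr_block hG O u (G.block x z v)
  have hpos : 0 < ((G.neighborFinset u).filter
      fun w => G.block x z w = G.block x z v).card :=
    Finset.card_pos.2 ⟨v, by simp [huv]⟩
  rw [h] at hpos
  generalize G.block x z u = i at *
  generalize G.block x z v = j at *
  fin_cases i <;> fin_cases j <;> simp [diagramMatrix] at hpos ⊢

end SimpleGraph.IsTight
end Scheme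

/-! ### Walk counts, diameter and spectrum of a tight graph. -/

section WalksAndEigenvalues

variable {V : Type*} [Fintype V] [DecidableEq V]
variable {G : SimpleGraph V} [DecidableRel G.Adj] {mu : ℕ} {x z : V} {ant : V → V}

namespace SimpleGraph.IsTight

theorem sum_nbr_block {R : Type*} [CommSemiring R] (T : G.IsTight mu) (hG : G.Connected)
    (O : G.Opp x z) (g : Fin 6 → R) (u : V) :
    ∑ v ∈ G.neighborFinset u, g (G.block x z v) =
      ∑ j, (diagramMatrix (2 * mu + 1) (G.block x z u) j : R) * g j := by
  rw [← Finset.sum_fiberwise_of_maps_to (g := G.block x z) (t := Finset.univ)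
    (fun _ _ => Finset.mem_univ _)]
  refine Finset.sum_congr rfl fun j _ => ?_
  rw [← T.card_nbr_block hG O u j, ← nsmul_eq_mul]
  apply Finset.sum_eq_card_nsmul
  intro v hv
  rw [(Finset.mem_filter.1 hv).2]

/-- The number of walks of length `n` from the base vertex to a vertex of the block `i`. -/
def walkCount (mu : ℕ) : ℕ → Fin 6 → ℕ
  | 0, i => if i = 0 then 1 else 0
  | n + 1, i => ∑ j, diagramMatrix (2 * mu + 1) i j * walkCount mu n j

theorem adjMatrix_pow_apply (T : G.IsTight mu) (hG : G.Connected)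
    (O : G.Opp x z) (n : ℕ) (y : V) :
    (G.adjMatrix ℕ ^ n) x y = walkCount mu n (G.block x z y) := by
  induction n generalizing y with
  | zero =>
    rw [pow_zero, Matrix.one_apply]
    simp only [walkCount, SimpleGraph.block_eq_zero, eq_comm (a := x)]
  | succ n ih =>
    rw [pow_succ, SimpleGraph.mul_adjMatrix_apply]
    simp only [ih, walkCount]
    exact T.sum_nbr_block hG O _ y

theorem ncard_walk (T : G.IsTight mu) (hG : G.Connected) (O : G.Opp x z) (n : ℕ) (y : V) :
    Set.ncard {p : G.Walk x y | p.length = n} = walkCount mu n (G.block x z y) := by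
  rw [← T.adjMatrix_pow_apply hG O n y, SimpleGraph.adjMatrix_pow_apply_eq_card_walk,
    ← Nat.card_coe_set_eq, Nat.card_eq_fintype_card]
  rfl

/-- The walk count depends only on the block, and distances 0, 1, 2 determine the block. Distance
three would not: it occurs in blocks 3 and 5. -/
theorem isWalkRegular (T : G.IsTight mu) (hG : G.Connected) (hant : ∀ x, G.Opp x (ant x)) :
    G.IsWalkRegular 2 := by
  intro n x y x' y' h h'
  rw [T.ncard_walk hG (hant x), T.ncard_walk hG (hant x')]
  congr 1
  rcases eq_or_ne x y with rfl | hxy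
  · rw [SimpleGraph.edist_self, SimpleGraph.edist_eq_zero_iff] at h'
    rw [SimpleGraph.block_eq_zero.2 rfl, SimpleGraph.block_eq_zero.2 h'.symm]
  by_cases hadj : G.Adj x y
  · rw [SimpleGraph.edist_eq_one_iff_adj.2 hadj, SimpleGraph.edist_eq_one_iff_adj] at h'
    rw [(hant x).block_eq_one.2 hadj, (hant x').block_eq_one.2 h']
  have key : ∀ u v, G.edist u v = 2 → G.block u (ant u) v = 2 := by
    intro u v huv
    obtain ⟨h1, -, p, hp⟩ := SimpleGraph.edist_eq_two_iff.1 huv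
    rw [SimpleGraph.mem_commonNeighbors] at hp
    exact (hant u).block_eq_two.2 ((T.mem_mid_iff (hant u)).2 ⟨h1, p, hp⟩)
  have h2 : G.edist x y = 2 := by
    refine le_antisymm h ?_
    by_contra h3
    push Not at h3
    have h4 := ENat.lt_add_one_iff (m := G.edist x y) (n := 1) (by simp) |>.1 h3
    rcases SimpleGraph.edist_le_one_iff_adj_or_eq.1 h4 with h5 | h5 <;> contradiction
  rw [key _ _ h2, key _ _ (h'.trans h2)]

theorem edist_le_of_adj {u v w : V} {n : ℕ} (h : G.edist u w ≤ n) (hwv : G.Adj w v) :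
    G.edist u v ≤ (n + 1 : ℕ) := by
  refine (SimpleGraph.edist_triangle (v := w)).trans ?_
  rw [SimpleGraph.edist_eq_one_iff_adj.2 hwv]
  push_cast
  gcongr

theorem edist_le_four (T : G.IsTight mu) (hG : G.Connected) (O : G.Opp x z) (v : V) :
    G.edist x v ≤ (4 : ℕ) := by
  have d0 : G.edist x x ≤ (0 : ℕ) := by simp
  have d2 : ∀ y ∈ G.mid x z, G.edist x y ≤ (2 : ℕ) := by
    intro y hy
    obtain ⟨⟨p, hp, hyp⟩, -⟩ := SimpleGraph.mem_mid.1 hy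
    exact edist_le_of_adj (edist_le_of_adj d0 hp) hyp.symm
  have d3 : ∀ q, G.Adj z q → G.edist x q ≤ (3 : ℕ) := by
    intro q hq
    obtain ⟨t, htz, hqt⟩ := T.exists_nbr_ne q z
    exact edist_le_of_adj
      (d2 t (SimpleGraph.mem_mid_symm (T.mem_mid_of_adj O.symm hq hqt htz))) hqt.symm
  have mono : ∀ {m : ℕ} {u}, m ≤ 4 → G.edist x u ≤ (m : ℕ) → G.edist x u ≤ (4 : ℕ) :=
    fun hm h => h.trans (by exact_mod_cast hm)
  rcases T.covering hG O v with rfl | h | h | h | rfl | ⟨⟨y, hy, h⟩, -⟩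
  · exact mono (by norm_num) d0
  · exact mono (by norm_num) (edist_le_of_adj d0 h)
  · exact mono (by norm_num) (d2 v h)
  · exact mono (by norm_num) (d3 v h)
  · obtain ⟨q, -, hq⟩ := T.exists_nbr_ne v x
    exact edist_le_of_adj (d3 q hq) hq.symm
  · exact mono (by norm_num) (edist_le_of_adj (d2 y hy) h)

theorem mem_eigenvalueSet_iff {θ : ℝ} :
    θ ∈ G.eigenvalueSet ↔ ∃ f : V → ℝ, f ≠ 0 ∧ ∀ u, ∑ v ∈ G.neighborFinset u, f v = θ * f u := by
  rw [SimpleGraph.eigenvalueSet, Set.mem_ofPred_eq, Module.End.hasEigenvalue_iff,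
    Submodule.ne_bot_iff]
  simp only [Module.End.mem_eigenspace_iff, Matrix.toLin'_apply, funext_iff,
    SimpleGraph.adjMatrix_mulVec_apply, Pi.smul_apply, smul_eq_mul]
  constructor
  · rintro ⟨f, h1, h2⟩
    exact ⟨f, h2, h1⟩
  · rintro ⟨f, h1, h2⟩
    exact ⟨f, h2, h1⟩

/-- A right eigenvector of the quotient matrix lifts to a function constant on blocks; its value at
`x` is `g 0`, so it is not zero. -/
theorem mem_eigenvalueSet_of_quotient (T : G.IsTight mu) (hG : G.Connected) (O : G.Opp x z)
    {θ : ℝ} (g : Fin 6 → ℝ) (h0 : g 0 ≠ 0)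
    (hg : ∀ i, ∑ j, (diagramMatrix (2 * mu + 1) i j : ℝ) * g j = θ * g i) :
    θ ∈ G.eigenvalueSet := by
  rw [mem_eigenvalueSet_iff]
  refine ⟨fun v => g (G.block x z v), fun h => h0 ?_, fun u => ?_⟩
  · have := congrFun h x
    rwa [SimpleGraph.block_eq_zero.2 rfl] at this
  · rw [T.sum_nbr_block hG O, hg]

/-- Summing an eigenvector over the blocks gives a left eigenvector of the quotient matrix. The
blocks are taken around a vertex where the eigenvector does not vanish, so that `g 0 ≠ 0` can be
cancelled after eliminating the other coordinates. -/
theorem eigenvalue_equation (T : G.IsTight mu) (hG : G.Connected)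
    (hant : ∀ x, G.Opp x (ant x)) {θ : ℝ} (hθ : θ ∈ G.eigenvalueSet) :
    (θ ^ 2 - (2 * mu + 1 : ℝ) ^ 2) * (θ ^ 2 - (2 * mu + 1)) * (θ ^ 2 - 1) = 0 := by
  obtain ⟨f, hf, hθf⟩ := mem_eigenvalueSet_iff.1 hθ
  obtain ⟨x, hx⟩ := Function.ne_iff.1 hf
  have O := hant x
  have hmu := T.two_le
  have hmu' : (mu : ℝ) ≠ 0 := by
    simp only [ne_eq, Nat.cast_eq_zero]; omega
  obtain ⟨g, hg⟩ : ∃ g : Fin 6 → ℝ,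
    ∀ j, ∑ v with G.block x (ant x) v = j, f v = g j := ⟨_, fun _ => rfl⟩
  have g0 : g 0 ≠ 0 := by
    rw [← hg]
    simpa [SimpleGraph.block_eq_zero, Finset.filter_eq'] using hx
  have key : ∀ j, θ * g j = ∑ i, (diagramMatrix (2 * mu + 1) i j : ℝ) * g i := by
    intro j
    rw [← hg, Finset.mul_sum]
    simp only [← hθf, SimpleGraph.neighborFinset_eq_filter, Finset.sum_filter]
    rw [← Finset.sum_filter, Finset.sum_comm]
    rw [← Finset.sum_fiberwise_of_maps_to (g := G.block x (ant x)) (t := Finset.univ)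
      (fun _ _ => Finset.mem_univ _)]
    refine Finset.sum_congr rfl fun i _ => ?_
    rw [← hg, Finset.mul_sum]
    refine Finset.sum_congr rfl fun u hu => ?_
    rw [← (Finset.mem_filter.1 hu).2, ← T.card_nbr_block hG O u j, ← Finset.sum_filter,
      Finset.sum_const, nsmul_eq_mul]
    congr 3
    ext v
    simp [and_comm, SimpleGraph.adj_comm]
  have hk' : 2 * mu + 1 - 1 = 2 * mu := by omega
  have e0 := key 0
  have e1 := key 1
  have e2 := key 2
  have e3 := key 3
  have e4 := key 4
  have e5 := key 5
  simp only [diagramMatrix, hk', Fin.sum_univ_six] at e0 e1 e2 e3 e4 e5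
  simp at e0 e1 e2 e3 e4 e5
  -- This factor is treated apart because `g 4 = g 0` is obtained by cancelling it.
  by_cases h : θ ^ 2 - (2 * mu + 1 : ℝ) = 0
  · rw [h]; ring
  have h1 : (mu : ℝ) * g 2 = (θ ^ 2 - (2 * mu + 1)) * g 0 := by
    linear_combination -e1 - θ * e0
  have h4 : g 4 = g 0 := by
    apply mul_left_cancel₀ h
    linear_combination θ * e4 + e3 + h1
  have h2 : (θ ^ 2 - (2 * mu + 1 : ℝ)) * g 2 = 4 * mu * θ ^ 2 * g 0 := by
    linear_combination θ * e2 - 2 * mu * θ * e0 - 2 * mu * θ * e4 + (2 * mu + 1) * e5 +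
      2 * mu * θ ^ 2 * h4
  have h3 : (θ ^ 2 - (2 * mu + 1 : ℝ) ^ 2) * (θ ^ 2 - 1) = 0 := by
    apply mul_right_cancel₀ g0
    linear_combination (θ ^ 2 - (2 * mu + 1 : ℝ)) * (-h1) + mu * h2
  linear_combination (θ ^ 2 - (2 * mu + 1 : ℝ)) * h3

theorem ncard_eigenvalueSet (T : G.IsTight mu) (hG : G.Connected)
    (hant : ∀ x, G.Opp x (ant x)) : G.eigenvalueSet.ncard = 6 := by
  obtain ⟨x⟩ := hG.nonempty
  have O := hant x
  have hmu : (2 : ℝ) ≤ mu := by exact_mod_cast T.two_le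
  have hk' : 2 * mu + 1 - 1 = 2 * mu := by omega
  set k : ℝ := 2 * mu + 1 with hkdef
  set s := Real.sqrt k with hs
  have hss : s ^ 2 = k := Real.sq_sqrt (by positivity)
  have hs0 : 0 ≤ s := Real.sqrt_nonneg k
  have hs1 : 1 < s := by nlinarith
  have hsk : s < k := by nlinarith
  -- Explicit eigenvectors of the quotient matrix for the three pairs `±√k`, `±1` and `±k`, distinct
  -- since `1 < √k < k`.
  have main1 : ∀ θ : ℝ, θ ^ 2 = k → θ ∈ G.eigenvalueSet := by
    intro θ hθ
    refine T.mem_eigenvalueSet_of_quotient hG O ![k, θ, 0, -θ, -k, 0] ?_ fun i => ?_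
    · simp; linarith
    · simp only [diagramMatrix, hk', Fin.sum_univ_six]
      fin_cases i <;> simp <;> first
      | (linear_combination -hθ)
      | (linear_combination (2 * mu + 1 : ℝ) * hθ)
      | (linear_combination -(2 * mu + 1 : ℝ) * hθ)
      | ring1
  have main2 : ∀ θ : ℝ, θ ^ 2 = 1 → θ ∈ G.eigenvalueSet := by
    intro θ hθ
    refine T.mem_eigenvalueSet_of_quotient hG O ![k, θ, -1, θ, k, -k * θ] ?_ fun i => ?_
    · simp; linarith
    · simp only [diagramMatrix, hk', Fin.sum_univ_six]
      fin_cases i <;> simp <;> first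
      | (linear_combination -hθ)
      | (linear_combination (2 * mu + 1 : ℝ) * hθ)
      | (linear_combination -(2 * mu + 1 : ℝ) * hθ)
      | ring1
  have main3 : ∀ r : ℝ, r ^ 2 = 1 → r * k ∈ G.eigenvalueSet := by
    intro r hr
    refine T.mem_eigenvalueSet_of_quotient hG O ![1, r, 1, r, 1, r] ?_ fun i => ?_
    · simp
    · simp only [diagramMatrix, hk', Fin.sum_univ_six]
      fin_cases i <;> simp <;> first
      | (linear_combination -hr)
      | (linear_combination (2 * mu + 1 : ℝ) * hr)
      | (linear_combination -(2 * mu + 1 : ℝ) * hr)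
      | ring1
  have hset : G.eigenvalueSet = ↑({k, -k, s, -s, 1, -1} : Finset ℝ) := by
    ext θ
    simp only [Finset.coe_insert, Finset.coe_singleton, Set.mem_insert_iff,
      Set.mem_singleton_iff]
    constructor
    · intro hθ
      have h := T.eigenvalue_equation hG hant hθ
      rw [← hkdef] at h
      rcases mul_eq_zero.1 h with h | h
      · rcases mul_eq_zero.1 h with h | h
        · have := sq_eq_sq_iff_eq_or_eq_neg.1 (sub_eq_zero.1 h)
          tauto
        · have := sq_eq_sq_iff_eq_or_eq_neg.1 ((sub_eq_zero.1 h).trans hss.symm)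
          tauto
      · have := sq_eq_one_iff.1 (sub_eq_zero.1 h)
        tauto
    · rintro (rfl | rfl | rfl | rfl | rfl | rfl)
      · simpa using main3 1 (by norm_num)
      · simpa using main3 (-1) (by norm_num)
      · exact main1 _ hss
      · exact main1 _ (by rw [neg_sq, hss])
      · exact main2 _ (by norm_num)
      · exact main2 _ (by norm_num)
  rw [hset, Set.ncard_coe_finset]
  rw [Finset.card_insert_of_notMem, Finset.card_insert_of_notMem,
    Finset.card_insert_of_notMem, Finset.card_insert_of_notMem,
    Finset.card_insert_of_notMem, Finset.card_singleton]
  all_goals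
    simp only [Finset.mem_insert, Finset.mem_singleton, not_or]
    repeat' apply And.intro
    all_goals intro h; linarith

end SimpleGraph.IsTight
end WalksAndEigenvalues

/-! ### Valency five: the local configuration where tightness fails. -/

section ValencyFive

variable {V : Type*} [Fintype V] [DecidableEq V]
variable {G : SimpleGraph V} [DecidableRel G.Adj]

/-- The neighbours of `v` are `a`, `b`, `c`, `d` and `e`. -/
def SimpleGraph.Nbrs (G : SimpleGraph V) (v a b c d e : V) : Prop :=
  ∀ u, G.Adj v u ↔ u = a ∨ u = b ∨ u = c ∨ u = d ∨ u = e

namespace SimpleGraph.HasCounts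

theorem other (H : G.HasCounts 5 0 2) {u v p : V} (huv : u ≠ v) (h1 : G.Adj u p)
    (h2 : G.Adj v p) : ∃ q, q ≠ p ∧ G.Adj u q ∧ G.Adj v q := by
  have h := H.card_common huv h1 h2
  obtain ⟨q, hq, hne⟩ := Finset.exists_mem_ne
    (s := G.neighborFinset u ∩ G.neighborFinset v) (by omega) p
  simp only [Finset.mem_inter, SimpleGraph.mem_neighborFinset] at hq
  exact ⟨q, hne, hq⟩

theorem two (H : G.HasCounts 5 0 2) {u v p q r : V} (huv : u ≠ v) (hpq : p ≠ q)
    (h1 : G.Adj u p) (h2 : G.Adj v p) (h3 : G.Adj u q) (h4 : G.Adj v q) (h5 : G.Adj u r)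
    (h6 : G.Adj v r) : r = p ∨ r = q := by
  by_contra! hr
  have h := H.card_common huv h1 h2
  have hs : ({p, q, r} : Finset V) ⊆ G.neighborFinset u ∩ G.neighborFinset v := by
    intro w hw
    simp only [Finset.mem_insert, Finset.mem_singleton] at hw
    rcases hw with rfl | rfl | rfl <;> simp [*]
  have := Finset.card_le_card hs
  rw [h, Finset.card_eq_three.2 ⟨p, q, r, hpq, hr.1.symm, hr.2.symm, rfl⟩] at this
  omega

theorem nbrs_of (H : G.HasCounts 5 0 2) {v a b c d e : V} (hn : [a, b, c, d, e].Nodup)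
    (ha : G.Adj v a) (hb : G.Adj v b) (hc : G.Adj v c) (hd : G.Adj v d) (he : G.Adj v e) :
    G.Nbrs v a b c d e := by
  have h1 : [a, b, c, d, e].toFinset ⊆ G.neighborFinset v := by
    intro w hw
    simp only [List.toFinset_cons, List.toFinset_nil, Finset.mem_insert, Finset.notMem_empty,
      or_false] at hw
    rcases hw with rfl | rfl | rfl | rfl | rfl <;> simpa
  have h2 := Finset.eq_of_subset_of_card_le h1
    (by rw [H.card_nbr, List.toFinset_card_of_nodup hn]; rfl)
  intro u
  rw [← SimpleGraph.mem_neighborFinset, ← h2]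
  simp

theorem nodup (H : G.HasCounts 5 0 2) {v a b c d e : V} (hN : G.Nbrs v a b c d e) :
    [a, b, c, d, e].Nodup := by
  refine Multiset.coe_nodup.1 (Multiset.toFinset_card_eq_card_iff_nodup.1 ?_)
  have : [a, b, c, d, e].toFinset = G.neighborFinset v := by
    ext u
    rw [SimpleGraph.mem_neighborFinset, hN u]
    simp
  exact (congrArg Finset.card this).trans (H.card_nbr v)

end SimpleGraph.HasCounts

/-- The neighbourhood of a vertex `a` that is adjacent to `x`, at distance three from `z`, and
has a neighbour `e ≠ x` not in the middle layer. -/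
structure SimpleGraph.BadConfig (G : SimpleGraph V)
    (x z a e a' s₁ s₂ s₃ y₁ y₂ y₃ q₁ q₂ q₃ w₁ w₂ w₃ : V) : Prop where
  far : G.Far x z
  Nx : G.Nbrs x a a' s₁ s₂ s₃
  Na : G.Nbrs a x e y₁ y₂ y₃
  Ne : G.Nbrs e a a' w₁ w₂ w₃
  N₁ : G.Nbrs y₁ a s₁ q₂ q₃ w₁
  N₂ : G.Nbrs y₂ a s₂ q₁ q₃ w₂
  N₃ : G.Nbrs y₃ a s₃ q₁ q₂ w₃
  zq₁ : G.Adj z q₁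
  zq₂ : G.Adj z q₂
  zq₃ : G.Adj z q₃
  not_mid : ∀ q, G.Adj z q → ¬ G.Adj e q

/-- Each vertex arises as the second common neighbour of a pair at distance two. Indices are chosen
so that `yᵢ` is adjacent to the two points `qⱼ` with `j ≠ i`, while `sᵢ` and `wᵢ` are its second
common neighbours with `x` and with `e`. -/
theorem SimpleGraph.HasCounts.exists_badConfig (H : G.HasCounts 5 0 2) {x z y₃ a e : V}
    (F : G.Far x z) (hy : y₃ ∈ G.mid x z) (hxa : G.Adj x a) (hya : G.Adj y₃ a)
    (hae : G.Adj a e) (hex : e ≠ x) (he : e ∉ G.mid x z) :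
    ∃ a' s₁ s₂ s₃ y₁ y₂ q₁ q₂ q₃ w₁ w₂ w₃,
      G.BadConfig x z a e a' s₁ s₂ s₃ y₁ y₂ y₃ q₁ q₂ q₃ w₁ w₂ w₃ := by
  have hne : ∀ p q, G.Adj x p → G.Adj z q → p ≠ q := by
    rintro p q hp hq rfl
    exact F.not_two p hp hq.symm
  have heq : ∀ q, G.Adj z q → ¬ G.Adj e q := fun q hq h =>
    he (SimpleGraph.mem_mid.2 ⟨⟨a, hxa, hae.symm⟩, q, hq, h⟩)
  have hmid : ∀ y q, G.Adj z q → G.Adj a y → G.Adj q y → y ≠ x ∧ y ≠ e := by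
    intro y q hq _ h
    refine ⟨?_, ?_⟩
    · rintro rfl; exact F.not_two q h.symm hq.symm
    · rintro rfl; exact heq q hq h.symm
  have haz : ∀ q, G.Adj z q → a ≠ q := fun q hq => hne a q hxa hq
  obtain ⟨-, q₁, hzq₁, hyq₁⟩ := SimpleGraph.mem_mid.1 hy
  have hzy : ∀ y, G.Adj a y → z ≠ y := by
    rintro y h rfl; exact F.not_two a hxa h
  obtain ⟨q₂, h21, hzq₂, hyq₂⟩ := H.other (hzy y₃ hya.symm) hzq₁ hyq₁
  obtain ⟨y₂, h23, hay₂, hqy₂⟩ := H.other (haz q₁ hzq₁) hya.symm hyq₁.symm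
  obtain ⟨y₁, h13, hay₁, hqy₁⟩ := H.other (haz q₂ hzq₂) hya.symm hyq₂.symm
  have h12 : y₁ ≠ y₂ := by
    rintro rfl
    rcases H.two h13 (haz q₁ hzq₁) hay₁.symm hya hqy₂.symm hyq₁ hqy₁.symm hyq₂ with h | h
    · exact haz q₂ hzq₂ h.symm
    · exact h21 h
  have Na : G.Nbrs a x e y₁ y₂ y₃ := by
    refine H.nbrs_of ?_ hxa.symm hae hay₁ hay₂ hya.symm
    have m1 := hmid y₁ q₂ hzq₂ hay₁ hqy₁
    have m2 := hmid y₂ q₁ hzq₁ hay₂ hqy₂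
    have m3 := hmid y₃ q₁ hzq₁ hya.symm hyq₁.symm
    simp [*, Ne.symm hex, m1.1.symm, m1.2.symm, m2.1.symm, m2.2.symm, m3.1.symm, m3.2.symm]
  obtain ⟨q₃, h31, hzq₃, hyq₃⟩ := H.other (hzy y₂ hay₂) hzq₁ hqy₂.symm
  have h32 : q₃ ≠ q₂ := by
    rintro rfl
    rcases H.two (haz q₃ hzq₃) h12 hay₁ hqy₁ hay₂ hyq₃.symm hya.symm hyq₂.symm with h | h
    · exact h13 h.symm
    · exact h23 h.symm
  -- Besides `y₂`, the vertices `a` and `q₃` have one more common neighbour. It cannot be `y₃`,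
  -- which already has `q₁` and `q₂` next to `z`.
  have hyq₃' : G.Adj y₁ q₃ := by
    obtain ⟨t, ht, hat, hqt⟩ := H.other (haz q₃ hzq₃) hay₂ hyq₃.symm
    obtain ⟨t1, t2⟩ := hmid t q₃ hzq₃ hat hqt
    rcases (Na t).1 hat with rfl | rfl | rfl | rfl | rfl
    · exact absurd rfl t1
    · exact absurd rfl t2
    · exact hqt.symm
    · exact absurd rfl ht
    · rcases H.two (hzy _ hya.symm) h21.symm hzq₁ hyq₁ hzq₂ hyq₂ hzq₃ hqt.symm with h | h
      · exact absurd h h31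
      · exact absurd h h32
  have hxy : ∀ y q, G.Adj z q → G.Adj a y → G.Adj q y → x ≠ y := fun y q h1 h2 h3 =>
    (hmid y q h1 h2 h3).1.symm
  obtain ⟨s₁, hs₁, hxs₁, hys₁⟩ := H.other (hxy y₁ q₂ hzq₂ hay₁ hqy₁) hxa hay₁.symm
  obtain ⟨s₂, hs₂, hxs₂, hys₂⟩ := H.other (hxy y₂ q₁ hzq₁ hay₂ hqy₂) hxa hay₂.symm
  obtain ⟨s₃, hs₃, hxs₃, hys₃⟩ := H.other (hxy y₃ q₁ hzq₁ hya.symm hyq₁.symm) hxa hya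
  obtain ⟨a', ha', hxa', hea'⟩ := H.other hex.symm hxa hae.symm
  have ws : ∀ y q, G.Adj z q → G.Adj a y → G.Adj q y → ∃ w, w ≠ a ∧ G.Adj e w ∧ G.Adj y w ∧
      ¬ G.Adj x w ∧ ¬ G.Adj y a' := by
    intro y q hq hay hqy
    have hye := (hmid y q hq hay hqy).2
    have hya' : ¬ G.Adj y a' := by
      intro h
      rcases H.two ha' hex hea'.symm hae hxa'.symm hxa.symm h.symm hay with h | h
      · exact hye h
      · exact (hmid y q hq hay hqy).1 h
    obtain ⟨w, hw, hew, hyw⟩ := H.other hye.symm hae.symm hay.symm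
    refine ⟨w, hw, hew, hyw, fun hxw => ?_, hya'⟩
    rcases H.two hex.symm ha'.symm hxa hae.symm hxa' hea' hxw hew with h | h
    · exact hw h
    · exact hya' (h ▸ hyw)
  obtain ⟨w₁, hwa₁, hew₁, hyw₁, hxw₁, hya₁⟩ := ws y₁ q₂ hzq₂ hay₁ hqy₁
  obtain ⟨w₂, hwa₂, hew₂, hyw₂, hxw₂, hya₂⟩ := ws y₂ q₁ hzq₁ hay₂ hqy₂
  obtain ⟨w₃, hwa₃, hew₃, hyw₃, hxw₃, hya₃⟩ := ws y₃ q₁ hzq₁ hya.symm hyq₁.symm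
  have row : ∀ y s w q q', G.Adj z q → G.Adj z q' → q ≠ q' → G.Adj a y → G.Adj y s →
      G.Adj x s → s ≠ a → G.Adj y q → G.Adj y q' → G.Adj y w → w ≠ a → G.Adj e w →
      ¬ G.Adj x w → G.Nbrs y a s q q' w := by
    intro y s w q q' hq hq' hqq hay hys hxs hsa hyq hyq' hyw hwa hew hxw
    refine H.nbrs_of ?_ hay.symm hys hyq hyq' hyw
    have n1 : q ≠ w := by rintro rfl; exact heq _ hq hew
    have n2 : q' ≠ w := by rintro rfl; exact heq _ hq' hew
    have n3 : s ≠ w := by rintro rfl; exact hxw hxs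
    simp [haz q hq, haz q' hq', hne s q hxs hq, hne s q' hxs hq', hqq, hsa.symm, n1, n2, n3,
      hwa.symm]
  -- Two of the `yᵢ` already share `a` and one `q`, hence nothing else; so the `sᵢ` are distinct,
  -- and so are the `wᵢ`.
  have sep : ∀ y y' q t, y ≠ y' → G.Adj a y → G.Adj a y' → G.Adj z q → G.Adj y q →
      G.Adj y' q → t ≠ a → t ≠ q → G.Adj y t → ¬ G.Adj y' t := by
    intro y y' q t hyy hay hay' hq hyq hyq' hta htq hyt hyt'
    rcases H.two hyy (haz q hq) hay.symm hay'.symm hyq hyq' hyt hyt' with h | h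
    · exact hta h
    · exact htq h
  have s12 : s₁ ≠ s₂ := by
    rintro rfl
    exact sep _ _ _ _ h12 hay₁ hay₂ hzq₃ hyq₃' hyq₃ hs₁ (hne _ _ hxs₁ hzq₃) hys₁ hys₂
  have s13 : s₁ ≠ s₃ := by
    rintro rfl
    exact sep _ _ _ _ h13 hay₁ hya.symm hzq₂ hqy₁.symm hyq₂ hs₁ (hne _ _ hxs₁ hzq₂) hys₁ hys₃
  have s23 : s₂ ≠ s₃ := by
    rintro rfl
    exact sep _ _ _ _ h23 hay₂ hya.symm hzq₁ hqy₂.symm hyq₁ hs₂ (hne _ _ hxs₂ hzq₁) hys₂ hys₃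
  have hwq : ∀ w q, G.Adj e w → G.Adj z q → w ≠ q := by
    rintro w q h1 h2 rfl; exact heq w h2 h1
  have w12 : w₁ ≠ w₂ := by
    rintro rfl
    exact sep _ _ _ _ h12 hay₁ hay₂ hzq₃ hyq₃' hyq₃ hwa₁ (hwq _ _ hew₁ hzq₃) hyw₁ hyw₂
  have w13 : w₁ ≠ w₃ := by
    rintro rfl
    exact sep _ _ _ _ h13 hay₁ hya.symm hzq₂ hqy₁.symm hyq₂ hwa₁ (hwq _ _ hew₁ hzq₂) hyw₁ hyw₃
  have w23 : w₂ ≠ w₃ := by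
    rintro rfl
    exact sep _ _ _ _ h23 hay₂ hya.symm hzq₁ hqy₂.symm hyq₁ hwa₂ (hwq _ _ hew₂ hzq₁) hyw₂ hyw₃
  have sa : ∀ y s, ¬ G.Adj y a' → G.Adj y s → a' ≠ s := by
    rintro y s h1 h2 rfl; exact h1 h2
  refine ⟨a', s₁, s₂, s₃, y₁, y₂, q₁, q₂, q₃, w₁, w₂, w₃, F, ?_, Na, ?_, ?_, ?_, ?_, hzq₁, hzq₂,
    hzq₃, heq⟩
  · refine H.nbrs_of ?_ hxa hxa' hxs₁ hxs₂ hxs₃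
    simp [ha'.symm, hs₁.symm, hs₂.symm, hs₃.symm, s12, s13, s23, sa _ _ hya₁ hys₁,
      sa _ _ hya₂ hys₂, sa _ _ hya₃ hys₃]
  · refine H.nbrs_of ?_ hae.symm hea' hew₁ hew₂ hew₃
    simp [ha'.symm, hwa₁.symm, hwa₂.symm, hwa₃.symm, w12, w13, w23, sa _ _ hya₁ hyw₁,
      sa _ _ hya₂ hyw₂, sa _ _ hya₃ hyw₃]
  · exact row _ _ _ _ _ hzq₂ hzq₃ h32.symm hay₁ hys₁ hxs₁ hs₁ hqy₁.symm hyq₃' hyw₁ hwa₁ hew₁ hxw₁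
  · exact row _ _ _ _ _ hzq₁ hzq₃ h31.symm hay₂ hys₂ hxs₂ hs₂ hqy₂.symm hyq₃ hyw₂ hwa₂ hew₂ hxw₂
  · exact row _ _ _ _ _ hzq₁ hzq₂ h21.symm hya.symm hys₃ hxs₃ hs₃ hyq₁ hyq₂ hyw₃ hwa₃ hew₃ hxw₃

namespace SimpleGraph.BadConfig

variable {x z a e a' s₁ s₂ s₃ y₁ y₂ y₃ q₁ q₂ q₃ w₁ w₂ w₃ : V}

/-- With `rotate` this generates the symmetric group acting on all indices at once, so facts are
proved for one index and transported. -/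
theorem swap (C : G.BadConfig x z a e a' s₁ s₂ s₃ y₁ y₂ y₃ q₁ q₂ q₃ w₁ w₂ w₃) :
    G.BadConfig x z a e a' s₂ s₁ s₃ y₂ y₁ y₃ q₂ q₁ q₃ w₂ w₁ w₃ where
  far := C.far
  Nx u := by rw [C.Nx u]; tauto
  Na u := by rw [C.Na u]; tauto
  Ne u := by rw [C.Ne u]; tauto
  N₁ u := by rw [C.N₂ u]
  N₂ u := by rw [C.N₁ u]
  N₃ u := by rw [C.N₃ u]; tauto
  zq₁ := C.zq₂
  zq₂ := C.zq₁
  zq₃ := C.zq₃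
  not_mid := C.not_mid

theorem rotate (C : G.BadConfig x z a e a' s₁ s₂ s₃ y₁ y₂ y₃ q₁ q₂ q₃ w₁ w₂ w₃) :
    G.BadConfig x z a e a' s₂ s₃ s₁ y₂ y₃ y₁ q₂ q₃ q₁ w₂ w₃ w₁ where
  far := C.far
  Nx u := by rw [C.Nx u]; tauto
  Na u := by rw [C.Na u]; tauto
  Ne u := by rw [C.Ne u]; tauto
  N₁ u := by rw [C.N₂ u]; tauto
  N₂ u := by rw [C.N₃ u]; tauto
  N₃ u := by rw [C.N₁ u]
  zq₁ := C.zq₂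
  zq₂ := C.zq₃
  zq₃ := C.zq₁
  not_mid := C.not_mid

end SimpleGraph.BadConfig

end ValencyFive

/-! ### Recognising the two exceptional graphs by covering maps. -/

section Covers

variable {V : Type*} [Fintype V] [DecidableEq V] {G : SimpleGraph V} [DecidableRel G.Adj]

/-- A covering map onto a connected graph with a one-point fibre is an isomorphism. -/
theorem SimpleGraph.Connected.nonempty_iso_of_cover {W : Type*} {H : SimpleGraph W}
    (hG : G.Connected) (f : W → V)
    (hf : ∀ u g, G.Adj (f u) g ↔ ∃ v, H.Adj u v ∧ f v = g)
    (hinj : ∀ u v v', H.Adj u v → H.Adj u v' → f v = f v' → v = v')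
    (u₀ : W) (h₀ : ∀ u, f u = f u₀ → u = u₀) : Nonempty (G ≃g H) := by
  -- Uniqueness of preimages spreads along edges: two preimages of `g'` have neighbours over `g`,
  -- which coincide, and `f` is injective on the neighbours of that vertex.
  have h1 : ∀ g u v, f u = g → f v = g → u = v := by
    refine hG.mem_of_closed (x := f u₀) (S := {g | ∀ u v, f u = g → f v = g → u = v})
      (fun u v hu hv => (h₀ u hu).trans (h₀ v hv).symm) ?_
    intro g hg g' hgg u v hu hv
    obtain ⟨u', hu', hfu⟩ := (hf u g).1 (hu ▸ hgg.symm)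
    obtain ⟨v', hv', hfv⟩ := (hf v g).1 (hv ▸ hgg.symm)
    obtain rfl := hg u' v' hfu hfv
    exact hinj u' u v hu'.symm hv'.symm (hu.trans hv.symm)
  have h2 : ∀ g, ∃ u, f u = g := by
    refine hG.mem_of_closed (x := f u₀) (S := {g | ∃ u, f u = g}) ⟨u₀, rfl⟩ ?_
    rintro g ⟨u, rfl⟩ g' hgg
    obtain ⟨v, -, hv⟩ := (hf u g').1 hgg
    exact ⟨v, hv⟩
  have hb : Function.Bijective f := ⟨fun u v h => h1 _ u v h rfl, h2⟩
  refine ⟨SimpleGraph.Iso.symm ⟨Equiv.ofBijective f hb, ?_⟩⟩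
  intro u v
  change G.Adj (f u) (f v) ↔ _
  rw [hf]
  constructor
  · rintro ⟨v', h, h'⟩
    rwa [← h1 _ v' v h' rfl]
  · exact fun h => ⟨v, h, rfl⟩

/-- The labelling need not be known to be injective: the neighbour table makes it a covering, and
`h₀` makes one fibre a single point. -/
theorem SimpleGraph.HasCounts.nonempty_iso_hypercube (H : G.HasCounts 5 0 2)
    (hG : G.Connected) (M : Fin 2 → Fin 2 → Fin 2 → Fin 2 → Fin 2 → V)
    (hM : ∀ a b c d e, G.Nbrs (M a b c d e) (M (1 - a) b c d e) (M a (1 - b) c d e)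
      (M a b (1 - c) d e) (M a b c (1 - d) e) (M a b c d (1 - e)))
    (h₀ : ∀ a b c d e, M a b c d e = M 0 0 0 0 0 → a = 0 ∧ b = 0 ∧ c = 0 ∧ d = 0 ∧ e = 0) :
    Nonempty (G ≃g hypercubeGraph 5) := by
  have hadj : ∀ u v : Fin 5 → Fin 2, (hypercubeGraph 5).Adj u v ↔
      ∃ i, v = Function.update u i (1 - u i) := by
    intro u v
    change (Finset.univ.filter fun i => u i ≠ v i).card = 1 ↔ _
    rw [Finset.card_eq_one]
    have h2 : ∀ a b : Fin 2, a ≠ b ↔ b = 1 - a := by decide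
    simp only [h2]
    refine exists_congr fun i => ?_
    constructor
    · intro h
      ext1 j
      have := Finset.ext_iff.1 h j
      simp only [Finset.mem_filter, Finset.mem_univ, true_and, Finset.mem_singleton] at this
      rcases eq_or_ne j i with rfl | hj
      · simpa using this.2 rfl
      · rw [Function.update_of_ne hj]
        by_contra h'
        exact hj (this.1 ((h2 _ _).1 (Ne.symm h')))
    · rintro rfl
      ext j
      have h3 : ∀ a : Fin 2, a ≠ 1 - a := by decide
      rcases eq_or_ne j i with rfl | hj
      · simp
      · simp [hj, h3]
  set f : (Fin 5 → Fin 2) → V := fun u => M (u 0) (u 1) (u 2) (u 3) (u 4) with hf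
  have hN : ∀ u : Fin 5 → Fin 2, G.Nbrs (f u) (f (Function.update u 0 (1 - u 0)))
      (f (Function.update u 1 (1 - u 1))) (f (Function.update u 2 (1 - u 2)))
      (f (Function.update u 3 (1 - u 3))) (f (Function.update u 4 (1 - u 4))) := by
    intro u
    simpa [hf, Function.update_apply] using hM (u 0) (u 1) (u 2) (u 3) (u 4)
  refine hG.nonempty_iso_of_cover f (fun u g => ?_) (fun u v v' hv hv' h => ?_) 0 fun u h => ?_
  · rw [hN u g]
    simp only [hadj]
    constructor
    · rintro (h | h | h | h | h)
      exacts [⟨_, ⟨0, rfl⟩, h.symm⟩, ⟨_, ⟨1, rfl⟩, h.symm⟩, ⟨_, ⟨2, rfl⟩, h.symm⟩,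
        ⟨_, ⟨3, rfl⟩, h.symm⟩, ⟨_, ⟨4, rfl⟩, h.symm⟩]
    · rintro ⟨v, ⟨i, rfl⟩, rfl⟩
      fin_cases i <;> simp
  · obtain ⟨i, rfl⟩ := (hadj _ _).1 hv
    obtain ⟨j, rfl⟩ := (hadj _ _).1 hv'
    have hn := H.nodup (hN u)
    simp only [List.nodup_cons, List.mem_cons, List.not_mem_nil, or_false, not_or,
      not_false_eq_true, List.nodup_nil, and_true] at hn
    obtain ⟨⟨h1, h2, h3, h4⟩, ⟨h5, h6, h7⟩, ⟨h8, h9⟩, h10⟩ := hn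
    have : i = j := by
      fin_cases i <;> fin_cases j <;> first | rfl | exact absurd h ‹_› | exact absurd h.symm ‹_›
    rw [this]
  · obtain ⟨h1, h2, h3, h4, h5⟩ := h₀ _ _ _ _ _ h
    ext i
    fin_cases i <;> simp [*]

theorem SimpleGraph.HasCounts.nonempty_iso_boxProd_delta41 (H : G.HasCounts 5 0 2)
    (hG : G.Connected) (P B : Fin 2 → ZMod 7 → V)
    (hP : ∀ i p, G.Nbrs (P i p) (P (1 - i) p) (B i p) (B i (p - 3)) (B i (p - 5))
      (B i (p - 6)))
    (hB : ∀ i b, G.Nbrs (B i b) (B (1 - i) b) (P i b) (P i (b + 3)) (P i (b + 5))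
      (P i (b + 6)))
    (h₀ : ∀ i p, P i p = P 0 0 → i = 0 ∧ p = 0) (h₁ : ∀ i b, B i b ≠ P 0 0) :
    Nonempty (G ≃g (⊤ : SimpleGraph (Fin 2)).boxProd delta41) := by
  have h2 : ∀ a b : Fin 2, a ≠ b ↔ b = 1 - a := by decide
  set f : Fin 2 × (ZMod 7 ⊕ ZMod 7) → V := fun u => Sum.elim (P u.1) (B u.1) u.2 with hf
  have hN : ∀ u, ∃ t : Fin 5 → Fin 2 × (ZMod 7 ⊕ ZMod 7),
      G.Nbrs (f u) (f (t 0)) (f (t 1)) (f (t 2)) (f (t 3)) (f (t 4)) ∧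
      ∀ v, ((⊤ : SimpleGraph (Fin 2)).boxProd delta41).Adj u v ↔ ∃ i, v = t i := by
    rintro ⟨i, p | b⟩
    · refine ⟨![(1 - i, .inl p), (i, .inr p), (i, .inr (p - 3)), (i, .inr (p - 5)),
        (i, .inr (p - 6))], hP i p, ?_⟩
      have h3 : ∀ p q : ZMod 7, design742 p q ↔ q = p ∨ q = p - 3 ∨ q = p - 5 ∨ q = p - 6 := by
        decide
      rintro ⟨j, q | q⟩
      · simp [SimpleGraph.boxProd_adj, Fin.exists_fin_succ, delta41, incidenceGraph, ← h2,
          eq_comm]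
      · simp [SimpleGraph.boxProd_adj, Fin.exists_fin_succ, delta41, incidenceGraph, h3]
        tauto
    · refine ⟨![(1 - i, .inr b), (i, .inl b), (i, .inl (b + 3)), (i, .inl (b + 5)),
        (i, .inl (b + 6))], hB i b, ?_⟩
      have h3 : ∀ p q : ZMod 7, design742 p q ↔ p = q ∨ p = q + 3 ∨ p = q + 5 ∨ p = q + 6 := by
        decide
      rintro ⟨j, q | q⟩
      · simp [SimpleGraph.boxProd_adj, Fin.exists_fin_succ, delta41, incidenceGraph, h3]
        tauto
      · simp [SimpleGraph.boxProd_adj, Fin.exists_fin_succ, delta41, incidenceGraph, ← h2,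
          eq_comm]
  refine hG.nonempty_iso_of_cover f (fun u g => ?_) (fun u v v' hv hv' h => ?_) (0, .inl 0)
    fun u h => ?_
  · obtain ⟨t, ht, hadj⟩ := hN u
    rw [ht g]
    simp only [hadj]
    constructor
    · rintro (h | h | h | h | h)
      exacts [⟨_, ⟨0, rfl⟩, h.symm⟩, ⟨_, ⟨1, rfl⟩, h.symm⟩, ⟨_, ⟨2, rfl⟩, h.symm⟩,
        ⟨_, ⟨3, rfl⟩, h.symm⟩, ⟨_, ⟨4, rfl⟩, h.symm⟩]
    · rintro ⟨v, ⟨i, rfl⟩, rfl⟩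
      fin_cases i <;> simp
  · obtain ⟨t, ht, hadj⟩ := hN u
    obtain ⟨i, rfl⟩ := (hadj _).1 hv
    obtain ⟨j, rfl⟩ := (hadj _).1 hv'
    have hn := H.nodup ht
    simp only [List.nodup_cons, List.mem_cons, List.not_mem_nil, or_false, not_or,
      not_false_eq_true, List.nodup_nil, and_true] at hn
    obtain ⟨⟨h1, h2, h3, h4⟩, ⟨h5, h6, h7⟩, ⟨h8, h9⟩, h10⟩ := hn
    have : i = j := by
      fin_cases i <;> fin_cases j <;> first | rfl | exact absurd h ‹_› | exact absurd h.symm ‹_›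
    rw [this]
  · obtain ⟨i, p | b⟩ := u
    · obtain ⟨rfl, rfl⟩ := h₀ i p h
      rfl
    · exact absurd h (h₁ i b)

end Covers

/-! ### The parity rule for third neighbours. -/

section BadConfigs

variable {V : Type*} [Fintype V] [DecidableEq V] {G : SimpleGraph V} [DecidableRel G.Adj]
variable {x z a e a' s₁ s₂ s₃ y₁ y₂ y₃ q₁ q₂ q₃ w₁ w₂ w₃ : V}

theorem SimpleGraph.Far.ne_of_adj (F : G.Far x z) {p q : V} (hp : G.Adj x p) (hq : G.Adj z q) :
    p ≠ q := by
  rintro rfl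
  exact F.not_two p hp hq.symm

namespace SimpleGraph.HasCounts

theorem exists_fifth (H : G.HasCounts 5 0 2) {v a b c d : V} (hn : [a, b, c, d].Nodup)
    (ha : G.Adj v a) (hb : G.Adj v b) (hc : G.Adj v c) (hd : G.Adj v d) :
    ∃ f, G.Nbrs v a b c d f := by
  have h1 : (G.neighborFinset v \ [a, b, c, d].toFinset).Nonempty := by
    rw [← Finset.card_pos]
    have h2 := Finset.le_card_sdiff [a, b, c, d].toFinset (G.neighborFinset v)
    rw [H.card_nbr, List.toFinset_card_of_nodup hn] at h2
    simp only [List.length_cons, List.length_nil] at h2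
    omega
  obtain ⟨f, hf⟩ := h1
  simp only [List.toFinset_cons, List.toFinset_nil, Finset.mem_sdiff, Finset.mem_insert,
    SimpleGraph.mem_neighborFinset, Finset.notMem_empty, or_false, not_or] at hf
  refine ⟨f, H.nbrs_of ?_ ha hb hc hd hf.1⟩
  simp only [List.nodup_cons, List.mem_cons, List.not_mem_nil, or_false, not_or] at hn ⊢
  obtain ⟨-, h1, h2, h3, h4⟩ := hf
  simp_all [eq_comm]

/-- Two vertices of the middle layer share their third neighbours if and only if they share a
neighbour at one of the ends, but not at both. -/
theorem third_eq_iff (H : G.HasCounts 5 0 2) (F : G.Far x z) {y y' p p' q q' w b b' r r' v : V}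
    (hyy : y ≠ y') (hy : G.Nbrs y p p' q q' w) (hy' : G.Nbrs y' b b' r r' v)
    (hp : G.Adj x p) (hp' : G.Adj x p') (hq : G.Adj z q) (hq' : G.Adj z q')
    (hb : G.Adj x b) (hb' : G.Adj x b') (hr : G.Adj z r) (hr' : G.Adj z r')
    (hxw : ¬ G.Adj x w) (hzw : ¬ G.Adj z w) (hxv : ¬ G.Adj x v) (hzv : ¬ G.Adj z v) :
    w = v ↔ ¬ ((p = b ∨ p = b' ∨ p' = b ∨ p' = b') ↔ (q = r ∨ q = r' ∨ q' = r ∨ q' = r')) := by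
  have hA : (p = b ∨ p = b' ∨ p' = b ∨ p' = b') ↔ ∃ c, G.Adj x c ∧ G.Adj y c ∧ G.Adj y' c := by
    constructor
    · rintro (rfl | rfl | rfl | rfl)
      exacts [⟨p, hp, by simp [hy p], by simp [hy' p]⟩, ⟨p, hp, by simp [hy p], by simp [hy' p]⟩,
        ⟨p', hp', by simp [hy p'], by simp [hy' p']⟩,
        ⟨p', hp', by simp [hy p'], by simp [hy' p']⟩]
    · rintro ⟨c, h1, h2, h3⟩
      have n1 := F.ne_of_adj h1 hq
      have n2 := F.ne_of_adj h1 hq'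
      have n3 := F.ne_of_adj h1 hr
      have n4 := F.ne_of_adj h1 hr'
      have n5 : c ≠ w := fun h => hxw (h ▸ h1)
      have n6 : c ≠ v := fun h => hxv (h ▸ h1)
      rcases (hy c).1 h2 with rfl | rfl | rfl | rfl | rfl <;>
        rcases (hy' _).1 h3 with h | h | h | h | h <;> simp_all
  have hB : (q = r ∨ q = r' ∨ q' = r ∨ q' = r') ↔ ∃ c, G.Adj z c ∧ G.Adj y c ∧ G.Adj y' c := by
    constructor
    · rintro (rfl | rfl | rfl | rfl)
      exacts [⟨q, hq, by simp [hy q], by simp [hy' q]⟩, ⟨q, hq, by simp [hy q], by simp [hy' q]⟩,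
        ⟨q', hq', by simp [hy q'], by simp [hy' q']⟩,
        ⟨q', hq', by simp [hy q'], by simp [hy' q']⟩]
    · rintro ⟨c, h1, h2, h3⟩
      have n1 := (F.ne_of_adj hp h1).symm
      have n2 := (F.ne_of_adj hp' h1).symm
      have n3 := (F.ne_of_adj hb h1).symm
      have n4 := (F.ne_of_adj hb' h1).symm
      have n5 : c ≠ w := fun h => hzw (h ▸ h1)
      have n6 : c ≠ v := fun h => hzv (h ▸ h1)
      rcases (hy c).1 h2 with rfl | rfl | rfl | rfl | rfl <;>
        rcases (hy' _).1 h3 with h | h | h | h | h <;> simp_all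
  have hyw : G.Adj y w := by simp [hy w]
  have hyv : G.Adj y' v := by simp [hy' v]
  have hyx : ∀ t, G.Adj y t → G.Adj y' t → G.Adj x t ∨ G.Adj z t ∨ (t = w ∧ t = v) := by
    intro t h1 h2
    rcases (hy t).1 h1 with rfl | rfl | rfl | rfl | rfl
    · exact Or.inl hp
    · exact Or.inl hp'
    · exact Or.inr (Or.inl hq)
    · exact Or.inr (Or.inl hq')
    · rcases (hy' t).1 h2 with rfl | rfl | rfl | rfl | rfl
      exacts [Or.inl hb, Or.inl hb', Or.inr (Or.inl hr), Or.inr (Or.inl hr'),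
        Or.inr (Or.inr ⟨rfl, rfl⟩)]
  -- Two shared neighbours next to `x` would themselves have three common neighbours `x`, `y` and
  -- `y'`.
  have uA : ∀ c c', G.Adj x c → G.Adj y c → G.Adj y' c → G.Adj x c' → G.Adj y c' →
      G.Adj y' c' → c = c' := by
    intro c c' h1 h2 h3 h4 h5 h6
    by_contra hcc
    rcases H.two hcc (p := y) (q := y') (r := x) hyy h2.symm h5.symm h3.symm h6.symm h1.symm
      h4.symm with rfl | rfl
    · exact F.not_two q ((hy q).2 (by simp)) hq.symm
    · exact F.not_two r ((hy' r).2 (by simp)) hr.symm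
  have uB : ∀ c c', G.Adj z c → G.Adj y c → G.Adj y' c → G.Adj z c' → G.Adj y c' →
      G.Adj y' c' → c = c' := by
    intro c c' h1 h2 h3 h4 h5 h6
    by_contra hcc
    rcases H.two hcc (p := y) (q := y') (r := z) hyy h2.symm h5.symm h3.symm h6.symm h1.symm
      h4.symm with rfl | rfl
    · exact F.not_two p hp ((hy p).2 (by simp)).symm
    · exact F.not_two b hb ((hy' b).2 (by simp)).symm
  -- `y` and `y'` have no or two common neighbours: at most one next to `x`, at most one next to
  -- `z`, and possibly the third neighbour. So an even number of these three coincidences occur.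
  rw [hA, hB]
  constructor
  · rintro rfl h
    by_cases hc : ∃ c, G.Adj x c ∧ G.Adj y c ∧ G.Adj y' c
    · obtain ⟨c, h1, h2, h3⟩ := hc
      obtain ⟨c', h1', h2', h3'⟩ := h.1 ⟨c, h1, h2, h3⟩
      rcases H.two hyy (F.ne_of_adj h1 h1') h2 h3 h2' h3' hyw hyv with h | h
      · exact hxw (h ▸ h1)
      · exact hzw (h ▸ h1')
    · obtain ⟨t, ht, h1, h2⟩ := H.other hyy hyw hyv
      rcases hyx t h1 h2 with h3 | h3 | h3
      · exact hc ⟨t, h3, h1, h2⟩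
      · exact hc (h.2 ⟨t, h3, h1, h2⟩)
      · exact ht h3.1
  · intro h
    by_cases hc : ∃ c, G.Adj x c ∧ G.Adj y c ∧ G.Adj y' c
    · have hd : ¬ ∃ c, G.Adj z c ∧ G.Adj y c ∧ G.Adj y' c := fun hd =>
        h ⟨fun _ => hd, fun _ => hc⟩
      obtain ⟨c, h1, h2, h3⟩ := hc
      obtain ⟨t, ht, h4, h5⟩ := H.other hyy h2 h3
      rcases hyx t h4 h5 with h6 | h6 | h6
      · exact absurd (uA t c h6 h4 h5 h1 h2 h3) ht
      · exact absurd ⟨t, h6, h4, h5⟩ hd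
      · exact h6.1.symm.trans h6.2
    · have hd : ∃ c, G.Adj z c ∧ G.Adj y c ∧ G.Adj y' c := by
        by_contra hd
        exact h ⟨fun h' => absurd h' hc, fun h' => absurd h' hd⟩
      obtain ⟨c, h1, h2, h3⟩ := hd
      obtain ⟨t, ht, h4, h5⟩ := H.other hyy h2 h3
      rcases hyx t h4 h5 with h6 | h6 | h6
      · exact absurd ⟨t, h6, h4, h5⟩ hc
      · exact absurd (uB t c h6 h4 h5 h1 h2 h3) ht
      · exact h6.1.symm.trans h6.2

/-- In the configuration around `a`, the neighbour of `y` next to neither end is one of the `wᵢ`.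
The lemma serves to apply this also with the ends exchanged. -/
theorem adj_third (H : G.HasCounts 5 0 2) (F : G.Far x z) {y q w : V} (hxa : G.Adj x a)
    (hay : G.Adj a y) (hzq : G.Adj z q) (hyq : G.Adj y q) (hae : G.Adj a e) (hex : e ≠ x)
    (he : ∀ q, G.Adj z q → ¬ G.Adj e q) (hyw : G.Adj y w) (hxw : ¬ G.Adj x w)
    (hzw : ¬ G.Adj z w) : G.Adj e w := by
  obtain ⟨a', s₁, s₂, s₃, y₁, y₂, q₁, q₂, q₃, w₁, w₂, w₃, C⟩ := H.exists_badConfig F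
    (SimpleGraph.mem_mid.2 ⟨⟨a, hxa, hay.symm⟩, q, hzq, hyq⟩) hxa hay.symm hae hex
    (fun h => by
      obtain ⟨-, r, hr, her⟩ := SimpleGraph.mem_mid.1 h
      exact he r hr her)
  rcases (C.N₃ w).1 hyw with rfl | rfl | rfl | rfl | rfl
  · exact absurd hxa hxw
  · exact absurd ((C.Nx _).2 (by simp)) hxw
  · exact absurd C.zq₁ hzw
  · exact absurd C.zq₂ hzw
  · exact (C.Ne _).2 (by simp)

/-- The configuration exists with any given order of the neighbours of `x`. -/
theorem exists_badConfig_of (H : G.HasCounts 5 0 2) (F : G.Far x z) {y q : V}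
    (hN : G.Nbrs x a a' s₁ s₂ s₃) (hay : G.Adj a y) (hzq : G.Adj z q) (hyq : G.Adj y q)
    (hae : G.Adj a e) (hae' : G.Adj a' e) (hex : e ≠ x)
    (he : ∀ q, G.Adj z q → ¬ G.Adj e q) :
    ∃ y₁ y₂ y₃ q₁ q₂ q₃ w₁ w₂ w₃,
      G.BadConfig x z a e a' s₁ s₂ s₃ y₁ y₂ y₃ q₁ q₂ q₃ w₁ w₂ w₃ := by
  have hxa : G.Adj x a := by simp [hN a]
  have hxa' : G.Adj x a' := by simp [hN a']
  obtain ⟨b', t₁, t₂, t₃, y₁, y₂, q₁, q₂, q₃, w₁, w₂, w₃, C⟩ := H.exists_badConfig F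
    (SimpleGraph.mem_mid.2 ⟨⟨a, hxa, hay.symm⟩, q, hzq, hyq⟩) hxa hay.symm hae hex
    (fun h => by
      obtain ⟨-, r, hr, her⟩ := SimpleGraph.mem_mid.1 h
      exact he r hr her)
  have hn := H.nodup hN
  have hn' := H.nodup C.Nx
  simp only [List.nodup_cons, List.mem_cons, List.not_mem_nil, or_false, not_or,
    not_false_eq_true, List.nodup_nil, and_true] at hn hn'
  have hb : a' = b' := by
    rcases H.two hex (p := a) (q := b') (r := a') hn'.1.1 hae.symm hxa
      ((C.Ne b').2 (by simp)) ((C.Nx b').2 (by simp)) hae'.symm hxa' with h | h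
    · exact absurd h.symm hn.1.1
    · exact h
  subst hb
  have h1 := (C.Nx s₁).1 ((hN s₁).2 (by simp))
  have h2 := (C.Nx s₂).1 ((hN s₂).2 (by simp))
  have h3 := (C.Nx s₃).1 ((hN s₃).2 (by simp))
  obtain ⟨⟨-, n1, n2, n3⟩, ⟨n4, n5, n6⟩, ⟨n7, n8⟩, n9⟩ := hn
  simp only [Ne.symm n1, Ne.symm n2, Ne.symm n3, Ne.symm n4, Ne.symm n5, Ne.symm n6,
      false_or] at h1 h2 h3
  clear hN hn' hay hzq hyq hae hae' he
  -- The given order of `s₁`, `s₂`, `s₃` is one of six, each reached by `swap` and `rotate`.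
  rcases h1 with rfl | rfl | rfl <;> rcases h2 with rfl | rfl | rfl <;>
    rcases h3 with rfl | rfl | rfl <;>
    first
    | exact absurd rfl ‹_›
    | exact ⟨_, _, _, _, _, _, _, _, _, C⟩
    | exact ⟨_, _, _, _, _, _, _, _, _, C.swap⟩
    | exact ⟨_, _, _, _, _, _, _, _, _, C.rotate⟩
    | exact ⟨_, _, _, _, _, _, _, _, _, C.rotate.rotate⟩
    | exact ⟨_, _, _, _, _, _, _, _, _, C.rotate.swap⟩
    | exact ⟨_, _, _, _, _, _, _, _, _, C.swap.rotate⟩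

end SimpleGraph.HasCounts
end BadConfigs

/-! ### Two configurations with the same outer vertex `e`. -/

section PairedConfigs

variable {V : Type*} [Fintype V] [DecidableEq V] {G : SimpleGraph V} [DecidableRel G.Adj]
variable {x z a e a' s₁ s₂ s₃ y₁ y₂ y₃ q₁ q₂ q₃ w₁ w₂ w₃ : V}

namespace SimpleGraph.HasCounts

theorem common_unique (H : G.HasCounts 5 0 2) {p p' y y' : V} (hpp : p ≠ p')
    (hp : G.Adj x p) (hp' : G.Adj x p') (h1 : G.Adj p y) (h2 : G.Adj p' y) (h3 : G.Adj p y')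
    (h4 : G.Adj p' y') (hy : y ≠ x) (hy' : y' ≠ x) : y = y' := by
  rcases H.two hpp hy'.symm hp.symm hp'.symm h3 h4 h1 h2 with h | h
  · exact absurd h hy
  · exact h

/-- Brings a layer vertex into the form required by the parity rule. -/
theorem exists_row (H : G.HasCounts 5 0 2) (F : G.Far x z) {p p' t r : V} (hpp : p ≠ p')
    (hp : G.Adj x p) (hp' : G.Adj x p') (h1 : G.Adj t p) (h2 : G.Adj t p') (hr : G.Adj z r)
    (htr : G.Adj t r) : ∃ r' v, G.Nbrs t p p' r r' v ∧ G.Adj z r' ∧ ¬ G.Adj x v ∧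
      ¬ G.Adj z v := by
  have hzt : z ≠ t := by rintro rfl; exact F.not_two p hp h1.symm
  have hxt : x ≠ t := by rintro rfl; exact F.not_two r htr hr.symm
  obtain ⟨r', hrr, hr', htr'⟩ := H.other hzt hr htr
  obtain ⟨v, hv⟩ := H.exists_fifth (a := p) (b := p') (c := r) (d := r')
    (by simp [hpp, hrr.symm, F.ne_of_adj hp hr, F.ne_of_adj hp hr', F.ne_of_adj hp' hr,
      F.ne_of_adj hp' hr']) h1 h2 htr htr'
  have hn := H.nodup hv
  simp only [List.nodup_cons, List.mem_cons, List.not_mem_nil, or_false, not_or,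
    not_false_eq_true, List.nodup_nil, and_true] at hn
  have htv : G.Adj t v := by simp [hv v]
  refine ⟨r', v, hv, hr', fun h => ?_, fun h => ?_⟩
  · rcases H.two hxt hpp hp h1 hp' h2 h htv with rfl | rfl <;> simp at hn
  · rcases H.two hzt hrr.symm hr htr hr' htr' h htv with rfl | rfl <;> simp at hn

end SimpleGraph.HasCounts

namespace SimpleGraph.BadConfig

variable {b f b' t₁ t₂ t₃ u₁ u₂ u₃ r₁ r₂ r₃ v₁ v₂ v₃ : V}

theorem not_adj_third (C : G.BadConfig x z a e a' s₁ s₂ s₃ y₁ y₂ y₃ q₁ q₂ q₃ w₁ w₂ w₃)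
    (H : G.HasCounts 5 0 2) : ¬ G.Adj x w₁ ∧ ¬ G.Adj z w₁ := by
  have hn := H.nodup C.N₁
  simp only [List.nodup_cons, List.mem_cons, List.not_mem_nil, or_false, not_or,
    not_false_eq_true, List.nodup_nil, and_true] at hn
  have hya : G.Adj y₁ a := by simp [C.N₁ a]
  have hys : G.Adj y₁ s₁ := by simp [C.N₁ s₁]
  have hyq : G.Adj y₁ q₂ := by simp [C.N₁ q₂]
  have hyq' : G.Adj y₁ q₃ := by simp [C.N₁ q₃]
  have hyw : G.Adj y₁ w₁ := by simp [C.N₁ w₁]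
  have hxa : G.Adj x a := by simp [C.Nx a]
  have hxs : G.Adj x s₁ := by simp [C.Nx s₁]
  have hzy : z ≠ y₁ := by rintro rfl; exact C.far.not_two a hxa hya.symm
  have hxy : x ≠ y₁ := by rintro rfl; exact C.far.not_two q₂ hyq C.zq₂.symm
  constructor
  · intro h
    rcases H.two hxy hn.1.1 hxa hya hxs hys h hyw with rfl | rfl <;> simp at hn
  · intro h
    rcases H.two hzy hn.2.2.1.1 C.zq₂ hyq C.zq₃ hyq' h hyw with rfl | rfl <;> simp at hn

theorem third_eq_iff (C : G.BadConfig x z a e a' s₁ s₂ s₃ y₁ y₂ y₃ q₁ q₂ q₃ w₁ w₂ w₃)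
    (D : G.BadConfig x z b f b' t₁ t₂ t₃ u₁ u₂ u₃ r₁ r₂ r₃ v₁ v₂ v₃)
    (H : G.HasCounts 5 0 2) (hyy : y₁ ≠ u₁) :
    w₁ = v₁ ↔ ¬ ((a = b ∨ a = t₁ ∨ s₁ = b ∨ s₁ = t₁) ↔
      (q₂ = r₂ ∨ q₂ = r₃ ∨ q₃ = r₂ ∨ q₃ = r₃)) := by
  have h1 := C.not_adj_third H
  have h2 := D.not_adj_third H
  exact H.third_eq_iff C.far hyy C.N₁ D.N₁ (by simp [C.Nx a]) (by simp [C.Nx s₁]) C.zq₂ C.zq₃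
    (by simp [D.Nx b]) (by simp [D.Nx t₁]) D.zq₂ D.zq₃ h1.1 h1.2 h2.1 h2.2

/-- Two neighbours of `z` have only one common neighbour besides `z`, so a layer vertex is
determined by its pair next to `z`. -/
theorem not_both (C : G.BadConfig x z a e a' s₁ s₂ s₃ y₁ y₂ y₃ q₁ q₂ q₃ w₁ w₂ w₃)
    (D : G.BadConfig x z b f b' t₁ t₂ t₃ u₁ u₂ u₃ r₁ r₂ r₃ v₁ v₂ v₃)
    (H : G.HasCounts 5 0 2) (hyy : y₁ ≠ u₁) :
    ¬ (q₂ = r₂ ∧ q₃ = r₃) ∧ ¬ (q₂ = r₃ ∧ q₃ = r₂) := by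
  have key : ¬ (G.Adj u₁ q₂ ∧ G.Adj u₁ q₃) := by
    rintro ⟨h1, h2⟩
    have hn := H.nodup C.N₁
    simp only [List.nodup_cons, List.mem_cons, List.not_mem_nil, or_false, not_or,
      not_false_eq_true, List.nodup_nil, and_true] at hn
    refine hyy (H.common_unique hn.2.2.1.1 C.zq₂ C.zq₃ ((C.N₁ q₂).2 (by simp)).symm
      ((C.N₁ q₃).2 (by simp)).symm h1.symm h2.symm ?_ ?_)
    · rintro rfl
      exact C.far.not_two a (by simp [C.Nx a]) ((C.N₁ a).2 (by simp)).symm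
    · rintro rfl
      exact C.far.not_two b (by simp [D.Nx b]) ((D.N₁ b).2 (by simp)).symm
  constructor
  · rintro ⟨rfl, rfl⟩
    exact key ⟨by simp [D.N₁ q₂], by simp [D.N₁ q₃]⟩
  · rintro ⟨rfl, rfl⟩
    exact key ⟨by simp [D.N₁ q₂], by simp [D.N₁ q₃]⟩

theorem ne_of_partner (C : G.BadConfig x z a e a' s₁ s₂ s₃ y₁ y₂ y₃ q₁ q₂ q₃ w₁ w₂ w₃)
    (D : G.BadConfig x z a' f a t₁ t₂ t₃ u₁ u₂ u₃ r₁ r₂ r₃ v₁ v₂ v₃)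
    (H : G.HasCounts 5 0 2) : y₁ ≠ u₁ := by
  rintro rfl
  have hn := H.nodup D.Nx
  simp only [List.nodup_cons, List.mem_cons, List.not_mem_nil, or_false, not_or,
    not_false_eq_true, List.nodup_nil, and_true] at hn
  have hxa : G.Adj x a := by simp [C.Nx a]
  rcases (D.N₁ a).1 ((C.N₁ a).2 (by simp)) with h | h | h | h | h
  · exact hn.1.1 h.symm
  · exact hn.2.1.1 h
  · exact C.far.ne_of_adj hxa D.zq₂ h
  · exact C.far.ne_of_adj hxa D.zq₃ h
  · exact (D.not_adj_third H).1 (h ▸ hxa)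

/-- Paired configurations do not meet at points opposite to different vertices. -/
theorem ne_of_paired (C : G.BadConfig x z a e a' s₁ s₂ s₃ y₁ y₂ y₃ q₁ q₂ q₃ w₁ w₂ w₃)
    (D : G.BadConfig x z a' e a s₁ s₂ s₃ u₁ u₂ u₃ r₁ r₂ r₃ v₁ v₂ v₃)
    (H : G.HasCounts 5 0 2) : q₁ ≠ r₂ := by
  intro hq
  have C2 := C.rotate
  have C3 := C.rotate.rotate
  have D2 := D.rotate
  have D3 := D.rotate.rotate
  -- `yᵢ` and `uᵢ` share `sᵢ`, so `wᵢ = vᵢ` exactly when they share nothing next to `z`. Given `q₁ =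
  -- r₂`, `not_both` makes this hold for `i = 1, 2`, while it fails for `i = 3`. Then `v₃` differs
  -- from all `wᵢ`, although it is adjacent to `e`.
  have R11 := C.third_eq_iff D H (C.ne_of_partner D H)
  have R22 := C2.third_eq_iff D2 H (C2.ne_of_partner D2 H)
  have R33 := C3.third_eq_iff D3 H (C3.ne_of_partner D3 H)
  have B21 := C2.not_both D H (C2.ne_of_partner D H)
  have B23 := C2.not_both D3 H (C2.ne_of_partner D3 H)
  have B31 := C3.not_both D H (C3.ne_of_partner D H)
  have B33 := C3.not_both D3 H (C3.ne_of_partner D3 H)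
  have n1 := H.nodup C.N₁
  have n2 := H.nodup C.N₂
  have n3 := H.nodup C.N₃
  have m1 := H.nodup D.N₁
  have m2 := H.nodup D.N₂
  have m3 := H.nodup D.N₃
  have nv := H.nodup D.Ne
  have nx := H.nodup C.Nx
  have hv3 := (C.Ne v₃).1 ((D.Ne v₃).2 (by simp))
  simp only [List.nodup_cons, List.mem_cons, List.not_mem_nil, or_false, not_or,
    not_false_eq_true, List.nodup_nil, and_true] at n1 n2 n3 m1 m2 m3 nv nx
  clear C D C2 C3 D2 D3 H
  grind

end SimpleGraph.BadConfig
end PairedConfigs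

/-! ### Paired configurations that meet next to `z`. -/

section PairedConfigs

variable {V : Type*} [Fintype V] [DecidableEq V] {G : SimpleGraph V} [DecidableRel G.Adj]
variable {x z a e a' s₁ s₂ s₃ y₁ y₂ y₃ q₁ q₂ q₃ w₁ w₂ w₃ : V}

theorem SimpleGraph.Nbrs.swap₁₂ {v a b c d e : V} (h : G.Nbrs v a b c d e) :
    G.Nbrs v b a c d e := fun u => by rw [h u]; tauto

theorem SimpleGraph.Nbrs.swap₃₄ {v a b c d e : V} (h : G.Nbrs v a b c d e) :
    G.Nbrs v a b d c e := fun u => by rw [h u]; tauto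

theorem SimpleGraph.Nbrs.rot₃₄₅ {v a b c d e : V} (h : G.Nbrs v a b c d e) :
    G.Nbrs v a b d e c := fun u => by rw [h u]; tauto

theorem SimpleGraph.Far.row_unique (F : G.Far x z) (H : G.HasCounts 5 0 2)
    {y p s q q' w p' s' c c' k : V} (h1 : G.Nbrs y p s q q' w) (h2 : G.Nbrs y p' s' c c' k)
    (hc : G.Adj z c) (hc' : G.Adj z c') (hk : ¬ G.Adj x k ∧ ¬ G.Adj z k) (hp : G.Adj x p)
    (hs : G.Adj x s) (hq : G.Adj z q) (hq' : G.Adj z q') (hw : ¬ G.Adj x w ∧ ¬ G.Adj z w) :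
    (c = q ∧ c' = q' ∨ c = q' ∧ c' = q) ∧ k = w := by
  have n := H.nodup h2
  simp only [List.nodup_cons, List.mem_cons, List.not_mem_nil, or_false, not_or,
    not_false_eq_true, List.nodup_nil, and_true] at n
  have key : ∀ c, G.Adj y c → G.Adj z c → c = q ∨ c = q' := by
    intro c h3 h4
    rcases (h1 c).1 h3 with rfl | rfl | h | h | rfl
    · exact absurd rfl (F.ne_of_adj hp h4)
    · exact absurd rfl (F.ne_of_adj hs h4)
    · exact Or.inl h
    · exact Or.inr h
    · exact absurd h4 hw.2
  constructor
  · rcases key c ((h2 c).2 (by simp)) hc with rfl | rfl <;>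
      rcases key c' ((h2 c').2 (by simp)) hc' with rfl | rfl <;> simp_all
  · rcases (h1 k).1 ((h2 k).2 (by simp)) with rfl | rfl | rfl | rfl | h
    · exact absurd hp hk.1
    · exact absurd hs hk.1
    · exact absurd hq hk.2
    · exact absurd hq' hk.2
    · exact h

/-- `row_unique` determines the points next to `z` only as unordered pairs; the element common to
two such pairs fixes the order. -/
theorem eq_of_pairs {o c c' c'' q r : V} (n1 : o ≠ q) (n2 : q ≠ r)
    (h : c = o ∧ c' = q ∨ c = q ∧ c' = o) (h' : c = o ∧ c'' = r ∨ c = r ∧ c'' = o) :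
    c = o ∧ c' = q ∧ c'' = r := by
  rcases h with ⟨rfl, rfl⟩ | ⟨rfl, rfl⟩ <;> rcases h' with ⟨h1, rfl⟩ | ⟨h1, rfl⟩
  · exact ⟨rfl, rfl, rfl⟩
  · exact ⟨rfl, rfl, h1⟩
  · exact absurd h1.symm n1
  · exact absurd h1 n2

namespace SimpleGraph.BadConfig

variable {u₁ u₂ u₃ r₁ r₂ r₃ v₁ v₂ v₃ : V}

/-- The incidences between paired configurations meeting at the point opposite to `s₁`. -/
theorem paired_thirds (C : G.BadConfig x z a e a' s₁ s₂ s₃ y₁ y₂ y₃ q₁ q₂ q₃ w₁ w₂ w₃)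
    (D : G.BadConfig x z a' e a s₁ s₂ s₃ u₁ u₂ u₃ q₁ r₂ r₃ v₁ v₂ v₃)
    (H : G.HasCounts 5 0 2) : v₁ = w₁ ∧ v₂ = w₃ ∧ v₃ = w₂ ∧ G.Nbrs z q₁ q₂ q₃ r₂ r₃ := by
  have C2 := C.rotate
  have C3 := C.rotate.rotate
  have D2 := D.rotate
  have D3 := D.rotate.rotate
  -- The shared `q₁` gives `w₂ ≠ v₂` and `w₃ ≠ v₃`. By `not_both`, `q₂` and `q₃` differ from `r₂`
  -- and `r₃`, so `w₁ = v₁`, and the other two are interchanged.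
  have R11 := C.third_eq_iff D H (C.ne_of_partner D H)
  have R22 := C2.third_eq_iff D2 H (C2.ne_of_partner D2 H)
  have R33 := C3.third_eq_iff D3 H (C3.ne_of_partner D3 H)
  have B22 := C2.not_both D2 H (C2.ne_of_partner D2 H)
  have B23 := C2.not_both D3 H (C2.ne_of_partner D3 H)
  have B32 := C3.not_both D2 H (C3.ne_of_partner D2 H)
  have B33 := C3.not_both D3 H (C3.ne_of_partner D3 H)
  have n1 := H.nodup C.N₁
  have n2 := H.nodup C.N₂
  have n3 := H.nodup C.N₃
  have m1 := H.nodup D.N₁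
  have m2 := H.nodup D.N₂
  have m3 := H.nodup D.N₃
  have nv := H.nodup D.Ne
  have nx := H.nodup C.Nx
  have hv1 := (C.Ne v₁).1 ((D.Ne v₁).2 (by simp))
  have hv2 := (C.Ne v₂).1 ((D.Ne v₂).2 (by simp))
  have hv3 := (C.Ne v₃).1 ((D.Ne v₃).2 (by simp))
  have hN : [q₁, q₂, q₃, r₂, r₃].Nodup → G.Nbrs z q₁ q₂ q₃ r₂ r₃ := fun h =>
    H.nbrs_of h C.zq₁ C.zq₂ C.zq₃ D.zq₂ D.zq₃
  simp only [List.nodup_cons, List.mem_cons, List.not_mem_nil, or_false, not_or,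
    not_false_eq_true, List.nodup_nil, and_true] at n1 n2 n3 m1 m2 m3 nv nx hN
  clear C D C2 C3 D2 D3 H
  refine ⟨by grind, by grind, by grind, hN ?_⟩
  clear hN
  grind

/-- The second common neighbour of `s₂` and `s₃` is not in the middle layer. -/
theorem paired_not_mid (C : G.BadConfig x z a e a' s₁ s₂ s₃ y₁ y₂ y₃ q₁ q₂ q₃ w₁ w₂ w₃)
    (D : G.BadConfig x z a' e a s₁ s₂ s₃ u₁ u₂ u₃ q₁ r₂ r₃ v₁ v₂ v₃)
    (H : G.HasCounts 5 0 2) {t r : V} (h2 : G.Adj s₂ t) (h3 : G.Adj s₃ t)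
    (hr : G.Adj z r) : ¬ G.Adj t r := by
  intro htr
  obtain ⟨rfl, rfl, rfl, hz⟩ := C.paired_thirds D H
  have nx := H.nodup C.Nx
  have ne := H.nodup C.Ne
  have nz := H.nodup hz
  simp only [List.nodup_cons, List.mem_cons, List.not_mem_nil, or_false, not_or,
    not_false_eq_true, List.nodup_nil, and_true] at nx ne nz
  have hx : ∀ {p : V}, p = a ∨ p = a' ∨ p = s₁ ∨ p = s₂ ∨ p = s₃ → G.Adj x p :=
    fun hp => (C.Nx _).2 hp
  obtain ⟨r', v, hN, hr', hxv, hzv⟩ := H.exists_row C.far nx.2.2.2 (hx (by simp)) (hx (by simp))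
    h2.symm h3.symm hr htr
  have rule : ∀ {y p s q q' w : V}, G.Nbrs y p s q q' w → G.Adj x p → G.Adj x s → p ≠ s₂ →
      p ≠ s₃ → G.Adj z q → G.Adj z q' → ¬ G.Adj x w ∧ ¬ G.Adj z w →
      (v = w ↔ ¬ ((s₂ = p ∨ s₂ = s ∨ s₃ = p ∨ s₃ = s) ↔
        (r = q ∨ r = q' ∨ r' = q ∨ r' = q'))) := by
    intro y p s q q' w hy hp hs h2 h3 hq hq' hw
    refine H.third_eq_iff C.far ?_ hN hy (hx (by simp)) (hx (by simp)) hr hr' hp hs hq hq' hxv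
      hzv hw.1 hw.2
    rintro rfl
    rcases (hN p).1 ((hy p).2 (by simp)) with h | h | h | h | h
    · exact h2 h
    · exact h3 h
    · exact C.far.ne_of_adj hp hr h
    · exact C.far.ne_of_adj hp hr' h
    · exact hxv (h ▸ hp)
  -- The vertex `t` shares nothing next to `x` with `y₁` and `u₁`, and one vertex with each of `y₂`,
  -- `y₃`, `u₂`, `u₃`. No pair `r`, `r'` among the five neighbours of `z` satisfies all six parity
  -- conditions.
  have R1 := rule C.N₁ (hx (by simp)) (hx (by simp)) nx.1.2.2.1 nx.1.2.2.2 C.zq₂ C.zq₃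
    (C.not_adj_third H)
  have R2 := rule C.N₂ (hx (by simp)) (hx (by simp)) nx.1.2.2.1 nx.1.2.2.2 C.zq₁ C.zq₃
    (C.swap.not_adj_third H)
  have R3 := rule C.N₃ (hx (by simp)) (hx (by simp)) nx.1.2.2.1 nx.1.2.2.2 C.zq₁ C.zq₂
    (C.rotate.rotate.not_adj_third H)
  have S1 := rule D.N₁ (hx (by simp)) (hx (by simp)) nx.2.1.2.1 nx.2.1.2.2 D.zq₂ D.zq₃
    (D.not_adj_third H)
  have S2 := rule D.N₂ (hx (by simp)) (hx (by simp)) nx.2.1.2.1 nx.2.1.2.2 D.zq₁ D.zq₃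
    (D.swap.not_adj_third H)
  have S3 := rule D.N₃ (hx (by simp)) (hx (by simp)) nx.2.1.2.1 nx.2.1.2.2 D.zq₁ D.zq₂
    (D.rotate.rotate.not_adj_third H)
  have h1 := (hz r).1 hr
  have h2 := (hz r').1 hr'
  have hn := H.nodup hN
  simp only [List.nodup_cons, List.mem_cons, List.not_mem_nil, or_false, not_or,
    not_false_eq_true, List.nodup_nil, and_true] at hn
  clear rule hx hN C D H hz
  grind

/-- The graph determined by paired configurations. -/
theorem paired_nbrs (C : G.BadConfig x z a e a' s₁ s₂ s₃ y₁ y₂ y₃ q₁ q₂ q₃ w₁ w₂ w₃)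
    (D : G.BadConfig x z a' e a s₁ s₂ s₃ u₁ u₂ u₃ q₁ r₂ r₃ w₁ w₃ w₂)
    (H : G.HasCounts 5 0 2) :
    ∃ t T T' h, G.Nbrs t s₂ s₃ w₂ w₃ h ∧ G.Nbrs T s₁ s₂ q₃ r₃ h ∧ G.Nbrs T' s₁ s₃ q₂ r₂ h ∧
      G.Nbrs s₂ x t T y₂ u₂ ∧ G.Nbrs s₃ x t T' y₃ u₃ ∧ (¬ G.Adj x h ∧ ¬ G.Adj z h) ∧
      ∀ q, G.Adj z q → ¬ G.Adj t q := by
  obtain ⟨-, -, -, hz⟩ := C.paired_thirds D H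
  have nx := H.nodup C.Nx
  have ne := H.nodup C.Ne
  have nz := H.nodup hz
  simp only [List.nodup_cons, List.mem_cons, List.not_mem_nil, or_false, not_or,
    not_false_eq_true, List.nodup_nil, and_true] at nx ne nz
  have hx : ∀ {p : V}, p = a ∨ p = a' ∨ p = s₁ ∨ p = s₂ ∨ p = s₃ → G.Adj x p :=
    fun hp => (C.Nx _).2 hp
  have hs₂ : G.Adj x s₂ := hx (by simp)
  have hs₃ : G.Adj x s₃ := hx (by simp)
  obtain ⟨t, htx, h2t, h3t⟩ := H.other nx.2.2.2 hs₂.symm hs₃.symm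
  have hmid := fun q hq => C.paired_not_mid D H h2t h3t (r := q) hq
  have hyq : ∀ {y q}, G.Adj y q → G.Adj z q → y ≠ x := by
    rintro y q h1 h2 rfl
    exact C.far.not_two q h1 h2.symm
  -- As `t` lies outside the layer, it plays the part of `e` for the partners `s₂` and `s₃`. The
  -- vertices `y₂`, `u₂` and `y₃`, `u₃` reappear in the two new configurations; only `T`, `T'` and
  -- the third neighbour `h` are new.
  obtain ⟨T, Y, U, c₁, c₂, c₃, h, k, k', E⟩ := H.exists_badConfig_of C.far
    (a := s₂) (a' := s₃) (s₁ := s₁) (s₂ := a) (s₃ := a') (e := t) (y := y₂) (q := q₁)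
    (fun u => by rw [C.Nx u]; tauto) ((C.N₂ _).2 (by simp)).symm C.zq₁
    ((C.N₂ _).2 (by simp)) h2t h3t htx hmid
  obtain ⟨T', Y', U', c₁', c₂', c₃', h', l, l', E'⟩ := H.exists_badConfig_of C.far
    (a := s₃) (a' := s₂) (s₁ := s₁) (s₂ := a) (s₃ := a') (e := t) (y := y₃) (q := q₁)
    (fun u => by rw [C.Nx u]; tauto) ((C.N₃ _).2 (by simp)).symm C.zq₁
    ((C.N₃ _).2 (by simp)) h3t h2t htx hmid
  have uniq : ∀ {p p' y y' q q' : V}, p ≠ p' → G.Adj x p → G.Adj x p' → G.Adj y p → G.Adj y p' →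
      G.Adj y' p → G.Adj y' p' → G.Adj z q → G.Adj y q → G.Adj z q' → G.Adj y' q' → y = y' :=
    fun n a1 a2 a3 a4 a5 a6 a7 a8 a9 a10 => H.common_unique n a1 a2 a3.symm a4.symm a5.symm
      a6.symm (hyq a8 a7) (hyq a10 a9)
  have hY : Y = y₂ := uniq nx.1.2.2.1 (hx (by simp)) hs₂ ((E.N₂ _).2 (by simp))
    ((E.N₂ _).2 (by simp)) ((C.N₂ _).2 (by simp)) ((C.N₂ _).2 (by simp)) E.zq₁
    ((E.N₂ _).2 (by simp)) C.zq₁ ((C.N₂ _).2 (by simp))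
  have hU : U = u₂ := uniq nx.2.1.2.1 (hx (by simp)) hs₂ ((E.N₃ _).2 (by simp))
    ((E.N₃ _).2 (by simp)) ((D.N₂ _).2 (by simp)) ((D.N₂ _).2 (by simp)) E.zq₁
    ((E.N₃ _).2 (by simp)) D.zq₁ ((D.N₂ _).2 (by simp))
  have hY' : Y' = y₃ := uniq nx.1.2.2.2 (hx (by simp)) hs₃ ((E'.N₂ _).2 (by simp))
    ((E'.N₂ _).2 (by simp)) ((C.N₃ _).2 (by simp)) ((C.N₃ _).2 (by simp)) E'.zq₁
    ((E'.N₂ _).2 (by simp)) C.zq₁ ((C.N₃ _).2 (by simp))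
  have hU' : U' = u₃ := uniq nx.2.1.2.2 (hx (by simp)) hs₃ ((E'.N₃ _).2 (by simp))
    ((E'.N₃ _).2 (by simp)) ((D.N₃ _).2 (by simp)) ((D.N₃ _).2 (by simp)) E'.zq₁
    ((E'.N₃ _).2 (by simp)) D.zq₁ ((D.N₃ _).2 (by simp))
  subst hY hU hY' hU'
  have K1 := C.far.row_unique H C.N₂ E.N₂ E.zq₁ E.zq₃ (E.swap.not_adj_third H)
    (hx (by simp)) hs₂ C.zq₁ C.zq₃ (C.swap.not_adj_third H)
  have K2 := C.far.row_unique H D.N₂ E.N₃ E.zq₁ E.zq₂ (E.rotate.rotate.not_adj_third H)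
    (hx (by simp)) hs₂ D.zq₁ D.zq₃ (D.swap.not_adj_third H)
  have K3 := C.far.row_unique H C.N₃ E'.N₂ E'.zq₁ E'.zq₃ (E'.swap.not_adj_third H)
    (hx (by simp)) hs₃ C.zq₁ C.zq₂ (C.rotate.rotate.not_adj_third H)
  have K4 := C.far.row_unique H D.N₃ E'.N₃ E'.zq₁ E'.zq₂ (E'.rotate.rotate.not_adj_third H)
    (hx (by simp)) hs₃ D.zq₁ D.zq₂ (D.rotate.rotate.not_adj_third H)
  obtain ⟨K1, rfl⟩ := K1
  obtain ⟨K2, rfl⟩ := K2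
  obtain ⟨K3, rfl⟩ := K3
  obtain ⟨K4, rfl⟩ := K4
  have L1 := eq_of_pairs nz.1.2.1 nz.2.2.1.2 K1 K2
  have L2 := eq_of_pairs nz.1.1 nz.2.1.2.1 K3 K4
  obtain ⟨rfl, rfl, rfl⟩ := L1
  obtain ⟨hc, rfl, rfl⟩ := L2
  have hh : h' = h := by
    have n := H.nodup E'.Ne
    simp only [List.nodup_cons, List.mem_cons, List.not_mem_nil, or_false, not_or,
      not_false_eq_true, List.nodup_nil, and_true] at n
    rcases (E.Ne h').1 ((E'.Ne h').2 (by simp)) with h | h | h | h | h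
    · exact absurd h.symm n.2.1.1
    · exact absurd h.symm n.1.2.1
    · exact h
    · exact absurd h n.2.2.1.2
    · exact absurd h n.2.2.1.1
  subst hh
  exact ⟨t, T, T', h', E.Ne.rot₃₄₅, E.N₁.swap₁₂.swap₃₄, E'.N₁.swap₁₂.swap₃₄, E.Na, E'.Na,
    E.not_adj_third H, hmid⟩

end SimpleGraph.BadConfig
end PairedConfigs

/-! ### The neighbourhood table of `K₂ □ Δ`. -/

section PairedGraphs

variable {V : Type*} [Fintype V] [DecidableEq V] {G : SimpleGraph V} [DecidableRel G.Adj]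
variable {x z a a' s₁ s₂ s₃ e t y₁ y₂ y₃ u₁ u₂ u₃ T T' q₁ q₂ q₃ r₂ r₃ w₁ w₂ w₃ h f g : V}

theorem nodup_five {a b c d e : V} (h1 : a ≠ b) (h2 : a ≠ c) (h3 : a ≠ d) (h4 : a ≠ e)
    (h5 : b ≠ c) (h6 : b ≠ d) (h7 : b ≠ e) (h8 : c ≠ d) (h9 : c ≠ e) (h10 : d ≠ e) :
    [a, b, c, d, e].Nodup := by
  simp [*]

namespace SimpleGraph.Nbrs

variable {v a b c d e : V}

theorem adj₁ (h : G.Nbrs v a b c d e) : G.Adj v a := (h a).2 (by simp)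
theorem adj₂ (h : G.Nbrs v a b c d e) : G.Adj v b := (h b).2 (by simp)
theorem adj₃ (h : G.Nbrs v a b c d e) : G.Adj v c := (h c).2 (by simp)
theorem adj₄ (h : G.Nbrs v a b c d e) : G.Adj v d := (h d).2 (by simp)
theorem adj₅ (h : G.Nbrs v a b c d e) : G.Adj v e := (h e).2 (by simp)

theorem ne (h : G.Nbrs v a b c d e) (H : G.HasCounts 5 0 2) :
    (a ≠ b ∧ a ≠ c ∧ a ≠ d ∧ a ≠ e) ∧ (b ≠ c ∧ b ≠ d ∧ b ≠ e) ∧ (c ≠ d ∧ c ≠ e) ∧ d ≠ e := by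
  have hn := H.nodup h
  simp only [List.nodup_cons, List.mem_cons, List.not_mem_nil, or_false, not_or,
    not_false_eq_true, List.nodup_nil, and_true] at hn
  exact hn

end SimpleGraph.Nbrs

/-- A vertex of the middle layer is adjacent to no further neighbour of `x`. -/
theorem SimpleGraph.Far.not_adj_of_row (F : G.Far x z) {y p s q q' w c : V}
    (hN : G.Nbrs y p s q q' w) (hq : G.Adj z q) (hq' : G.Adj z q') (hw : ¬ G.Adj x w)
    (hc : G.Adj x c) (hp : c ≠ p) (hs : c ≠ s) : ¬ G.Adj y c := by
  intro h
  rcases (hN c).1 h with rfl | rfl | rfl | rfl | rfl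
  · exact hp rfl
  · exact hs rfl
  · exact F.ne_of_adj hc hq rfl
  · exact F.ne_of_adj hc hq' rfl
  · exact hw hc

/-- The neighbourhoods in the graph determined by two paired configurations. -/
structure SimpleGraph.PairedGraph (G : SimpleGraph V)
    (x z a a' s₁ s₂ s₃ e t y₁ y₂ y₃ u₁ u₂ u₃ T T' q₁ q₂ q₃ r₂ r₃ w₁ w₂ w₃ h : V) : Prop where
  far : G.Far x z
  Nx : G.Nbrs x a a' s₁ s₂ s₃
  Nz : G.Nbrs z q₁ q₂ q₃ r₂ r₃
  Na : G.Nbrs a x e y₁ y₂ y₃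
  Na' : G.Nbrs a' x e u₁ u₂ u₃
  Ns₁ : G.Nbrs s₁ x y₁ u₁ T T'
  Ns₂ : G.Nbrs s₂ x t T y₂ u₂
  Ns₃ : G.Nbrs s₃ x t T' y₃ u₃
  Ne : G.Nbrs e a a' w₁ w₂ w₃
  Nt : G.Nbrs t s₂ s₃ w₂ w₃ h
  Ny₁ : G.Nbrs y₁ a s₁ q₂ q₃ w₁
  Ny₂ : G.Nbrs y₂ a s₂ q₁ q₃ w₂
  Ny₃ : G.Nbrs y₃ a s₃ q₁ q₂ w₃
  Nu₁ : G.Nbrs u₁ a' s₁ r₂ r₃ w₁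
  Nu₂ : G.Nbrs u₂ a' s₂ q₁ r₃ w₃
  Nu₃ : G.Nbrs u₃ a' s₃ q₁ r₂ w₂
  NT : G.Nbrs T s₁ s₂ q₃ r₃ h
  NT' : G.Nbrs T' s₁ s₃ q₂ r₂ h
  e_not_mid : ∀ q, G.Adj z q → ¬ G.Adj e q
  t_not_mid : ∀ q, G.Adj z q → ¬ G.Adj t q
  not_adj_w₁ : ¬ G.Adj x w₁ ∧ ¬ G.Adj z w₁
  not_adj_w₂ : ¬ G.Adj x w₂ ∧ ¬ G.Adj z w₂
  not_adj_w₃ : ¬ G.Adj x w₃ ∧ ¬ G.Adj z w₃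
  not_adj_h : ¬ G.Adj x h ∧ ¬ G.Adj z h

theorem SimpleGraph.BadConfig.exists_pairedGraph
    (C : G.BadConfig x z a e a' s₁ s₂ s₃ y₁ y₂ y₃ q₁ q₂ q₃ w₁ w₂ w₃) {v₁ v₂ v₃ : V}
    (D : G.BadConfig x z a' e a s₁ s₂ s₃ u₁ u₂ u₃ q₁ r₂ r₃ v₁ v₂ v₃)
    (H : G.HasCounts 5 0 2) : ∃ t T T' h,
    G.PairedGraph x z a a' s₁ s₂ s₃ e t y₁ y₂ y₃ u₁ u₂ u₃ T T' q₁ q₂ q₃ r₂ r₃ w₁ w₂ w₃ h := by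
  obtain ⟨rfl, rfl, rfl, Nz⟩ := C.paired_thirds D H
  obtain ⟨t, T, T', h, Nt, NT, NT', Ns₂, Ns₃, hh, ht⟩ := C.paired_nbrs D H
  have c1 := C.not_adj_third H
  have c2 := C.swap.not_adj_third H
  have c3 := C.rotate.rotate.not_adj_third H
  have nx := C.Nx.ne H
  have hxy : ∀ {y q}, G.Adj y q → G.Adj z q → x ≠ y := by
    rintro y q h1 h2 rfl
    exact C.far.not_two q h1 h2.symm
  have n1 : y₁ ≠ T := G.ne_of_adj_of_not_adj C.N₁.adj₁ (C.far.not_adj_of_row NT C.zq₃ D.zq₃ hh.1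
    C.Nx.adj₁ nx.1.2.1 nx.1.2.2.1)
  have n2 : y₁ ≠ T' := G.ne_of_adj_of_not_adj C.N₁.adj₁ (C.far.not_adj_of_row NT' C.zq₂ D.zq₂
    hh.1 C.Nx.adj₁ nx.1.2.1 nx.1.2.2.2)
  have n3 : u₁ ≠ T := G.ne_of_adj_of_not_adj D.N₁.adj₁ (C.far.not_adj_of_row NT C.zq₃ D.zq₃ hh.1
    C.Nx.adj₂ nx.2.1.1 nx.2.1.2.1)
  have n4 : u₁ ≠ T' := G.ne_of_adj_of_not_adj D.N₁.adj₁ (C.far.not_adj_of_row NT' C.zq₂ D.zq₂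
    hh.1 C.Nx.adj₂ nx.2.1.1 nx.2.1.2.2)
  have n5 : T ≠ T' := G.ne_of_adj_of_not_adj NT.adj₂ (C.far.not_adj_of_row NT' C.zq₂ D.zq₂
    hh.1 C.Nx.adj₄ nx.2.2.1.1.symm nx.2.2.2)
  exact ⟨t, T, T', h,
    { far := C.far
      Nx := C.Nx
      Nz := Nz
      Na := C.Na
      Na' := D.Na
      Ns₁ := H.nbrs_of (nodup_five (hxy C.N₁.adj₃ C.zq₂) (hxy D.N₁.adj₃ D.zq₂)
        (hxy NT.adj₃ C.zq₃) (hxy NT'.adj₃ C.zq₂) (C.ne_of_partner D H) n1 n2 n3 n4 n5)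
        C.Nx.adj₃.symm C.N₁.adj₂.symm D.N₁.adj₂.symm NT.adj₁.symm NT'.adj₁.symm
      Ns₂ := Ns₂
      Ns₃ := Ns₃
      Ne := C.Ne
      Nt := Nt
      Ny₁ := C.N₁
      Ny₂ := C.N₂
      Ny₃ := C.N₃
      Nu₁ := D.N₁
      Nu₂ := D.N₂
      Nu₃ := D.N₃
      NT := NT
      NT' := NT'
      e_not_mid := C.not_mid
      t_not_mid := ht
      not_adj_w₁ := c1
      not_adj_w₂ := c2
      not_adj_w₃ := c3
      not_adj_h := hh }⟩

namespace SimpleGraph.PairedGraph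

theorem swap (A : G.PairedGraph x z a a' s₁ s₂ s₃ e t y₁ y₂ y₃ u₁ u₂ u₃ T T' q₁ q₂ q₃ r₂ r₃
    w₁ w₂ w₃ h) : G.PairedGraph x z a a' s₁ s₃ s₂ e t y₁ y₃ y₂ u₁ u₃ u₂ T' T q₁ q₃ q₂ r₃ r₂
    w₁ w₃ w₂ h where
  far := A.far
  Nx u := by rw [A.Nx u]; tauto
  Nz u := by rw [A.Nz u]; tauto
  Na u := by rw [A.Na u]; tauto
  Na' u := by rw [A.Na' u]; tauto
  Ns₁ u := by rw [A.Ns₁ u]; tauto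
  Ns₂ := A.Ns₃
  Ns₃ := A.Ns₂
  Ne u := by rw [A.Ne u]; tauto
  Nt u := by rw [A.Nt u]; tauto
  Ny₁ := A.Ny₁.swap₃₄
  Ny₂ := A.Ny₃
  Ny₃ := A.Ny₂
  Nu₁ := A.Nu₁.swap₃₄
  Nu₂ := A.Nu₃
  Nu₃ := A.Nu₂
  NT := A.NT'
  NT' := A.NT
  e_not_mid := A.e_not_mid
  t_not_mid := A.t_not_mid
  not_adj_w₁ := A.not_adj_w₁
  not_adj_w₂ := A.not_adj_w₃
  not_adj_w₃ := A.not_adj_w₂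
  not_adj_h := A.not_adj_h

theorem ne_layers (A : G.PairedGraph x z a a' s₁ s₂ s₃ e t y₁ y₂ y₃ u₁ u₂ u₃ T T' q₁ q₂ q₃ r₂
    r₃ w₁ w₂ w₃ h) {y p q : V} (hp : G.Adj x p) (hyp : G.Adj y p) (hq : G.Adj z q)
    (hyq : G.Adj y q) : x ≠ y ∧ z ≠ y ∧ y ≠ e ∧ y ≠ t := by
  refine ⟨?_, ?_, ?_, ?_⟩
  · rintro rfl; exact A.far.not_two q hyq hq.symm
  · rintro rfl; exact A.far.not_two p hp hyp.symm
  · rintro rfl; exact A.e_not_mid q hq hyq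
  · rintro rfl; exact A.t_not_mid q hq hyq

/-- The situation repeats at the other end: the fifth neighbour `f` of `q₂` lies outside the layer,
and `adj_third` from `z` joins it to the third neighbours of `y₁`, `y₃` and `T'`. -/
theorem exists_end (A : G.PairedGraph x z a a' s₁ s₂ s₃ e t y₁ y₂ y₃ u₁ u₂ u₃ T T' q₁ q₂ q₃ r₂
    r₃ w₁ w₂ w₃ h) (H : G.HasCounts 5 0 2) : ∃ f, G.Nbrs q₂ z y₁ y₃ T' f ∧
      (∀ p, G.Adj x p → ¬ G.Adj f p) ∧ G.Adj f r₃ ∧ G.Adj f w₁ ∧ G.Adj f w₃ ∧ G.Adj f h := by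
  have nx := A.Nx.ne H
  have nz := A.Nz.ne H
  have na := A.Na.ne H
  have l1 := A.ne_layers A.Nx.adj₁ A.Ny₁.adj₁ A.Nz.adj₂ A.Ny₁.adj₃
  have l3 := A.ne_layers A.Nx.adj₁ A.Ny₃.adj₁ A.Nz.adj₂ A.Ny₃.adj₄
  have lT := A.ne_layers A.Nx.adj₃ A.NT'.adj₁ A.Nz.adj₂ A.NT'.adj₃
  obtain ⟨f, hf⟩ := H.exists_fifth (v := q₂) (a := z) (b := y₁) (c := y₃) (d := T')
    (by simp [l1.2.1, l3.2.1, lT.2.1, na.2.2.1.2, (A.Ns₁.ne H).2.1.2.2,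
      (A.Ns₃.ne H).2.2.1.1.symm])
    A.Nz.adj₂.symm A.Ny₁.adj₃.symm A.Ny₃.adj₄.symm A.NT'.adj₃.symm
  obtain ⟨⟨-, -, -, m1⟩, ⟨-, -, m2⟩, ⟨-, m3⟩, m4⟩ := hf.ne H
  have hfq : G.Adj f q₂ := hf.adj₅.symm
  have b1 : ¬ G.Adj x q₂ := fun h => A.far.not_two q₂ h A.Nz.adj₂.symm
  have b2 := A.e_not_mid q₂ A.Nz.adj₂
  have b3 := A.t_not_mid q₂ A.Nz.adj₂
  have right : ∀ {y p s q q' w : V}, G.Nbrs y p s q q' w → G.Adj x p → G.Adj x s →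
      ¬ G.Adj z w → q₂ ≠ q → q₂ ≠ q' → ¬ G.Adj y q₂ := fun hN hp hs hw =>
    A.far.symm.not_adj_of_row (fun u => by rw [hN u]; tauto : G.Nbrs _ _ _ _ _ _) hp hs hw
      A.Nz.adj₂
  have b4 := right A.Ny₂ A.Nx.adj₁ A.Nx.adj₄ A.not_adj_w₂.2 nz.1.1.symm nz.2.1.1
  have b5 := right A.Nu₁ A.Nx.adj₂ A.Nx.adj₃ A.not_adj_w₁.2 nz.2.1.2.1 nz.2.1.2.2
  have b6 := right A.Nu₂ A.Nx.adj₂ A.Nx.adj₄ A.not_adj_w₃.2 nz.1.1.symm nz.2.1.2.2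
  have b7 := right A.Nu₃ A.Nx.adj₂ A.Nx.adj₅ A.not_adj_w₂.2 nz.1.1.symm nz.2.1.2.1
  have b8 := right A.NT A.Nx.adj₃ A.Nx.adj₄ A.not_adj_h.2 nz.2.1.1 nz.2.1.2.2
  have hfx : ∀ p, G.Adj x p → ¬ G.Adj f p := by
    intro p hp hfp
    rcases (A.Nx p).1 hp with rfl | rfl | rfl | rfl | rfl
    · rcases (A.Na f).1 hfp.symm with rfl | rfl | rfl | rfl | rfl <;> contradiction
    · rcases (A.Na' f).1 hfp.symm with rfl | rfl | rfl | rfl | rfl <;> contradiction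
    · rcases (A.Ns₁ f).1 hfp.symm with rfl | rfl | rfl | rfl | rfl <;> contradiction
    · rcases (A.Ns₂ f).1 hfp.symm with rfl | rfl | rfl | rfl | rfl <;> contradiction
    · rcases (A.Ns₃ f).1 hfp.symm with rfl | rfl | rfl | rfl | rfl <;> contradiction
  have third := fun {p y w : V} (hp : G.Adj x p) (hyp : G.Adj y p) (hqy : G.Adj q₂ y) =>
    H.adj_third (w := w) A.far.symm A.Nz.adj₂ hqy hp hyp hf.adj₅ m1.symm hfx
  refine ⟨f, hf, hfx, ?_, third A.Nx.adj₁ A.Ny₁.adj₁ hf.adj₂ A.Ny₁.adj₅ A.not_adj_w₁.2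
    A.not_adj_w₁.1, third A.Nx.adj₁ A.Ny₃.adj₁ hf.adj₃ A.Ny₃.adj₅ A.not_adj_w₃.2
    A.not_adj_w₃.1, third A.Nx.adj₃ A.NT'.adj₁ hf.adj₄ A.NT'.adj₅ A.not_adj_h.2 A.not_adj_h.1⟩
  -- The second common neighbour of `z` and `f` is `r₃`: each of `q₁`, `q₃`, `r₂` already shares
  -- with `q₂` the vertex `z` and one of `y₃`, `y₁`, `T'`.
  obtain ⟨c, hc, hzc, hfc⟩ := H.other m1 A.Nz.adj₂ hfq
  have no : ∀ {y}, y ≠ z → f ≠ y → G.Adj c y → G.Adj q₂ y → False := by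
    intro y h1 h2 h3 h4
    rcases H.two hc h1 h3 h4 hzc.symm A.Nz.adj₂.symm hfc.symm hf.adj₅ with h | h
    · exact h2 h
    · exact m1 h.symm
  rcases (A.Nz c).1 hzc with rfl | rfl | rfl | rfl | rfl
  · exact (no l3.2.1.symm m3.symm A.Ny₃.adj₃.symm hf.adj₃).elim
  · exact absurd rfl hc
  · exact (no l1.2.1.symm m2.symm A.Ny₁.adj₄.symm hf.adj₂).elim
  · exact (no lT.2.1.symm m4.symm A.NT'.adj₄.symm hf.adj₄).elim
  · exact hfc

end SimpleGraph.PairedGraph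
end PairedGraphs

/-! ### Completing the table and labelling `K₂ □ Δ`. -/

section PairedGraphs

variable {V : Type*} [Fintype V] [DecidableEq V] {G : SimpleGraph V} [DecidableRel G.Adj]
variable {x z a a' s₁ s₂ s₃ e t y₁ y₂ y₃ u₁ u₂ u₃ T T' q₁ q₂ q₃ r₂ r₃ w₁ w₂ w₃ h f g : V}

theorem SimpleGraph.Nbrs.perm {v a b c d e a' b' c' d' e' : V} (h : G.Nbrs v a b c d e)
    (hp : ∀ u, (u = a ∨ u = b ∨ u = c ∨ u = d ∨ u = e) =
      (u = a' ∨ u = b' ∨ u = c' ∨ u = d' ∨ u = e')) : G.Nbrs v a' b' c' d' e' :=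
  fun u => (h u).trans (iff_of_eq (hp u))

theorem forall_zmod_seven {p : ZMod 7 → Prop} :
    (∀ i, p i) ↔ p 0 ∧ p 1 ∧ p 2 ∧ p 3 ∧ p 4 ∧ p 5 ∧ p 6 :=
  ⟨fun h => ⟨h 0, h 1, h 2, h 3, h 4, h 5, h 6⟩, fun ⟨h0, h1, h2, h3, h4, h5, h6⟩ i => by
    fin_cases i <;> assumption⟩

namespace SimpleGraph.PairedGraph

theorem nbrs_q₁ (A : G.PairedGraph x z a a' s₁ s₂ s₃ e t y₁ y₂ y₃ u₁ u₂ u₃ T T' q₁ q₂ q₃ r₂ r₃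
    w₁ w₂ w₃ h) (H : G.HasCounts 5 0 2) : G.Nbrs q₁ z y₂ y₃ u₂ u₃ := by
  obtain ⟨⟨-, -, n1, n2⟩, ⟨-, m1, m2⟩, ⟨-, -⟩, -⟩ := A.Nx.ne H
  exact H.nbrs_of (nodup_five (A.ne_layers A.Nx.adj₁ A.Ny₂.adj₁ A.Nz.adj₁ A.Ny₂.adj₃).2.1
    (A.ne_layers A.Nx.adj₁ A.Ny₃.adj₁ A.Nz.adj₁ A.Ny₃.adj₃).2.1
    (A.ne_layers A.Nx.adj₂ A.Nu₂.adj₁ A.Nz.adj₁ A.Nu₂.adj₃).2.1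
    (A.ne_layers A.Nx.adj₂ A.Nu₃.adj₁ A.Nz.adj₁ A.Nu₃.adj₃).2.1
    (A.Na.ne H).2.2.2 (A.Ns₂.ne H).2.2.2
    (G.ne_of_adj_of_not_adj A.Ny₂.adj₂ (A.far.not_adj_of_row A.Nu₃ A.Nz.adj₁ A.Nz.adj₄
      A.not_adj_w₂.1 A.Nx.adj₄ m1.symm (A.Nx.ne H).2.2.2))
    (G.ne_of_adj_of_not_adj A.Ny₃.adj₂ (A.far.not_adj_of_row A.Nu₂ A.Nz.adj₁ A.Nz.adj₅
      A.not_adj_w₃.1 A.Nx.adj₅ m2.symm (A.Nx.ne H).2.2.2.symm))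
    (A.Ns₃.ne H).2.2.2 (A.Na'.ne H).2.2.2)
    A.Nz.adj₁.symm A.Ny₂.adj₃.symm A.Ny₃.adj₃.symm A.Nu₂.adj₃.symm A.Nu₃.adj₃.symm

theorem nbrs_end (A : G.PairedGraph x z a a' s₁ s₂ s₃ e t y₁ y₂ y₃ u₁ u₂ u₃ T T' q₁ q₂ q₃ r₂ r₃
    w₁ w₂ w₃ h) (H : G.HasCounts 5 0 2) (Nf : G.Nbrs q₂ z y₁ y₃ T' f)
    (hf : ∀ p, G.Adj x p → ¬ G.Adj f p) (h₁ : G.Adj f r₃) (h₂ : G.Adj f w₁) (h₃ : G.Adj f w₃)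
    (h₄ : G.Adj f h) :
    h ≠ w₁ ∧ G.Nbrs f q₂ r₃ w₁ w₃ h ∧ G.Nbrs w₃ y₃ u₂ e t f ∧ G.Nbrs r₃ z u₁ u₂ T f := by
  have nq := (A.Nz.ne H).2.1.2.2
  have nf : ∀ {y p}, G.Adj x p → G.Adj y p → y ≠ f := by
    rintro y p hp hy rfl; exact hf p hp hy
  -- The vertices `y₁` and `T` already share `s₁` and `q₃`, so their third neighbours differ.
  have hw : h ≠ w₁ := by
    rintro rfl
    rcases H.two (u := y₁) (v := T) (p := s₁) (q := q₃) (r := h) (A.Ns₁.ne H).2.1.2.1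
      (A.NT.ne H).1.2.1 A.Ny₁.adj₂ A.NT.adj₁ A.Ny₁.adj₄ A.NT.adj₃ A.Ny₁.adj₅ A.NT.adj₅ with h | h
    · exact (A.NT.ne H).1.2.2.2 h.symm
    · exact (A.NT.ne H).2.2.1.2 h.symm
  have het : e ≠ t := by
    refine G.ne_of_adj_of_not_adj A.Ne.adj₁ fun hta => ?_
    obtain ⟨⟨-, -, n1, n2⟩, -, -, -⟩ := A.Nx.ne H
    rcases (A.Nt a).1 hta with rfl | rfl | rfl | rfl | rfl
    · exact n1 rfl
    · exact n2 rfl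
    · exact A.not_adj_w₂.1 A.Nx.adj₁
    · exact A.not_adj_w₃.1 A.Nx.adj₁
    · exact A.not_adj_h.1 A.Nx.adj₁
  have mid := fun {y p q : V} (hp : G.Adj x p) (hyp : G.Adj y p) (hq : G.Adj z q)
    (hyq : G.Adj y q) => A.ne_layers hp hyp hq hyq
  have l3 := mid A.Nx.adj₁ A.Ny₃.adj₁ A.Nz.adj₁ A.Ny₃.adj₃
  have l2 := mid A.Nx.adj₂ A.Nu₂.adj₁ A.Nz.adj₁ A.Nu₂.adj₃
  have l1 := mid A.Nx.adj₂ A.Nu₁.adj₁ A.Nz.adj₄ A.Nu₁.adj₃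
  have lT := mid A.Nx.adj₃ A.NT.adj₁ A.Nz.adj₅ A.NT.adj₄
  have hfz : z ≠ f := (Nf.ne H).1.2.2.2
  refine ⟨hw, H.nbrs_of (nodup_five nq (A.Ny₁.ne H).2.2.1.2 (A.Ny₃.ne H).2.2.2
      (A.NT'.ne H).2.2.1.2 (A.Nu₁.ne H).2.2.2 (A.Nu₂.ne H).2.2.2 (A.NT.ne H).2.2.2
      (A.Ne.ne H).2.2.1.2 hw.symm (A.Nt.ne H).2.2.2) Nf.adj₅.symm h₁ h₂ h₃ h₄,
    H.nbrs_of (nodup_five (G.ne_of_adj_of_not_adj A.Ny₃.adj₂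
      (A.far.not_adj_of_row A.Nu₂ A.Nz.adj₁ A.Nz.adj₅ A.not_adj_w₃.1 A.Nx.adj₅
      (A.Nx.ne H).2.1.2.2.symm (A.Nx.ne H).2.2.2.symm)) l3.2.2.1 l3.2.2.2 (nf A.Nx.adj₁ A.Ny₃.adj₁)
      l2.2.2.1 l2.2.2.2 (nf A.Nx.adj₂ A.Nu₂.adj₁) het (nf A.Nx.adj₁ A.Ne.adj₁)
      (nf A.Nx.adj₄ A.Nt.adj₁)) A.Ny₃.adj₅.symm A.Nu₂.adj₅.symm A.Ne.adj₅.symm A.Nt.adj₄.symm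
      h₃.symm,
    H.nbrs_of (nodup_five l1.2.1 l2.2.1 lT.2.1 hfz (A.Na'.ne H).2.2.1.1 (A.Ns₁.ne H).2.2.1.1
      (nf A.Nx.adj₂ A.Nu₁.adj₁) (A.Ns₂.ne H).2.2.1.2.symm (nf A.Nx.adj₂ A.Nu₂.adj₁)
      (nf A.Nx.adj₃ A.NT.adj₁)) A.Nz.adj₅.symm A.Nu₁.adj₄.symm A.Nu₂.adj₄.symm A.NT.adj₄.symm
      h₁.symm⟩

set_option maxHeartbeats 1000000 in
-- With the two outer vertices `f` and `g`, next to `q₂` and `q₃`, all 28 neighbourhoods are known.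
-- In the labelling `x` is point 0 of the first copy, and the edge from `x` to `s₁` has the
-- direction of `K₂`.
theorem nonempty_iso (A : G.PairedGraph x z a a' s₁ s₂ s₃ e t y₁ y₂ y₃ u₁ u₂ u₃ T T' q₁ q₂ q₃
    r₂ r₃ w₁ w₂ w₃ h) (H : G.HasCounts 5 0 2) (hG : G.Connected) :
    Nonempty (G ≃g (⊤ : SimpleGraph (Fin 2)).boxProd delta41) := by
  obtain ⟨f, Nq₂, hf, f₁, f₂, f₃, f₄⟩ := A.exists_end H
  obtain ⟨g, Nq₃, hg, g₁, g₂, g₃, g₄⟩ := A.swap.exists_end H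
  obtain ⟨hw, Nf, Nw₃, Nr₃⟩ := A.nbrs_end H Nq₂ hf f₁ f₂ f₃ f₄
  obtain ⟨-, Ng, Nw₂, Nr₂⟩ := A.swap.nbrs_end H Nq₃ hg g₁ g₂ g₃ g₄
  have nf : ∀ {y p}, G.Adj x p → G.Adj y p → y ≠ f := by
    rintro y p hp hy rfl; exact hf p hp hy
  have ng : ∀ {y p}, G.Adj x p → G.Adj y p → y ≠ g := by
    rintro y p hp hy rfl; exact hg p hp hy
  have fg : f ≠ g := by
    rintro rfl
    obtain ⟨⟨n1, -, -, n2⟩, ⟨-, -, n3⟩, -, -⟩ := Nq₂.ne H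
    rcases H.two (A.Nz.ne H).2.1.1 n1 Nq₂.adj₁ Nq₃.adj₁ Nq₂.adj₂ Nq₃.adj₂ Nq₂.adj₅ Nq₃.adj₅
      with h | h
    · exact n2 h.symm
    · exact n3 h.symm
  have Nw₁ : G.Nbrs w₁ y₁ u₁ e f g := H.nbrs_of (nodup_five (A.Ns₁.ne H).2.1.1
    (A.Na.ne H).2.1.1.symm (nf A.Nx.adj₁ A.Ny₁.adj₁) (ng A.Nx.adj₁ A.Ny₁.adj₁)
    (A.Na'.ne H).2.1.1.symm (nf A.Nx.adj₂ A.Nu₁.adj₁) (ng A.Nx.adj₂ A.Nu₁.adj₁)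
    (nf A.Nx.adj₁ A.Ne.adj₁) (ng A.Nx.adj₁ A.Ne.adj₁) fg)
    A.Ny₁.adj₅.symm A.Nu₁.adj₅.symm A.Ne.adj₃.symm f₂.symm g₂.symm
  have Nh : G.Nbrs h T T' t f g := H.nbrs_of (nodup_five (A.Ns₁.ne H).2.2.2
    (A.Ns₂.ne H).2.1.1.symm (nf A.Nx.adj₃ A.NT.adj₁) (ng A.Nx.adj₃ A.NT.adj₁)
    (A.Ns₃.ne H).2.1.1.symm (nf A.Nx.adj₃ A.NT'.adj₁) (ng A.Nx.adj₃ A.NT'.adj₁)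
    (nf A.Nx.adj₄ A.Nt.adj₁) (ng A.Nx.adj₄ A.Nt.adj₁) fg)
    A.NT.adj₅.symm A.NT'.adj₅.symm A.Nt.adj₅.symm f₄.symm g₄.symm
  have nz : ∀ {q}, G.Adj z q → q ≠ x := by
    rintro q h rfl; exact A.far.not_adj h.symm
  have nt : ∀ {p q r}, G.Adj x p → G.Adj p q → G.Adj q r → r ≠ x := by
    rintro p q r h1 h2 h3 rfl; exact H.not_triangle h1 h2 h3.symm
  refine H.nonempty_iso_boxProd_delta41 hG
    ![![x, t, u₂, e, u₃, y₂, y₃], ![s₁, h, r₃, w₁, r₂, q₃, q₂]]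
    ![![a, s₃, s₂, w₃, a', w₂, q₁], ![y₁, T', T, f, u₁, g, z]] ?_ ?_ ?_ ?_
  · refine Fin.forall_fin_two.2 ⟨forall_zmod_seven.2 ⟨?_, ?_, ?_, ?_, ?_, ?_, ?_⟩,
      forall_zmod_seven.2 ⟨?_, ?_, ?_, ?_, ?_, ?_, ?_⟩⟩
    · exact (show G.Nbrs x s₁ a a' s₂ s₃ from Nbrs.perm (A.Nx) fun u => by ac_rfl)
    · exact (show G.Nbrs t h s₃ w₂ w₃ s₂ from Nbrs.perm (A.Nt) fun u => by ac_rfl)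
    · exact (show G.Nbrs u₂ r₃ s₂ q₁ a' w₃ from Nbrs.perm (A.Nu₂) fun u => by ac_rfl)
    · exact (show G.Nbrs e w₁ w₃ a w₂ a' from Nbrs.perm (A.Ne) fun u => by ac_rfl)
    · exact (show G.Nbrs u₃ r₂ a' s₃ q₁ w₂ from Nbrs.perm (A.Nu₃) fun u => by ac_rfl)
    · exact (show G.Nbrs y₂ q₃ w₂ s₂ a q₁ from Nbrs.perm (A.Ny₂) fun u => by ac_rfl)
    · exact (show G.Nbrs y₃ q₂ q₁ w₃ s₃ a from Nbrs.perm (A.Ny₃) fun u => by ac_rfl)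
    · exact (show G.Nbrs s₁ x y₁ u₁ T T' from Nbrs.perm (A.Ns₁) fun u => by ac_rfl)
    · exact (show G.Nbrs h t T' g f T from Nbrs.perm (Nh) fun u => by ac_rfl)
    · exact (show G.Nbrs r₃ u₂ T z u₁ f from Nbrs.perm (Nr₃) fun u => by ac_rfl)
    · exact (show G.Nbrs w₁ e f y₁ g u₁ from Nbrs.perm (Nw₁) fun u => by ac_rfl)
    · exact (show G.Nbrs r₂ u₃ u₁ T' z g from Nbrs.perm (Nr₂) fun u => by ac_rfl)
    · exact (show G.Nbrs q₃ y₂ g T y₁ z from Nbrs.perm (Nq₃) fun u => by ac_rfl)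
    · exact (show G.Nbrs q₂ y₃ z f T' y₁ from Nbrs.perm (Nq₂) fun u => by ac_rfl)
  · refine Fin.forall_fin_two.2 ⟨forall_zmod_seven.2 ⟨?_, ?_, ?_, ?_, ?_, ?_, ?_⟩,
      forall_zmod_seven.2 ⟨?_, ?_, ?_, ?_, ?_, ?_, ?_⟩⟩
    · exact (show G.Nbrs a y₁ x e y₂ y₃ from Nbrs.perm (A.Na) fun u => by ac_rfl)
    · exact (show G.Nbrs s₃ T' t u₃ y₃ x from Nbrs.perm (A.Ns₃) fun u => by ac_rfl)
    · exact (show G.Nbrs s₂ T u₂ y₂ x t from Nbrs.perm (A.Ns₂) fun u => by ac_rfl)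
    · exact (show G.Nbrs w₃ f e y₃ t u₂ from Nbrs.perm (Nw₃) fun u => by ac_rfl)
    · exact (show G.Nbrs a' u₁ u₃ x u₂ e from Nbrs.perm (A.Na') fun u => by ac_rfl)
    · exact (show G.Nbrs w₂ g y₂ t e u₃ from Nbrs.perm (Nw₂) fun u => by ac_rfl)
    · exact (show G.Nbrs q₁ z y₃ u₂ u₃ y₂ from Nbrs.perm (A.nbrs_q₁ H) fun u => by ac_rfl)
    · exact (show G.Nbrs y₁ a s₁ w₁ q₃ q₂ from Nbrs.perm (A.Ny₁) fun u => by ac_rfl)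
    · exact (show G.Nbrs T' s₃ h r₂ q₂ s₁ from Nbrs.perm (A.NT') fun u => by ac_rfl)
    · exact (show G.Nbrs T s₂ r₃ q₃ s₁ h from Nbrs.perm (A.NT) fun u => by ac_rfl)
    · exact (show G.Nbrs f w₃ w₁ q₂ h r₃ from Nbrs.perm (Nf) fun u => by ac_rfl)
    · exact (show G.Nbrs u₁ a' r₂ s₁ r₃ w₁ from Nbrs.perm (A.Nu₁) fun u => by ac_rfl)
    · exact (show G.Nbrs g w₂ q₃ h w₁ r₂ from Nbrs.perm (Ng) fun u => by ac_rfl)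
    · exact (show G.Nbrs z q₁ q₂ r₃ r₂ q₃ from Nbrs.perm (A.Nz) fun u => by ac_rfl)
  · have key := fun {y : V} {b : Prop} (h : y ≠ x) (h' : y = x) => (absurd h' h : b)
    refine Fin.forall_fin_two.2 ⟨forall_zmod_seven.2 ⟨fun _ => ⟨rfl, rfl⟩,
      key (A.Ns₂.ne H).1.1.symm, key (A.Na'.ne H).1.2.2.1.symm, key (A.Na.ne H).1.1.symm,
          key (A.Na'.ne H).1.2.2.2.symm, key (A.Na.ne H).1.2.2.1.symm,
          key (A.Na.ne H).1.2.2.2.symm⟩,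
      forall_zmod_seven.2 ⟨key A.Nx.adj₃.ne', key (nt A.Nx.adj₄ A.Ns₂.adj₂ A.Nt.adj₅),
          key (nz A.Nz.adj₅), key (nt A.Nx.adj₁ A.Na.adj₂ A.Ne.adj₃), key (nz A.Nz.adj₄),
          key (nz A.Nz.adj₃), key (nz A.Nz.adj₂)⟩⟩
  · exact Fin.forall_fin_two.2 ⟨forall_zmod_seven.2
      ⟨A.Nx.adj₁.ne', A.Nx.adj₅.ne', A.Nx.adj₄.ne', (nt A.Nx.adj₁ A.Na.adj₂ A.Ne.adj₅),
      A.Nx.adj₂.ne', (nt A.Nx.adj₁ A.Na.adj₂ A.Ne.adj₄), (nz A.Nz.adj₁)⟩,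
      forall_zmod_seven.2 ⟨(A.Na.ne H).1.2.1.symm, (A.Ns₁.ne H).1.2.2.2.symm,
          (A.Ns₁.ne H).1.2.2.1.symm, (nf A.Nx.adj₁ A.Nx.adj₁).symm, (A.Na'.ne H).1.2.1.symm,
          (ng A.Nx.adj₁ A.Nx.adj₁).symm, A.far.ne.symm⟩⟩

end SimpleGraph.PairedGraph

namespace SimpleGraph.BadConfig

variable {r₁ v₁ v₂ v₃ : V}

theorem nonempty_iso_of_eq (C : G.BadConfig x z a e a' s₁ s₂ s₃ y₁ y₂ y₃ q₁ q₂ q₃ w₁ w₂ w₃)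
    (D : G.BadConfig x z a' e a s₁ s₂ s₃ u₁ u₂ u₃ r₁ r₂ r₃ v₁ v₂ v₃) (H : G.HasCounts 5 0 2)
    (hG : G.Connected) (hq : q₁ = r₁) :
    Nonempty (G ≃g (⊤ : SimpleGraph (Fin 2)).boxProd delta41) := by
  subst hq
  obtain ⟨t, T, T', h, A⟩ := C.exists_pairedGraph D H
  exact A.nonempty_iso H hG

/-- Paired configurations meet at some `qᵢ = rᵢ`, and `rotate` moves `i` to 1. Otherwise, since `qᵢ
≠ rⱼ` for `i ≠ j` by `ne_of_paired`, the vertex `z` would have six neighbours. -/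
theorem nonempty_iso (C : G.BadConfig x z a e a' s₁ s₂ s₃ y₁ y₂ y₃ q₁ q₂ q₃ w₁ w₂ w₃)
    (D : G.BadConfig x z a' e a s₁ s₂ s₃ u₁ u₂ u₃ r₁ r₂ r₃ v₁ v₂ v₃) (H : G.HasCounts 5 0 2)
    (hG : G.Connected) : Nonempty (G ≃g (⊤ : SimpleGraph (Fin 2)).boxProd delta41) := by
  have C2 := C.rotate
  have D2 := D.rotate
  by_cases h1 : q₁ = r₁
  · exact C.nonempty_iso_of_eq D H hG h1
  by_cases h2 : q₂ = r₂
  · exact C2.nonempty_iso_of_eq D2 H hG h2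
  by_cases h3 : q₃ = r₃
  · exact C2.rotate.nonempty_iso_of_eq D2.rotate H hG h3
  exfalso
  have n12 := C.ne_of_paired D H
  have n23 := C2.ne_of_paired D2 H
  have n31 := C2.rotate.ne_of_paired D2.rotate H
  have n21 := C.swap.ne_of_paired D.swap H
  have n13 := C2.swap.rotate.rotate.ne_of_paired D2.swap.rotate.rotate H
  have n32 := C2.swap.ne_of_paired D2.swap H
  obtain ⟨-, ⟨-, -⟩, ⟨c23, -⟩, -⟩ := C.N₁.ne H
  obtain ⟨-, ⟨-, -⟩, ⟨c13, -⟩, -⟩ := C.N₂.ne H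
  obtain ⟨-, ⟨-, -⟩, ⟨c12, -⟩, -⟩ := C.N₃.ne H
  obtain ⟨-, ⟨-, -⟩, ⟨d12, -⟩, -⟩ := D.N₃.ne H
  have hz := H.nbrs_of (nodup_five c12 c13 h1 n12 c23 n21 h2 n31 n32 d12) C.zq₁ C.zq₂ C.zq₃
    D.zq₁ D.zq₂
  obtain ⟨-, ⟨-, -⟩, ⟨d13, -⟩, -⟩ := D.N₂.ne H
  obtain ⟨-, ⟨-, -⟩, ⟨d23, -⟩, -⟩ := D.N₁.ne H
  rcases (hz _).1 D.zq₃ with h | h | h | h | h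
  · exact n13 h.symm
  · exact n23 h.symm
  · exact h3 h.symm
  · exact d13 h.symm
  · exact d23 h.symm

end SimpleGraph.BadConfig
end PairedGraphs

/-! ### The neighbourhood table of the 5-cube. -/

section CubeGraphs

variable {V : Type*} [Fintype V] [DecidableEq V] {G : SimpleGraph V} [DecidableRel G.Adj]
variable {x z c p₁ p₂ p₃ p₄ e₁ e₂ e₃ e₄ q₁ q₂ q₃ q₄ y₁₂ y₁₃ y₁₄ y₂₃ y₂₄ y₃₄ w₁₂ w₁₃ w₁₄ w₂₃ w₂₄ w₃₄
    f : V}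

/-- The neighbourhoods of the vertices at distance at most one from `x` or from its neighbour
`c`, and of the vertices of the middle layer, in a graph that looks like the `5`-cube. -/
structure SimpleGraph.CubeGraph (G : SimpleGraph V)
    (x z c p₁ p₂ p₃ p₄ e₁ e₂ e₃ e₄ q₁ q₂ q₃ q₄ y₁₂ y₁₃ y₁₄ y₂₃ y₂₄ y₃₄ w₁₂ w₁₃ w₁₄ w₂₃ w₂₄ w₃₄ : V)
        : Prop where
  far : G.Far x z
  Nx : G.Nbrs x p₁ p₂ p₃ p₄ c
  Nc : G.Nbrs c x e₁ e₂ e₃ e₄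
  Np₁ : G.Nbrs p₁ x e₁ y₁₂ y₁₃ y₁₄
  Ne₁ : G.Nbrs e₁ p₁ c w₁₂ w₁₃ w₁₄
  Np₂ : G.Nbrs p₂ x e₂ y₁₂ y₂₃ y₂₄
  Ne₂ : G.Nbrs e₂ p₂ c w₁₂ w₂₃ w₂₄
  Np₃ : G.Nbrs p₃ x e₃ y₁₃ y₂₃ y₃₄
  Ne₃ : G.Nbrs e₃ p₃ c w₁₃ w₂₃ w₃₄
  Np₄ : G.Nbrs p₄ x e₄ y₁₄ y₂₄ y₃₄
  Ne₄ : G.Nbrs e₄ p₄ c w₁₄ w₂₄ w₃₄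
  Ny₁₂ : G.Nbrs y₁₂ p₁ p₂ q₃ q₄ w₁₂
  Ny₁₃ : G.Nbrs y₁₃ p₁ p₃ q₂ q₄ w₁₃
  Ny₁₄ : G.Nbrs y₁₄ p₁ p₄ q₂ q₃ w₁₄
  Ny₂₃ : G.Nbrs y₂₃ p₂ p₃ q₁ q₄ w₂₃
  Ny₂₄ : G.Nbrs y₂₄ p₂ p₄ q₁ q₃ w₂₄
  Ny₃₄ : G.Nbrs y₃₄ p₃ p₄ q₁ q₂ w₃₄
  zq₁ : G.Adj z q₁
  zq₂ : G.Adj z q₂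
  zq₃ : G.Adj z q₃
  zq₄ : G.Adj z q₄
  e_not_mid₁ : ∀ q, G.Adj z q → ¬ G.Adj e₁ q
  e_not_mid₂ : ∀ q, G.Adj z q → ¬ G.Adj e₂ q
  e_not_mid₃ : ∀ q, G.Adj z q → ¬ G.Adj e₃ q
  e_not_mid₄ : ∀ q, G.Adj z q → ¬ G.Adj e₄ q
  not_adj_w₁₂ : ¬ G.Adj x w₁₂ ∧ ¬ G.Adj z w₁₂
  not_adj_w₁₃ : ¬ G.Adj x w₁₃ ∧ ¬ G.Adj z w₁₃
  not_adj_w₁₄ : ¬ G.Adj x w₁₄ ∧ ¬ G.Adj z w₁₄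
  not_adj_w₂₃ : ¬ G.Adj x w₂₃ ∧ ¬ G.Adj z w₂₃
  not_adj_w₂₄ : ¬ G.Adj x w₂₄ ∧ ¬ G.Adj z w₂₄
  not_adj_w₃₄ : ¬ G.Adj x w₃₄ ∧ ¬ G.Adj z w₃₄
  qq : [q₁, q₂, q₃, q₄].Nodup

namespace SimpleGraph.CubeGraph

/-- With `swap` this generates all permutations of the four indices, so `exists_end` and
`nbrs_third` are proved for one choice only. -/
theorem rotate (A : G.CubeGraph x z c p₁ p₂ p₃ p₄ e₁ e₂ e₃ e₄ q₁ q₂ q₃ q₄ y₁₂ y₁₃ y₁₄ y₂₃ y₂₄ y₃₄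
    w₁₂ w₁₃ w₁₄ w₂₃ w₂₄ w₃₄) :
    G.CubeGraph x z c p₂ p₃ p₄ p₁ e₂ e₃ e₄ e₁ q₂ q₃ q₄ q₁ y₂₃ y₂₄ y₁₂ y₃₄ y₁₃ y₁₄ w₂₃ w₂₄ w₁₂ w₃₄
        w₁₃ w₁₄ where
  far := A.far
  Nx := A.Nx.perm fun u => by ac_rfl
  Nc := A.Nc.perm fun u => by ac_rfl
  Np₁ := A.Np₂.perm fun u => by ac_rfl
  Ne₁ := A.Ne₂.perm fun u => by ac_rfl
  Np₂ := A.Np₃.perm fun u => by ac_rfl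
  Ne₂ := A.Ne₃.perm fun u => by ac_rfl
  Np₃ := A.Np₄.perm fun u => by ac_rfl
  Ne₃ := A.Ne₄.perm fun u => by ac_rfl
  Np₄ := A.Np₁
  Ne₄ := A.Ne₁
  Ny₁₂ := A.Ny₂₃.perm fun u => by ac_rfl
  Ny₁₃ := A.Ny₂₄.perm fun u => by ac_rfl
  Ny₁₄ := A.Ny₁₂.perm fun u => by ac_rfl
  Ny₂₃ := A.Ny₃₄.perm fun u => by ac_rfl
  Ny₂₄ := A.Ny₁₃.perm fun u => by ac_rfl
  Ny₃₄ := A.Ny₁₄.perm fun u => by ac_rfl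
  zq₁ := A.zq₂
  zq₂ := A.zq₃
  zq₃ := A.zq₄
  zq₄ := A.zq₁
  e_not_mid₁ := A.e_not_mid₂
  e_not_mid₂ := A.e_not_mid₃
  e_not_mid₃ := A.e_not_mid₄
  e_not_mid₄ := A.e_not_mid₁
  not_adj_w₁₂ := A.not_adj_w₂₃
  not_adj_w₁₃ := A.not_adj_w₂₄
  not_adj_w₁₄ := A.not_adj_w₁₂
  not_adj_w₂₃ := A.not_adj_w₃₄
  not_adj_w₂₄ := A.not_adj_w₁₃
  not_adj_w₃₄ := A.not_adj_w₁₄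
  qq := by have := A.qq; grind

theorem swap (A : G.CubeGraph x z c p₁ p₂ p₃ p₄ e₁ e₂ e₃ e₄ q₁ q₂ q₃ q₄ y₁₂ y₁₃ y₁₄ y₂₃ y₂₄ y₃₄ w₁₂
    w₁₃ w₁₄ w₂₃ w₂₄ w₃₄) :
    G.CubeGraph x z c p₂ p₁ p₃ p₄ e₂ e₁ e₃ e₄ q₂ q₁ q₃ q₄ y₁₂ y₂₃ y₂₄ y₁₃ y₁₄ y₃₄ w₁₂ w₂₃ w₂₄ w₁₃
        w₁₄ w₃₄ where
  far := A.far
  Nx := A.Nx.perm fun u => by ac_rfl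
  Nc := A.Nc.perm fun u => by ac_rfl
  Np₁ := A.Np₂
  Ne₁ := A.Ne₂
  Np₂ := A.Np₁
  Ne₂ := A.Ne₁
  Np₃ := A.Np₃.perm fun u => by ac_rfl
  Ne₃ := A.Ne₃.perm fun u => by ac_rfl
  Np₄ := A.Np₄.perm fun u => by ac_rfl
  Ne₄ := A.Ne₄.perm fun u => by ac_rfl
  Ny₁₂ := A.Ny₁₂.perm fun u => by ac_rfl
  Ny₁₃ := A.Ny₂₃
  Ny₁₄ := A.Ny₂₄
  Ny₂₃ := A.Ny₁₃
  Ny₂₄ := A.Ny₁₄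
  Ny₃₄ := A.Ny₃₄.perm fun u => by ac_rfl
  zq₁ := A.zq₂
  zq₂ := A.zq₁
  zq₃ := A.zq₃
  zq₄ := A.zq₄
  e_not_mid₁ := A.e_not_mid₂
  e_not_mid₂ := A.e_not_mid₁
  e_not_mid₃ := A.e_not_mid₃
  e_not_mid₄ := A.e_not_mid₄
  not_adj_w₁₂ := A.not_adj_w₁₂
  not_adj_w₁₃ := A.not_adj_w₂₃
  not_adj_w₁₄ := A.not_adj_w₂₄
  not_adj_w₂₃ := A.not_adj_w₁₃
  not_adj_w₂₄ := A.not_adj_w₁₄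
  not_adj_w₃₄ := A.not_adj_w₃₄
  qq := by have := A.qq; grind

theorem ne_layers (A : G.CubeGraph x z c p₁ p₂ p₃ p₄ e₁ e₂ e₃ e₄ q₁ q₂ q₃ q₄ y₁₂ y₁₃ y₁₄ y₂₃ y₂₄
    y₃₄ w₁₂ w₁₃ w₁₄ w₂₃ w₂₄ w₃₄) {y p q : V}
    (hp : G.Adj x p) (hyp : G.Adj y p) (hq : G.Adj z q) (hyq : G.Adj y q) :
    x ≠ y ∧ z ≠ y ∧ y ≠ e₁ ∧ y ≠ e₂ ∧ y ≠ e₃ ∧ y ≠ e₄ := by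
  refine ⟨?_, ?_, ?_, ?_, ?_, ?_⟩
  · rintro rfl; exact A.far.not_two q hyq hq.symm
  · rintro rfl; exact A.far.not_two p hp hyp.symm
  · rintro rfl; exact A.e_not_mid₁ q hq hyq
  · rintro rfl; exact A.e_not_mid₂ q hq hyq
  · rintro rfl; exact A.e_not_mid₃ q hq hyq
  · rintro rfl; exact A.e_not_mid₄ q hq hyq

theorem exists_end (A : G.CubeGraph x z c p₁ p₂ p₃ p₄ e₁ e₂ e₃ e₄ q₁ q₂ q₃ q₄ y₁₂ y₁₃ y₁₄ y₂₃ y₂₄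
    y₃₄ w₁₂ w₁₃ w₁₄ w₂₃ w₂₄ w₃₄)
    (H : G.HasCounts 5 0 2) {b : V} (Nz : G.Nbrs z q₁ q₂ q₃ q₄ b) :
    ∃ f, G.Nbrs q₄ z y₁₂ y₁₃ y₂₃ f ∧ (∀ p, G.Adj x p → ¬ G.Adj f p) ∧
      G.Nbrs f q₄ b w₁₂ w₁₃ w₂₃ := by
  have nz := Nz.ne H
  obtain ⟨f, hf⟩ := H.exists_fifth (v := q₄) (a := z) (b := y₁₂) (c := y₁₃) (d := y₂₃)
    (by simp [(A.ne_layers A.Nx.adj₁ A.Ny₁₂.adj₁ A.zq₃ A.Ny₁₂.adj₃).2.1,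
      (A.ne_layers A.Nx.adj₁ A.Ny₁₃.adj₁ A.zq₂ A.Ny₁₃.adj₃).2.1,
      (A.ne_layers A.Nx.adj₂ A.Ny₂₃.adj₁ A.zq₁ A.Ny₂₃.adj₃).2.1,
      (A.Np₁.ne H).2.2.1.1, (A.Np₂.ne H).2.2.1.1, (A.Np₃.ne H).2.2.1.1])
    A.zq₄.symm A.Ny₁₂.adj₄.symm A.Ny₁₃.adj₄.symm A.Ny₂₃.adj₄.symm
  obtain ⟨⟨-, -, -, m1⟩, ⟨-, -, m2⟩, ⟨-, m3⟩, m4⟩ := hf.ne H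
  have b1 : ¬ G.Adj x q₄ := fun h => A.far.not_two q₄ h A.zq₄.symm
  have b2 := A.e_not_mid₁ q₄ A.zq₄
  have b3 := A.e_not_mid₂ q₄ A.zq₄
  have b4 := A.e_not_mid₃ q₄ A.zq₄
  have b5 := A.e_not_mid₄ q₄ A.zq₄
  have right : ∀ {y p s q q' w : V}, G.Nbrs y p s q q' w → G.Adj x p → G.Adj x s →
      ¬ G.Adj z w → q₄ ≠ q → q₄ ≠ q' → ¬ G.Adj y q₄ := fun hN hp hs hw =>
    A.far.symm.not_adj_of_row (fun u => by rw [hN u]; tauto : G.Nbrs _ _ _ _ _ _) hp hs hw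
      A.zq₄
  have b6 := right A.Ny₁₄ A.Nx.adj₁ A.Nx.adj₄ A.not_adj_w₁₄.2 nz.2.1.2.1.symm nz.2.2.1.1.symm
  have b7 := right A.Ny₂₄ A.Nx.adj₂ A.Nx.adj₄ A.not_adj_w₂₄.2 nz.1.2.2.1.symm nz.2.2.1.1.symm
  have b8 := right A.Ny₃₄ A.Nx.adj₃ A.Nx.adj₄ A.not_adj_w₃₄.2 nz.1.2.2.1.symm nz.2.1.2.1.symm
  have hcx : ∀ {p}, G.Adj x p → p ≠ q₄ := fun hp => A.far.ne_of_adj hp A.zq₄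
  have hfx : ∀ p, G.Adj x p → ¬ G.Adj f p := by
    intro p hp hfp
    have hq := hf.adj₅.symm
    rcases (A.Nx p).1 hp with rfl | rfl | rfl | rfl | rfl
    · rcases (A.Np₁ f).1 hfp.symm with rfl | rfl | rfl | rfl | rfl <;> contradiction
    · rcases (A.Np₂ f).1 hfp.symm with rfl | rfl | rfl | rfl | rfl <;> contradiction
    · rcases (A.Np₃ f).1 hfp.symm with rfl | rfl | rfl | rfl | rfl <;> contradiction
    · rcases (A.Np₄ f).1 hfp.symm with rfl | rfl | rfl | rfl | rfl <;> contradiction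
    · rcases (A.Nc f).1 hfp.symm with rfl | rfl | rfl | rfl | rfl <;> contradiction
  have third := fun {p y w : V} (hp : G.Adj x p) (hyp : G.Adj y p) (hqy : G.Adj q₄ y) =>
    H.adj_third (w := w) A.far.symm A.zq₄ hqy hp hyp hf.adj₅ m1.symm hfx
  -- The second common neighbour of `z` and `f` is `b`, because each of `q₁`, `q₂`, `q₃` already
  -- shares two vertices with `q₄`.
  obtain ⟨d, hd, hzd, hfd⟩ := H.other m1 A.zq₄ hf.adj₅.symm
  have no : ∀ {y}, y ≠ z → f ≠ y → G.Adj d y → G.Adj q₄ y → False := by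
    intro y h1 h2 h3 h4
    rcases H.two hd h1 h3 h4 hzd.symm A.zq₄.symm hfd.symm hf.adj₅ with h | h
    · exact h2 h
    · exact m1 h.symm
  have hfb : G.Adj f b := by
    rcases (Nz d).1 hzd with rfl | rfl | rfl | rfl | rfl
    · exact (no (hf.ne H).1.2.2.1.symm m4.symm A.Ny₂₃.adj₃.symm hf.adj₄).elim
    · exact (no (hf.ne H).1.2.1.symm m3.symm A.Ny₁₃.adj₃.symm hf.adj₃).elim
    · exact (no (hf.ne H).1.1.symm m2.symm A.Ny₁₂.adj₃.symm hf.adj₂).elim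
    · exact absurd rfl hd
    · exact hfd
  have hbw : ∀ {w}, ¬ G.Adj z w → b ≠ w := by
    rintro w h rfl; exact h Nz.adj₅
  exact ⟨f, hf, hfx, H.nbrs_of (nodup_five nz.2.2.2 (A.Ny₁₂.ne H).2.2.2
    (A.Ny₁₃.ne H).2.2.2 (A.Ny₂₃.ne H).2.2.2 (hbw A.not_adj_w₁₂.2) (hbw A.not_adj_w₁₃.2)
    (hbw A.not_adj_w₂₃.2) (A.Ne₁.ne H).2.2.1.1 (A.Ne₂.ne H).2.2.1.1 (A.Ne₃.ne H).2.2.1.1)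
    hf.adj₅.symm hfb
    (third A.Nx.adj₁ A.Ny₁₂.adj₁ hf.adj₂ A.Ny₁₂.adj₅ A.not_adj_w₁₂.2 A.not_adj_w₁₂.1)
    (third A.Nx.adj₁ A.Ny₁₃.adj₁ hf.adj₃ A.Ny₁₃.adj₅ A.not_adj_w₁₃.2 A.not_adj_w₁₃.1)
    (third A.Nx.adj₂ A.Ny₂₃.adj₁ hf.adj₄ A.Ny₂₃.adj₅ A.not_adj_w₂₃.2 A.not_adj_w₂₃.1)⟩

theorem nbrs_third (A : G.CubeGraph x z c p₁ p₂ p₃ p₄ e₁ e₂ e₃ e₄ q₁ q₂ q₃ q₄ y₁₂ y₁₃ y₁₄ y₂₃ y₂₄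
    y₃₄ w₁₂ w₁₃ w₁₄ w₂₃ w₂₄ w₃₄)
    (H : G.HasCounts 5 0 2) {f f' : V} (Nf : ∀ p, G.Adj x p → ¬ G.Adj f p)
    (Nf' : ∀ p, G.Adj x p → ¬ G.Adj f' p) (h : G.Adj f w₁₂) (h' : G.Adj f' w₁₂)
    (hff : f ≠ f') : G.Nbrs w₁₂ y₁₂ e₁ e₂ f f' := by
  have nf : ∀ {y p}, G.Adj x p → G.Adj y p → y ≠ f := by
    rintro y p hp hy rfl; exact Nf p hp hy
  have nf' : ∀ {y p}, G.Adj x p → G.Adj y p → y ≠ f' := by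
    rintro y p hp hy rfl; exact Nf' p hp hy
  exact H.nbrs_of (nodup_five (A.Np₁.ne H).2.1.1.symm (A.Np₂.ne H).2.1.1.symm
    (nf A.Nx.adj₁ A.Ny₁₂.adj₁) (nf' A.Nx.adj₁ A.Ny₁₂.adj₁) (A.Nc.ne H).2.1.1
    (nf A.Nx.adj₁ A.Ne₁.adj₁) (nf' A.Nx.adj₁ A.Ne₁.adj₁) (nf A.Nx.adj₂ A.Ne₂.adj₁)
    (nf' A.Nx.adj₂ A.Ne₂.adj₁) hff) A.Ny₁₂.adj₅.symm A.Ne₁.adj₃.symm A.Ne₂.adj₃.symm h.symm h'.symm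

set_option maxHeartbeats 2000000 in
-- The first four coordinates form the support of a vertex: `pᵢ`, `yᵢⱼ`, `qₗ` (all but `l`) and `z`.
-- The fifth, in the direction of `c`, turns `x`, `pᵢ`, `yᵢⱼ`, `qₗ`, `z` into `c`, `eᵢ`, `wᵢⱼ`,
-- `fₗ`, `b`.
theorem nonempty_iso (A : G.CubeGraph x z c p₁ p₂ p₃ p₄ e₁ e₂ e₃ e₄ q₁ q₂ q₃ q₄ y₁₂ y₁₃ y₁₄ y₂₃ y₂₄
    y₃₄ w₁₂ w₁₃ w₁₄ w₂₃ w₂₄ w₃₄)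
    (H : G.HasCounts 5 0 2) (hG : G.Connected) : Nonempty (G ≃g hypercubeGraph 5) := by
  obtain ⟨b, Nz⟩ := H.exists_fifth A.qq A.zq₁ A.zq₂ A.zq₃ A.zq₄
  have A1 := A.rotate
  have A2 := A1.rotate
  have A3 := A2.rotate
  have S1 := A.swap.rotate
  have S3 := S1.rotate.rotate
  obtain ⟨f₄, Nq₄, hf₄, Nf₄⟩ := A.exists_end H Nz
  obtain ⟨f₁, Nq₁, hf₁, Nf₁⟩ := A1.exists_end (b := b) H (Nz.perm fun u => by ac_rfl)
  obtain ⟨f₂, Nq₂, hf₂, Nf₂⟩ := A2.exists_end (b := b) H (Nz.perm fun u => by ac_rfl)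
  obtain ⟨f₃, Nq₃, hf₃, Nf₃⟩ := A3.exists_end (b := b) H (Nz.perm fun u => by ac_rfl)
  have nz := Nz.ne H
  have hff : ∀ {q q' y f f'}, q ≠ q' → G.Adj q z → G.Adj q' z → G.Adj q y → G.Adj q' y →
      G.Adj q f → G.Adj q' f' → z ≠ y → z ≠ f → y ≠ f → f ≠ f' := by
    rintro q q' y f f' hq h1 h2 h3 h4 h5 h6 hy n1 n2 rfl
    rcases H.two hq hy h1 h2 h3 h4 h5 h6 with h | h
    · exact n1 h.symm
    · exact n2 h.symm
  have g₃₄ := hff nz.2.2.1.1 Nq₃.adj₁ Nq₄.adj₁ Nq₃.adj₄ Nq₄.adj₂ Nq₃.adj₅ Nq₄.adj₅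
    (Nq₃.ne H).1.2.2.1 (Nq₃.ne H).1.2.2.2 (Nq₃.ne H).2.2.2
  have g₂₄ := hff nz.2.1.2.1 Nq₂.adj₁ Nq₄.adj₁ Nq₂.adj₃ Nq₄.adj₃ Nq₂.adj₅ Nq₄.adj₅
    (Nq₂.ne H).1.2.1 (Nq₂.ne H).1.2.2.2 (Nq₂.ne H).2.2.1.2
  have g₂₃ := hff nz.2.1.1 Nq₂.adj₁ Nq₃.adj₁ Nq₂.adj₄ Nq₃.adj₂ Nq₂.adj₅ Nq₃.adj₅
    (Nq₂.ne H).1.2.2.1 (Nq₂.ne H).1.2.2.2 (Nq₂.ne H).2.2.2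
  have g₁₄ := hff nz.1.2.2.1 Nq₁.adj₁ Nq₄.adj₁ Nq₁.adj₂ Nq₄.adj₄ Nq₁.adj₅ Nq₄.adj₅
    (Nq₁.ne H).1.1 (Nq₁.ne H).1.2.2.2 (Nq₁.ne H).2.1.2.2
  have g₁₃ := hff nz.1.2.1 Nq₁.adj₁ Nq₃.adj₁ Nq₁.adj₃ Nq₃.adj₃ Nq₁.adj₅ Nq₃.adj₅
    (Nq₁.ne H).1.2.1 (Nq₁.ne H).1.2.2.2 (Nq₁.ne H).2.2.1.2
  have g₁₂ := hff nz.1.1 Nq₁.adj₁ Nq₂.adj₁ Nq₁.adj₄ Nq₂.adj₂ Nq₁.adj₅ Nq₂.adj₅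
    (Nq₁.ne H).1.2.2.1 (Nq₁.ne H).1.2.2.2 (Nq₁.ne H).2.2.2
  have Nw₁₂ := A.nbrs_third H hf₃ hf₄ Nf₃.adj₅ Nf₄.adj₃ g₃₄
  have Nw₁₃ := S1.nbrs_third H hf₄ hf₂ Nf₄.adj₄ Nf₂.adj₄ g₂₄.symm
  have Nw₁₄ := A3.nbrs_third H hf₂ hf₃ Nf₂.adj₅ Nf₃.adj₃ g₂₃
  have Nw₂₃ := A1.nbrs_third H hf₄ hf₁ Nf₄.adj₅ Nf₁.adj₃ g₁₄.symm
  have Nw₂₄ := S3.nbrs_third H hf₁ hf₃ Nf₁.adj₄ Nf₃.adj₄ g₁₃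
  have Nw₃₄ := A2.nbrs_third H hf₁ hf₂ Nf₁.adj₅ Nf₂.adj₃ g₁₂
  have Nb : G.Nbrs b z f₁ f₂ f₃ f₄ := H.nbrs_of (nodup_five (Nq₁.ne H).1.2.2.2
    (Nq₂.ne H).1.2.2.2 (Nq₃.ne H).1.2.2.2 (Nq₄.ne H).1.2.2.2 g₁₂ g₁₃ g₁₄ g₂₃ g₂₄ g₃₄)
    Nz.adj₅.symm Nf₁.adj₂.symm Nf₂.adj₂.symm Nf₃.adj₂.symm Nf₄.adj₂.symm
  have nz' : ∀ {q}, G.Adj z q → q ≠ x := by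
    rintro q h rfl; exact A.far.not_adj h.symm
  have hbx := nz' Nz.adj₅
  have nf : ∀ {f}, (∀ p, G.Adj x p → ¬ G.Adj f p) → f ≠ x := by
    rintro f h rfl; exact h _ A.Nx.adj₁ A.Nx.adj₁
  have nt : ∀ {p q r}, G.Adj x p → G.Adj p q → G.Adj q r → r ≠ x := by
    rintro p q r h1 h2 h3 rfl; exact H.not_triangle h1 h2 h3.symm
  have key := fun {y : V} {b : Prop} (h : y ≠ x) (h' : y = x) => (absurd h' h : b)
  refine H.nonempty_iso_hypercube hG
    ![![![![![x, c], ![p₄, e₄]], ![![p₃, e₃], ![y₃₄, w₃₄]]], ![![![p₂, e₂], ![y₂₄, w₂₄]], ![![y₂₃,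
    w₂₃], ![q₁, f₁]]]], ![![![![p₁, e₁], ![y₁₄, w₁₄]], ![![y₁₃, w₁₃], ![q₂, f₂]]], ![![![y₁₂, w₁₂],
    ![q₃, f₃]], ![![q₄, f₄], ![z, b]]]]] ?_ ?_
  · exact Fin.forall_fin_two.2 ⟨Fin.forall_fin_two.2 ⟨Fin.forall_fin_two.2 ⟨Fin.forall_fin_two.2
      ⟨Fin.forall_fin_two.2 ⟨(show G.Nbrs x p₁ p₂ p₃ p₄ c from A.Nx.perm fun u => by ac_rfl),
      (show G.Nbrs c e₁ e₂ e₃ e₄ x from A.Nc.perm fun u => by ac_rfl)⟩,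
      Fin.forall_fin_two.2 ⟨(show G.Nbrs p₄ y₁₄ y₂₄ y₃₄ x e₄ from A.Np₄.perm fun u => by ac_rfl),
      (show G.Nbrs e₄ w₁₄ w₂₄ w₃₄ c p₄ from A.Ne₄.perm fun u => by ac_rfl)⟩⟩,
      Fin.forall_fin_two.2 ⟨Fin.forall_fin_two.2 ⟨(show G.Nbrs p₃ y₁₃ y₂₃ x y₃₄ e₃ from A.Np₃.perm
      fun u => by ac_rfl), (show G.Nbrs e₃ w₁₃ w₂₃ c w₃₄ p₃ from A.Ne₃.perm fun u => by ac_rfl)⟩,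
      Fin.forall_fin_two.2 ⟨(show G.Nbrs y₃₄ q₂ q₁ p₄ p₃ w₃₄ from A.Ny₃₄.perm fun u => by ac_rfl),
      (show G.Nbrs w₃₄ f₂ f₁ e₄ e₃ y₃₄ from Nw₃₄.perm fun u => by ac_rfl)⟩⟩⟩,
      Fin.forall_fin_two.2 ⟨Fin.forall_fin_two.2 ⟨Fin.forall_fin_two.2 ⟨(show G.Nbrs p₂ y₁₂ x y₂₃
      y₂₄ e₂ from A.Np₂.perm fun u => by ac_rfl),
      (show G.Nbrs e₂ w₁₂ c w₂₃ w₂₄ p₂ from A.Ne₂.perm fun u => by ac_rfl)⟩,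
      Fin.forall_fin_two.2 ⟨(show G.Nbrs y₂₄ q₃ p₄ q₁ p₂ w₂₄ from A.Ny₂₄.perm fun u => by ac_rfl),
      (show G.Nbrs w₂₄ f₃ e₄ f₁ e₂ y₂₄ from Nw₂₄.perm fun u => by ac_rfl)⟩⟩,
      Fin.forall_fin_two.2 ⟨Fin.forall_fin_two.2 ⟨(show G.Nbrs y₂₃ q₄ p₃ p₂ q₁ w₂₃ from A.Ny₂₃.perm
      fun u => by ac_rfl), (show G.Nbrs w₂₃ f₄ e₃ e₂ f₁ y₂₃ from Nw₂₃.perm fun u => by ac_rfl)⟩,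
      Fin.forall_fin_two.2 ⟨(show G.Nbrs q₁ z y₃₄ y₂₄ y₂₃ f₁ from Nq₁.perm fun u => by ac_rfl),
      (show G.Nbrs f₁ b w₃₄ w₂₄ w₂₃ q₁ from Nf₁.perm fun u => by ac_rfl)⟩⟩⟩⟩,
      Fin.forall_fin_two.2 ⟨Fin.forall_fin_two.2 ⟨Fin.forall_fin_two.2 ⟨Fin.forall_fin_two.2 ⟨(show
      G.Nbrs p₁ x y₁₂ y₁₃ y₁₄ e₁ from A.Np₁.perm fun u => by ac_rfl),
      (show G.Nbrs e₁ c w₁₂ w₁₃ w₁₄ p₁ from A.Ne₁.perm fun u => by ac_rfl)⟩,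
      Fin.forall_fin_two.2 ⟨(show G.Nbrs y₁₄ p₄ q₃ q₂ p₁ w₁₄ from A.Ny₁₄.perm fun u => by ac_rfl),
      (show G.Nbrs w₁₄ e₄ f₃ f₂ e₁ y₁₄ from Nw₁₄.perm fun u => by ac_rfl)⟩⟩,
      Fin.forall_fin_two.2 ⟨Fin.forall_fin_two.2 ⟨(show G.Nbrs y₁₃ p₃ q₄ p₁ q₂ w₁₃ from A.Ny₁₃.perm
      fun u => by ac_rfl), (show G.Nbrs w₁₃ e₃ f₄ e₁ f₂ y₁₃ from Nw₁₃.perm fun u => by ac_rfl)⟩,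
      Fin.forall_fin_two.2 ⟨(show G.Nbrs q₂ y₃₄ z y₁₄ y₁₃ f₂ from Nq₂.perm fun u => by ac_rfl),
      (show G.Nbrs f₂ w₃₄ b w₁₄ w₁₃ q₂ from Nf₂.perm fun u => by ac_rfl)⟩⟩⟩,
      Fin.forall_fin_two.2 ⟨Fin.forall_fin_two.2 ⟨Fin.forall_fin_two.2 ⟨(show G.Nbrs y₁₂ p₂ p₁ q₄
      q₃ w₁₂ from A.Ny₁₂.perm fun u => by ac_rfl),
      (show G.Nbrs w₁₂ e₂ e₁ f₄ f₃ y₁₂ from Nw₁₂.perm fun u => by ac_rfl)⟩,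
      Fin.forall_fin_two.2 ⟨(show G.Nbrs q₃ y₂₄ y₁₄ z y₁₂ f₃ from Nq₃.perm fun u => by ac_rfl),
      (show G.Nbrs f₃ w₂₄ w₁₄ b w₁₂ q₃ from Nf₃.perm fun u => by ac_rfl)⟩⟩,
      Fin.forall_fin_two.2 ⟨Fin.forall_fin_two.2 ⟨(show G.Nbrs q₄ y₂₃ y₁₃ y₁₂ z f₄ from Nq₄.perm
      fun u => by ac_rfl), (show G.Nbrs f₄ w₂₃ w₁₃ w₁₂ b q₄ from Nf₄.perm fun u => by ac_rfl)⟩,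
      Fin.forall_fin_two.2 ⟨(show G.Nbrs z q₁ q₂ q₃ q₄ b from Nz.perm fun u => by ac_rfl),
      (show G.Nbrs b f₁ f₂ f₃ f₄ z from Nb.perm fun u => by ac_rfl)⟩⟩⟩⟩⟩
  · exact Fin.forall_fin_two.2 ⟨Fin.forall_fin_two.2 ⟨Fin.forall_fin_two.2 ⟨Fin.forall_fin_two.2
      ⟨Fin.forall_fin_two.2 ⟨fun _ => ⟨rfl, rfl, rfl, rfl, rfl⟩, key A.Nx.adj₅.ne'⟩,
      Fin.forall_fin_two.2 ⟨key A.Nx.adj₄.ne', key (A.Np₄.ne H).1.1.symm⟩⟩,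
      Fin.forall_fin_two.2 ⟨Fin.forall_fin_two.2 ⟨key A.Nx.adj₃.ne', key (A.Np₃.ne H).1.1.symm⟩,
      Fin.forall_fin_two.2 ⟨key (A.Np₃.ne H).1.2.2.2.symm,
      key (nt A.Nx.adj₃ A.Np₃.adj₂ A.Ne₃.adj₅)⟩⟩⟩,
      Fin.forall_fin_two.2 ⟨Fin.forall_fin_two.2 ⟨Fin.forall_fin_two.2 ⟨key A.Nx.adj₂.ne',
      key (A.Np₂.ne H).1.1.symm⟩,
      Fin.forall_fin_two.2 ⟨key (A.Np₂.ne H).1.2.2.2.symm,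
      key (nt A.Nx.adj₂ A.Np₂.adj₂ A.Ne₂.adj₅)⟩⟩,
      Fin.forall_fin_two.2 ⟨Fin.forall_fin_two.2 ⟨key (A.Np₂.ne H).1.2.2.1.symm,
      key (nt A.Nx.adj₂ A.Np₂.adj₂ A.Ne₂.adj₄)⟩,
      Fin.forall_fin_two.2 ⟨key (nz' A.zq₁), key (nf hf₁)⟩⟩⟩⟩,
      Fin.forall_fin_two.2 ⟨Fin.forall_fin_two.2 ⟨Fin.forall_fin_two.2 ⟨Fin.forall_fin_two.2 ⟨key
      A.Nx.adj₁.ne', key (A.Np₁.ne H).1.1.symm⟩,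
      Fin.forall_fin_two.2 ⟨key (A.Np₁.ne H).1.2.2.2.symm,
      key (nt A.Nx.adj₁ A.Np₁.adj₂ A.Ne₁.adj₅)⟩⟩,
      Fin.forall_fin_two.2 ⟨Fin.forall_fin_two.2 ⟨key (A.Np₁.ne H).1.2.2.1.symm,
      key (nt A.Nx.adj₁ A.Np₁.adj₂ A.Ne₁.adj₄)⟩,
      Fin.forall_fin_two.2 ⟨key (nz' A.zq₂), key (nf hf₂)⟩⟩⟩,
      Fin.forall_fin_two.2 ⟨Fin.forall_fin_two.2 ⟨Fin.forall_fin_two.2 ⟨key (A.Np₁.ne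
      H).1.2.1.symm, key (nt A.Nx.adj₁ A.Np₁.adj₂ A.Ne₁.adj₃)⟩,
      Fin.forall_fin_two.2 ⟨key (nz' A.zq₃), key (nf hf₃)⟩⟩,
      Fin.forall_fin_two.2 ⟨Fin.forall_fin_two.2 ⟨key (nz' A.zq₄), key (nf hf₄)⟩,
      Fin.forall_fin_two.2 ⟨key A.far.ne.symm, key hbx⟩⟩⟩⟩⟩

end SimpleGraph.CubeGraph
end CubeGraphs

/-! ### From a configuration whose partner misses the layer to the cube. -/

section CubeConfigs

variable {V : Type*} [Fintype V] [DecidableEq V] {G : SimpleGraph V} [DecidableRel G.Adj]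
variable {x z a e a' s₁ s₂ s₃ y₁ y₂ y₃ q₁ q₂ q₃ w₁ w₂ w₃ : V}

namespace SimpleGraph.BadConfig

/-- As `a'` misses the layer, the second common neighbour of `a'` and `s₁` lies outside it, so `s₁`
carries a configuration with partner `a'`. The vertex `y₁` belongs to both configurations, which
fixes `q₂` and `q₃` up to order. -/
theorem exists_side (C : G.BadConfig x z a e a' s₁ s₂ s₃ y₁ y₂ y₃ q₁ q₂ q₃ w₁ w₂ w₃)
    (H : G.HasCounts 5 0 2) (hA : ∀ t q, G.Adj a' t → G.Adj z q → ¬ G.Adj t q) :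
    ∃ e₁ t₂ t₃ c v₂ v₃, G.BadConfig x z s₁ e₁ a' a s₂ s₃ y₁ t₂ t₃ c q₂ q₃ w₁ v₂ v₃ ∨
      G.BadConfig x z s₁ e₁ a' a s₂ s₃ y₁ t₂ t₃ c q₃ q₂ w₁ v₂ v₃ := by
  have nx := C.Nx.ne H
  obtain ⟨e₁, hx, h2, h3⟩ := H.other nx.2.1.1 C.Nx.adj₂.symm C.Nx.adj₃.symm
  obtain ⟨t₁, t₂, t₃, c₁, c₂, c₃, v₁, v₂, v₃, D⟩ := H.exists_badConfig_of C.far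
    (a := s₁) (a' := a') (s₁ := a) (s₂ := s₂) (s₃ := s₃) (e := e₁) (y := y₁) (q := q₂)
    (C.Nx.perm fun u => by ac_rfl) C.N₁.adj₂.symm C.zq₂ C.N₁.adj₃ h3 h2 hx
    (fun q hq => hA _ q h2 hq)
  have hyx : ∀ {y q}, G.Adj y q → G.Adj z q → y ≠ x := by
    rintro y q h1 h2 rfl
    exact C.far.not_two q h1 h2.symm
  obtain rfl : t₁ = y₁ := H.common_unique nx.1.2.1 C.Nx.adj₁ C.Nx.adj₃ D.N₁.adj₂.symm
    D.N₁.adj₁.symm C.N₁.adj₁.symm C.N₁.adj₂.symm (hyx D.N₁.adj₃ D.zq₂) (hyx C.N₁.adj₃ C.zq₂)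
  obtain ⟨h, rfl⟩ := C.far.row_unique H C.N₁ D.N₁.swap₁₂ D.zq₂ D.zq₃ (D.not_adj_third H)
    C.Nx.adj₁ C.Nx.adj₃ C.zq₂ C.zq₃ (C.not_adj_third H)
  rcases h with ⟨rfl, rfl⟩ | ⟨rfl, rfl⟩
  · exact ⟨e₁, t₂, t₃, c₁, v₂, v₃, Or.inl D⟩
  · exact ⟨e₁, t₂, t₃, c₁, v₂, v₃, Or.inr D⟩

/-- Two side configurations agree on the common neighbour of their base points. -/
theorem side_unique {f t t₃ u₁ u₂ u₃ r₁ r₂ r₃ v₁ v₂ v₃ : V}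
    (C : G.BadConfig x z s₁ e a' a s₂ s₃ y₁ y₂ y₃ q₁ q₂ q₃ w₁ w₂ w₃)
    (D : G.BadConfig x z s₂ f a' t s₁ t₃ u₁ u₂ u₃ r₁ r₂ r₃ v₁ v₂ v₃) (H : G.HasCounts 5 0 2) :
    u₂ = y₂ ∧ v₂ = w₂ ∧ (r₁ = q₁ ∧ r₃ = q₃ ∨ r₁ = q₃ ∧ r₃ = q₁) := by
  have nx := C.Nx.ne H
  have hyx : ∀ {y q}, G.Adj y q → G.Adj z q → y ≠ x := by
    rintro y q h1 h2 rfl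
    exact C.far.not_two q h1 h2.symm
  obtain rfl : u₂ = y₂ := H.common_unique nx.1.2.2.1 C.Nx.adj₁ C.Nx.adj₄ D.N₂.adj₂.symm
    D.N₂.adj₁.symm C.N₂.adj₁.symm C.N₂.adj₂.symm (hyx D.N₂.adj₃ D.zq₁) (hyx C.N₂.adj₃ C.zq₁)
  obtain ⟨h, rfl⟩ := C.far.row_unique H C.N₂ D.N₂.swap₁₂ D.zq₁ D.zq₃ (D.swap.not_adj_third H)
    C.Nx.adj₁ C.Nx.adj₄ C.zq₁ C.zq₃ (C.swap.not_adj_third H)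
  exact ⟨rfl, rfl, h⟩

/-- The points opposite to the side configuration at `s₁` are in the expected order. -/
theorem not_side_swap {e₁ e₂ t₂ t₃ u₂ u₃ c d v₂ v₃ k₂ k₃ r r' : V}
    (C : G.BadConfig x z a e a' s₁ s₂ s₃ y₁ y₂ y₃ q₁ q₂ q₃ w₁ w₂ w₃)
    (D : G.BadConfig x z s₁ e₁ a' a s₂ s₃ y₁ t₂ t₃ c q₃ q₂ w₁ v₂ v₃)
    (E : G.BadConfig x z s₂ e₂ a' a s₁ s₃ y₂ u₂ u₃ d r r' w₂ k₂ k₃) (hr : r' = q₁ ∨ r' = q₃)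
    (H : G.HasCounts 5 0 2) : False := by
  obtain ⟨rfl, rfl, h⟩ := D.side_unique E H
  have n : y₃ ≠ u₂ := by
    refine G.ne_of_adj_of_not_adj C.N₃.adj₁ (C.far.not_adj_of_row D.N₂ D.zq₁ D.zq₃
      (D.swap.not_adj_third H).1 C.Nx.adj₁ (C.Nx.ne H).1.2.1 (C.Nx.ne H).1.2.2.1)
  -- The two descriptions of `u₂` force `c = q₁`. Then `u₂` and `y₃` have the same pair `q₁`, `q₂`
  -- next to `z`.
  have B := C.rotate.rotate.not_both D.rotate H n
  have n1 := C.N₃.ne H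
  have n2 := D.N₃.ne H
  have n3 := D.N₂.ne H
  have n4 := C.N₁.ne H
  grind

/-- The configurations at `s₁`, `s₂`, `s₃` overlap pairwise in a layer vertex. Comparing them
identifies these vertices and shows that all three have the same new point `c` next to `z`, which
becomes the first of the four `q`. -/
theorem exists_cubeGraph (C : G.BadConfig x z a e a' s₁ s₂ s₃ y₁ y₂ y₃ q₁ q₂ q₃ w₁ w₂ w₃)
    (H : G.HasCounts 5 0 2) (hA : ∀ t q, G.Adj a' t → G.Adj z q → ¬ G.Adj t q) :
    ∃ e₁ e₂ e₃ c t₁₂ t₁₃ t₂₃ k₁₂ k₁₃ k₂₃, G.CubeGraph x z a' a s₁ s₂ s₃ e e₁ e₂ e₃ c q₁ q₂ q₃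
      y₁ y₂ y₃ t₁₂ t₁₃ t₂₃ w₁ w₂ w₃ k₁₂ k₁₃ k₂₃ := by
  obtain ⟨e₁, t₁₂, t₁₃, c, k₁₂, k₁₃, D₁⟩ := C.exists_side H hA
  obtain ⟨e₂, t₂₁, t₂₃, d, k₂₁, k₂₃, D₂⟩ := C.swap.exists_side H hA
  obtain ⟨e₃, t₃₁, t₃₂, g, k₃₁, k₃₂, D₃⟩ := C.rotate.rotate.exists_side H hA
  -- A wrong order at `s₁` contradicts either order at `s₂`; the right order at `s₁` then excludes
  -- wrong ones at `s₂` and `s₃`.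
  replace D₁ := D₁.resolve_right fun D => D₂.elim
    (fun E => C.not_side_swap D E (Or.inr rfl) H) fun E => C.not_side_swap D E (Or.inl rfl) H
  replace D₂ := D₂.resolve_right fun D => C.swap.not_side_swap D D₁ (Or.inr rfl) H
  replace D₃ := D₃.resolve_right fun D =>
    C.rotate.rotate.not_side_swap D D₁.rotate.swap.rotate.rotate (Or.inr rfl) H
  obtain ⟨rfl, rfl, h₁₂⟩ := D₁.side_unique D₂ H
  obtain rfl : d = c := h₁₂.elim And.left fun h => absurd h.1 (D₂.N₂.ne H).2.2.1.1
  obtain ⟨rfl, rfl, h₁₃⟩ := D₁.rotate.swap.rotate.rotate.side_unique D₃ H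
  obtain rfl : g = d := h₁₃.elim And.left fun h => absurd h.1 (D₃.N₂.ne H).2.2.1.1
  obtain ⟨rfl, rfl, -⟩ :=
    D₂.rotate.swap.rotate.rotate.side_unique D₃.rotate.swap.rotate.rotate H
  have nx := C.Nx.ne H
  have no : ∀ {e s w w' w'' p}, G.Nbrs e s a' w w' w'' → ¬ G.Adj x w → ¬ G.Adj x w' →
      ¬ G.Adj x w'' → G.Adj x p → p ≠ s → p ≠ a' → ¬ G.Adj e p := by
    intro e s w w' w'' p hN h1 h2 h3 hp n1 n2 h
    rcases (hN p).1 h with rfl | rfl | rfl | rfl | rfl <;> contradiction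
  have m₁ := C.not_adj_third H
  have m₂ := C.swap.not_adj_third H
  have m₃ := C.rotate.rotate.not_adj_third H
  have m₁₂ := D₁.swap.not_adj_third H
  have m₁₃ := D₁.rotate.rotate.not_adj_third H
  have m₂₃ := D₂.rotate.rotate.not_adj_third H
  have no₁ := fun {p} => no (p := p) D₁.Ne m₁.1 m₁₂.1 m₁₃.1
  have no₂ := fun {p} => no (p := p) D₂.Ne m₂.1 m₁₂.1 m₂₃.1
  have no₃ := fun {p} => no (p := p) D₃.Ne m₃.1 m₁₃.1 m₂₃.1
  refine ⟨e₁, e₂, e₃, _, _, _, _, _, _, _,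
    { far := C.far
      Nx := C.Nx.perm fun u => by ac_rfl
      Nc := H.nbrs_of (nodup_five (C.Na.ne H).1.1 (D₁.Na.ne H).1.1 (D₂.Na.ne H).1.1
        (D₃.Na.ne H).1.1
        (G.ne_of_adj_of_not_adj C.Ne.adj₁ (no₁ C.Nx.adj₁ nx.1.2.1 nx.1.1))
        (G.ne_of_adj_of_not_adj C.Ne.adj₁ (no₂ C.Nx.adj₁ nx.1.2.2.1 nx.1.1))
        (G.ne_of_adj_of_not_adj C.Ne.adj₁ (no₃ C.Nx.adj₁ nx.1.2.2.2 nx.1.1))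
        (G.ne_of_adj_of_not_adj D₁.Ne.adj₁ (no₂ C.Nx.adj₃ nx.2.2.1.1 nx.2.1.1.symm))
        (G.ne_of_adj_of_not_adj D₁.Ne.adj₁ (no₃ C.Nx.adj₃ nx.2.2.1.2 nx.2.1.1.symm))
        (G.ne_of_adj_of_not_adj D₂.Ne.adj₁ (no₃ C.Nx.adj₄ nx.2.2.2 nx.2.1.2.1.symm)))
        C.Nx.adj₂.symm C.Ne.adj₂.symm D₁.Ne.adj₂.symm D₂.Ne.adj₂.symm D₃.Ne.adj₂.symm
      Np₁ := C.Na
      Ne₁ := C.Ne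
      Np₂ := D₁.Na
      Ne₂ := D₁.Ne
      Np₃ := D₂.Na
      Ne₃ := D₂.Ne
      Np₄ := D₃.Na
      Ne₄ := D₃.Ne
      Ny₁₂ := C.N₁
      Ny₁₃ := C.N₂
      Ny₁₄ := C.N₃
      Ny₂₃ := D₁.N₂
      Ny₂₄ := D₁.N₃
      Ny₃₄ := D₂.N₃
      zq₁ := D₁.zq₁
      zq₂ := C.zq₁
      zq₃ := C.zq₂
      zq₄ := C.zq₃
      e_not_mid₁ := C.not_mid
      e_not_mid₂ := D₁.not_mid
      e_not_mid₃ := D₂.not_mid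
      e_not_mid₄ := D₃.not_mid
      not_adj_w₁₂ := m₁
      not_adj_w₁₃ := m₂
      not_adj_w₁₄ := m₃
      not_adj_w₂₃ := m₁₂
      not_adj_w₂₄ := m₁₃
      not_adj_w₃₄ := m₂₃
      qq := by
        simp [(D₂.N₃.ne H).2.2.1.1, (D₁.N₃.ne H).2.2.1.1, (D₁.N₂.ne H).2.2.1.1,
          (C.N₃.ne H).2.2.1.1, (C.N₂.ne H).2.2.1.1, (C.N₁.ne H).2.2.1.1] }⟩

end SimpleGraph.BadConfig
end CubeConfigs

/-! ### Distances, diameters, and the passage from the hypotheses to the counts. -/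

section Distances

variable {V : Type*} {G : SimpleGraph V}

theorem SimpleGraph.diam_le_of_edist_le {n : ℕ} (h : ∀ u v, G.edist u v ≤ n) : G.diam ≤ n :=
  ENat.toNat_le_of_le_natCast (G.ediam_le_of_edist_le h)

theorem SimpleGraph.Iso.edist_le {W : Type*} {K : SimpleGraph W} (φ : G ≃g K) (u v : V) :
    G.edist u v ≤ K.edist (φ u) (φ v) := by
  by_cases h : K.edist (φ u) (φ v) = ⊤
  · rw [h]; exact le_top
  obtain ⟨p, hp⟩ := K.exists_walk_of_edist_ne_top h
  have := (p.map φ.symm.toHom).edist_le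
  rw [SimpleGraph.Walk.length_map, hp] at this
  simpa using this

theorem edist_delta41_le (u v : ZMod 7 ⊕ ZMod 7) : delta41.edist u v ≤ 3 := by
  have key : ∀ (p b : ZMod 7), ∃ b' p', design742 p b' ∧ design742 p' b' ∧ design742 p' b := by
    decide
  have hpp : ∀ p p' : ZMod 7, ∃ b, design742 p b ∧ design742 p' b := by decide
  have hbb : ∀ b b' : ZMod 7, ∃ p, design742 p b ∧ design742 p b' := by decide
  have hadj : ∀ {p b}, design742 p b → delta41.Adj (.inl p) (.inr b) := id
  have hpb : ∀ p b, delta41.edist (.inl p) (.inr b) ≤ 3 := by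
    intro p b
    obtain ⟨b', p', h1, h2, h3⟩ := key p b
    exact SimpleGraph.edist_le (.cons (hadj h1) (.cons (hadj h2).symm (.cons (hadj h3) .nil)))
  rcases u with p | b <;> rcases v with p' | b'
  · obtain ⟨b, h1, h2⟩ := hpp p p'
    exact (SimpleGraph.edist_le (.cons (hadj h1) (.cons (hadj h2).symm .nil))).trans
      (by norm_num)
  · exact hpb p b'
  · rw [SimpleGraph.edist_comm]
    exact hpb p' b
  · obtain ⟨p, h1, h2⟩ := hbb b b'
    exact (SimpleGraph.edist_le (.cons (hadj h1).symm (.cons (hadj h2) .nil))).trans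
      (by norm_num)

theorem edist_boxProd_delta41_le (u v : Fin 2 × (ZMod 7 ⊕ ZMod 7)) :
    ((⊤ : SimpleGraph (Fin 2)).boxProd delta41).edist u v ≤ (4 : ℕ) := by
  rw [SimpleGraph.edist_boxProd, SimpleGraph.edist_top]
  have := edist_delta41_le u.2 v.2
  calc _ ≤ (1 : ℕ∞) + 3 := add_le_add (by split_ifs <;> simp) this
    _ = _ := by norm_num

variable [Fintype V] [DecidableEq V] [DecidableRel G.Adj]

/-- Distinct non-adjacent vertices with a common neighbour are at distance exactly two.
Connectedness supplies the lower bound, as `dist` takes the default value 0 between components. -/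
theorem SimpleGraph.IsAmplyRegularWith.hasCounts {v k lam mu : ℕ} (hG : G.Connected)
    (h : G.IsAmplyRegularWith v k lam mu) : G.HasCounts k lam mu := by
  have key : ∀ x y, (G.neighborFinset x ∩ G.neighborFinset y).card =
      Fintype.card (G.commonNeighbors x y) := by
    intro x y
    rw [← Set.toFinset_card]
    congr 1
    ext u
    simp [SimpleGraph.mem_commonNeighbors]
  refine ⟨h.regular, fun x y hxy => (key x y).trans (h.of_adj x y hxy), ?_⟩
  intro x y p hne hxy h1 h2
  rw [key]
  refine h.of_dist_two x y (le_antisymm ?_ (hG.one_lt_dist_of_ne_of_not_adj hne hxy))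
  exact SimpleGraph.dist_le (.cons h1 (.cons h2.symm .nil))

/-- The first four edges of a shortest walk realising the diameter again form a shortest walk. -/
theorem SimpleGraph.Connected.exists_opp (hG : G.Connected) (hd : 4 ≤ G.diam) :
    ∃ x z, G.Opp x z := by
  have := hG.nonempty
  obtain ⟨x, z, hxz⟩ := G.exists_dist_eq_diam
  obtain ⟨p, hp⟩ := hG.exists_walk_length_eq_dist x z
  have h4 : (p.take 4).length = 4 := by
    rw [SimpleGraph.Walk.take_length]; omega
  have hs := SimpleGraph.length_eq_dist_of_subwalk hp (p.isSubwalk_take 4)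
  rw [h4] at hs
  generalize p.take 4 = w at h4
  generalize p.getVert 4 = u at hs w
  refine ⟨x, u, ⟨⟨?_, ?_, ?_, ?_⟩, ?_⟩⟩
  · rintro rfl; simp at hs
  · intro h
    have := SimpleGraph.dist_le (.cons h .nil : G.Walk x u)
    simp at this; omega
  · intro c h1 h2
    have := SimpleGraph.dist_le (.cons h1 (.cons h2 .nil) : G.Walk x u)
    simp at this; omega
  · intro c d h1 h2 h3
    have := SimpleGraph.dist_le (.cons h1 (.cons h2 (.cons h3 .nil)) : G.Walk x u)
    simp at this; omega
  · match w, h4 with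
    | .cons (v := a) h1 (.cons (v := y) h2 (.cons (v := q) h3 (.cons h4 .nil))), _ =>
      exact ⟨y, SimpleGraph.mem_mid.2 ⟨⟨a, h1, h2.symm⟩, q, h4.symm, h3⟩⟩

end Distances

/-- A graph of valency five in which some interval between vertices at distance four is not
tight. -/
theorem SimpleGraph.HasCounts.nonempty_iso_of_not_mem_mid {V : Type*} [Fintype V]
    [DecidableEq V] {G : SimpleGraph V} [DecidableRel G.Adj] {x z y a e : V}
    (H : G.HasCounts 5 0 2) (hG : G.Connected) (F : G.Far x z) (hy : y ∈ G.mid x z)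
    (hxa : G.Adj x a) (hya : G.Adj y a) (hae : G.Adj a e) (hex : e ≠ x)
    (he : e ∉ G.mid x z) : Nonempty (G ≃g hypercubeGraph 5) ∨
      Nonempty (G ≃g (⊤ : SimpleGraph (Fin 2)).boxProd delta41) := by
  obtain ⟨a', s₁, s₂, s₃, y₁, y₂, q₁, q₂, q₃, w₁, w₂, w₃, C⟩ :=
    H.exists_badConfig F hy hxa hya hae hex he
  -- The two exceptional graphs are told apart by whether the partner `a'` of `a` meets the layer.
  by_cases hA : ∀ t q, G.Adj a' t → G.Adj z q → ¬ G.Adj t q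
  · obtain ⟨e₁, e₂, e₃, c, t₁, t₂, t₃, k₁, k₂, k₃, A⟩ := C.exists_cubeGraph H hA
    exact Or.inl (A.nonempty_iso H hG)
  · push Not at hA
    obtain ⟨t, q, h1, h2, h3⟩ := hA
    obtain ⟨u₁, u₂, u₃, r₁, r₂, r₃, v₁, v₂, v₃, D⟩ := H.exists_badConfig_of F C.Nx.swap₁₂ h1 h2
      h3 C.Ne.adj₂.symm hae hex C.not_mid
    exact Or.inr (C.nonempty_iso D H hG)

theorem mainTheorem4 {V : Type*} [Fintype V] [DecidableEq V] (G : SimpleGraph V)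
    [DecidableRel G.Adj] (v k lam mu : ℕ) (hconn : G.Connected)
    (hG : G.IsAmplyRegularWith v k lam mu) (hdiam : 4 ≤ G.diam)
    (hk : 5 ≤ k) (hodd : Odd k) (hmu : mu = (k - 1) / 2) :
    Nonempty (G ≃g hypercubeGraph 5) ∨
    (Nonempty (G ≃g (⊤ : SimpleGraph (Fin 2)).boxProd delta41) ∧
      G.diam = 4 ∧ G.IsAmplyRegularWith 28 5 0 2) ∨
    ((∃ (S : AssocScheme V 5) (hS : S.IsSymmetric) (i : Fin 6) (hi : i ≠ 0),
        G = S.relationGraph hS i hi ∧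
        S.HasDistributionDiagram hS i hi (diagramSizes k) (diagramMatrix k)) ∧
      G.IsBipartite ∧ G.IsWalkRegular 2 ∧ Fintype.card V = 4 * k + 4 ∧ G.diam = 4 ∧
      G.eigenvalueSet.ncard = 6) := by
  obtain ⟨x, z, O⟩ := hconn.exists_opp hdiam
  have H := hG.hasCounts hconn
  -- Oddness makes the division in `(k - 1) / 2` exact.
  obtain rfl : k = 2 * mu + 1 := by obtain ⟨m, rfl⟩ := hodd; omega
  have hmu2 : 2 ≤ mu := by omega
  obtain rfl := H.lam_eq_zero rfl hmu2 O.toFar O.nonempty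
  have diam_eq : (∀ u v, G.edist u v ≤ (4 : ℕ)) → G.diam = 4 := fun h =>
    le_antisymm (G.diam_le_of_edist_le h) hdiam
  by_cases hT : ∀ x z y a e, G.Far x z → y ∈ G.mid x z → G.Adj x a → G.Adj y a → G.Adj a e →
      e ≠ x → e ∈ G.mid x z
  · have T : G.IsTight mu := ⟨H, hmu2, hT⟩
    choose ant hant using T.exists_opp hconn O
    exact Or.inr (Or.inr ⟨T.exists_scheme hconn hant, T.isBipartite hconn O,
      T.isWalkRegular hconn hant, T.card_vertices hconn O,
      diam_eq fun u v => T.edist_le_four hconn (hant u) v, T.ncard_eigenvalueSet hconn hant⟩)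
  · push Not at hT
    obtain ⟨x, z, y, a, e, F, hy, hxa, hya, hae, hex, he⟩ := hT
    obtain rfl : mu = 2 := by
      by_contra h
      exact he (H.mem_mid_of_three_le rfl (by omega) F hy hxa hya hae hex)
    rcases H.nonempty_iso_of_not_mem_mid hconn F hy hxa hya hae hex he with h | ⟨⟨φ⟩⟩
    · exact Or.inl h
    · refine Or.inr (Or.inl ⟨⟨φ⟩, diam_eq fun u v => (φ.edist_le u v).trans
        (edist_boxProd_delta41_le _ _), ?_, hG.regular, hG.of_adj, hG.of_dist_two⟩)
      rw [Fintype.card_congr φ.toEquiv]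
      simp [ZMod.card]
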